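/- Let $p\neq\ell$ be primes, let $F$ be a nonarchimedean local field of residue characteristic $p$ (for instance a finite extension of $\mathbb{Q}_p$), with ring of integers $\mathcal{O}_F$, residue field of order $q$ and uniformizer $\varpi$. Let $k$ be an algebraically closed field of characteristic $\ell$, with ring of Witt vectors $W(k)$. Let $n\ge 0$, $G=GL_n(F)$, $K=GL_n(\mathcal{O}_F)$, and let $U\subset G$ be the group of upper triangular unipotent matrices. Let $\psi:F\to W(k)^\times$ be an additive character of conductor zero (for $y\in F$, $\psi$ is trivial on $y\mathcal{O}_F$ if and only if $y\in\mathcal{O}_F$), and put $\psi(u)=\psi(u_{12}+u_{23}+\dots+u_{n-1,n})$ for $u\in U$. Let $\mathcal{Z}=W(k)[K\backslash G/K]$ be the spherical Hecke algebra, i.e. the $K$-bi-invariant, compactly supported functions $G\to W(k)$ with the convolution product $(f*g)(x)=\sum_{y\in G/K}f(y)g(y^{-1}x)$. For $0\le j\le n$ let $T^{(j)}\in\mathcal{Z}$ be the indicator function of $K\,\mathrm{diag}(\varpi,\dots,\varpi,1,\dots,1)\,K$ ($\varpi$ occurring $j$ times). For $\mu\in\mathbb{Z}^n$ let $\varpi^\mu=\mathrm{diag}(\varpi^{\mu_1},\dots,\varpi^{\mu_n})$.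 Let $R$ be a commutative $W(k)$-algebra and $\lambda:\mathcal{Z}\to R$ a homomorphism of $W(k)$-algebras. Let $\mathrm{Ind}_U^G\psi_R$ be the $R$-module of locally constant functions $W:G\to R$ with $W(ug)=\psi(u)W(g)$ for $u\in U$, $g\in G$, let $(\mathrm{Ind}_U^G\psi_R)^K$ be the submodule of those $W$ with $W(gk)=W(g)$ for $k\in K$, on which $z\in\mathcal{Z}$ acts by $(z*W)(x)=\sum_{h\in G/K}z(h)W(xh)$, and let $$(\mathrm{Ind}_U^G\psi_R)^{K,\lambda}=\{W\in(\mathrm{Ind}_U^G\psi_R)^K: z*W=\lambda(z)W\text{ for all }z\in\mathcal{Z}\}.$$ For a partition $\mu=(\mu_1\ge\dots\ge\mu_n\ge 0)$ let $S_\mu(T_1,\dots,T_n)\in\mathbb{Z}[T_1,\dots,T_n]$ denote the unique polynomial which becomes the Schur polynomial $\det\big(X_j^{\mu_i+n-i}\big)_{i,j}\big/\prod_{i<j}(X_i-X_j)$ when the elementary symmetric polynomial $e_i(X_1,\dots,X_n)$ is substituted for $T_i$ for all $i$. Then $q$ and $\lambda(T^{(n)})$ are units of $R$, and the following hold. (1)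 Let $W\in(\mathrm{Ind}_U^G\psi_R)^K$ satisfy $T^{(j)}*W=\lambda(T^{(j)})W$ for $1\le j\le n$. Then for every partition $\mu=(\mu_1\ge\dots\ge\mu_n\ge0)$, $$W(\varpi^\mu)=q^{\sum_{i=1}^n(i-n)\mu_i}\,S_\mu\big(\lambda(T^{(1)}),\,q\lambda(T^{(2)}),\dots,q^{i(i-1)/2}\lambda(T^{(i)}),\dots,q^{n(n-1)/2}\lambda(T^{(n)})\big)\,W(1).$$ Moreover $W(\varpi^{(\mu_1+m,\dots,\mu_n+m)})=\lambda(T^{(n)})^m\,W(\varpi^\mu)$ for all $\mu\in\mathbb{Z}^n$ and $m\in\mathbb{Z}$, and $W(\varpi^\mu)=0$ whenever $\mu\in\mathbb{Z}^n$ is not weakly decreasing. (2) Evaluation at the identity, $W\mapsto W(1)$, is an isomorphism of $R$-modules $(\mathrm{Ind}_U^G\psi_R)^{K,\lambda}\to R$. -/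

import Mathlib

open ValuativeRel

namespace Shintani

section Hecke

variable {G : Type*} [Group G]

/-- The functions `f : G → A` that are bi-invariant under `K` and supported on finitely many
cosets `gK` (for `K` compact open in a topological group: the compactly supported ones). -/
def heckeSubmodule (A : Type*) [CommRing A] (K : Subgroup G) : Submodule A (G → A) where
  carrier := {f | (∀ k ∈ K, ∀ g, f (k * g) = f g) ∧ (∀ k ∈ K, ∀ g, f (g * k) = f g) ∧
    {c : G ⧸ K | f c.out ≠ 0}.Finite}
  zero_mem' := by simp
  add_mem' := by
    rintro f g ⟨hf1, hf2, hf3⟩ ⟨hg1, hg2, hg3⟩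
    refine ⟨fun k hk x => by simp [hf1 k hk, hg1 k hk], fun k hk x => by simp [hf2 k hk, hg2 k hk],
      (hf3.union hg3).subset ?_⟩
    intro c hc
    by_contra h
    simp only [Set.mem_union, Set.mem_ofPred_eq, not_or, not_not] at h
    exact hc (by simp [h.1, h.2])
  smul_mem' := by
    rintro a f ⟨hf1, hf2, hf3⟩
    refine ⟨fun k hk x => by simp [hf1 k hk], fun k hk x => by simp [hf2 k hk], hf3.subset ?_⟩
    intro c hc h
    exact hc (by simp [h])

/-- The Hecke algebra `A[K\G/K]`. -/
def HeckeAlgebra (A : Type*) [CommRing A] (K : Subgroup G) : Type _ := heckeSubmodule A K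

variable {A : Type*} [CommRing A] {K : Subgroup G}

noncomputable instance : AddCommGroup (HeckeAlgebra A K) :=
  inferInstanceAs (AddCommGroup (heckeSubmodule A K))

noncomputable instance : Module A (HeckeAlgebra A K) :=
  inferInstanceAs (Module A (heckeSubmodule A K))

namespace HeckeAlgebra

instance : FunLike (HeckeAlgebra A K) G A where
  coe f := f.1
  coe_injective := Subtype.val_injective

@[ext] theorem ext {f g : HeckeAlgebra A K} (h : ∀ x, f x = g x) : f = g := DFunLike.ext _ _ h

theorem left_inv (f : HeckeAlgebra A K) {k : G} (hk : k ∈ K) (g : G) : f (k * g) = f g :=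
  f.2.1 k hk g

theorem right_inv (f : HeckeAlgebra A K) {k : G} (hk : k ∈ K) (g : G) : f (g * k) = f g :=
  f.2.2.1 k hk g

theorem finite_supp (f : HeckeAlgebra A K) : {c : G ⧸ K | f c.out ≠ 0}.Finite := f.2.2.2

@[simp] theorem add_apply (f g : HeckeAlgebra A K) (x : G) : (f + g) x = f x + g x := rfl
@[simp] theorem zero_apply (x : G) : (0 : HeckeAlgebra A K) x = 0 := rfl
@[simp] theorem smul_apply (a : A) (f : HeckeAlgebra A K) (x : G) : (a • f) x = a * f x := rfl

/-- A right `K`-invariant function takes the same value at `g` and at the chosen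
representative of `gK`. -/
theorem apply_out {M : Type*} {φ : G → M} (h : ∀ k ∈ K, ∀ g, φ (g * k) = φ g) (g : G) :
    φ ((g : G ⧸ K).out) = φ g := by
  obtain ⟨k, hk⟩ := QuotientGroup.mk_out_eq_mul K g
  rw [hk, h _ k.2]

/-- Left translation does not change a sum over `G ⧸ K`. -/
theorem finsum_translate {M : Type*} [AddCommMonoid M] {φ : G → M}
    (h : ∀ k ∈ K, ∀ g, φ (g * k) = φ g) (y : G) :
    ∑ᶠ c : G ⧸ K, φ (y * c.out) = ∑ᶠ c : G ⧸ K, φ c.out := by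
  rw [← finsum_comp_equiv (f := fun c : G ⧸ K => φ c.out)
    (MulAction.toPerm y : Equiv.Perm (G ⧸ K))]
  refine finsum_congr fun c => ?_
  have : (MulAction.toPerm y : Equiv.Perm (G ⧸ K)) c = ((y * c.out : G) : G ⧸ K) := by
    conv_lhs => rw [← QuotientGroup.out_eq' c]
    rfl
  rw [this, apply_out h]

theorem finite_translate (f : HeckeAlgebra A K) (y : G) :
    {c : G ⧸ K | f (y * c.out) ≠ 0}.Finite := by
  refine (f.finite_supp.preimage
    ((MulAction.toPerm y : Equiv.Perm (G ⧸ K)).injective.injOn)).subset fun c hc => ?_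
  have : (MulAction.toPerm y : Equiv.Perm (G ⧸ K)) c = ((y * c.out : G) : G ⧸ K) := by
    conv_lhs => rw [← QuotientGroup.out_eq' c]
    rfl
  simp only [Set.mem_preimage, Set.mem_ofPred_eq, this]
  rw [apply_out (φ := f) (fun k hk y => f.right_inv hk y)]
  exact hc

/-- The value at `x` of the convolution `f * g`, a sum over representatives of `G ⧸ K`. -/
noncomputable def conv (f g : HeckeAlgebra A K) (x : G) : A :=
  ∑ᶠ c : G ⧸ K, f c.out * g (c.out⁻¹ * x)

theorem term_inv (f g : HeckeAlgebra A K) (x : G) :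
    ∀ k ∈ K, ∀ y, f (y * k) * g ((y * k)⁻¹ * x) = f y * g (y⁻¹ * x) := by
  intro k hk y
  rw [f.right_inv hk, mul_inv_rev, mul_assoc, g.left_inv (K.inv_mem hk)]

/-- The cosets `c` for which some summand of the convolution at `c` is non-zero. -/
theorem finite_conv (f g : HeckeAlgebra A K) :
    {c : G ⧸ K | ∃ d : G ⧸ K, f d.out * g (d.out⁻¹ * c.out) ≠ 0}.Finite := by
  refine (f.finite_supp.image2 (fun d e : G ⧸ K => ((d.out * e.out : G) : G ⧸ K))
    g.finite_supp).subset ?_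
  rintro c ⟨d, hd⟩
  refine ⟨d, left_ne_zero_of_mul hd, ((d.out⁻¹ * c.out : G) : G ⧸ K), ?_, ?_⟩
  · simp only [Set.mem_ofPred_eq]
    rw [apply_out (φ := g) (fun k hk y => g.right_inv hk y)]
    exact right_ne_zero_of_mul hd
  · obtain ⟨k, hk⟩ := QuotientGroup.mk_out_eq_mul K (d.out⁻¹ * c.out)
    simp only [hk, mul_assoc, mul_inv_cancel_left]
    conv_rhs => rw [← QuotientGroup.out_eq' c]
    exact QuotientGroup.mk_mul_of_mem _ k.2

theorem conv_mem (f g : HeckeAlgebra A K) : conv f g ∈ heckeSubmodule A K := by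
  refine ⟨fun k hk x => ?_, fun k hk x => ?_, (finite_conv f g).subset fun c hc => ?_⟩
  · unfold conv
    rw [← finsum_translate (φ := fun y => f y * g (y⁻¹ * (k * x))) (term_inv f g _) k]
    refine finsum_congr fun c => ?_
    rw [f.left_inv hk]
    congr 2
    group
  · unfold conv
    refine finsum_congr fun c => ?_
    rw [← mul_assoc, g.right_inv hk]
  · by_contra h
    simp only [Set.mem_ofPred_eq, not_exists, not_not] at h
    exact hc (by unfold conv; simp only [h]; exact finsum_zero)

noncomputable instance : Mul (HeckeAlgebra A K) := ⟨fun f g => ⟨conv f g, conv_mem f g⟩⟩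

theorem mul_apply (f g : HeckeAlgebra A K) (x : G) :
    (f * g) x = ∑ᶠ c : G ⧸ K, f c.out * g (c.out⁻¹ * x) := rfl

/-- The indicator function of a double coset `KgK` that is a finite union of cosets `hK`. -/
noncomputable def doubleCoset (A : Type*) [CommRing A] (K : Subgroup G) (g : G)
    (h : {c : G ⧸ K | c.out ∈ DoubleCoset.doubleCoset g K K}.Finite) : HeckeAlgebra A K :=
  ⟨Set.indicator (DoubleCoset.doubleCoset g K K) 1, by
    classical
    have key : ∀ a ∈ K, ∀ b ∈ K, ∀ x, a * x * b ∈ DoubleCoset.doubleCoset g (K : Set G) K ↔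
        x ∈ DoubleCoset.doubleCoset g (K : Set G) K := by
      intro a ha b hb x
      simp only [DoubleCoset.mem_doubleCoset, SetLike.mem_coe]
      constructor
      · rintro ⟨u, hu, v, hv, e⟩
        refine ⟨a⁻¹ * u, K.mul_mem (K.inv_mem ha) hu, v * b⁻¹, K.mul_mem hv (K.inv_mem hb), ?_⟩
        rw [show x = a⁻¹ * (a * x * b) * b⁻¹ by group, e]
        group
      · rintro ⟨u, hu, v, hv, rfl⟩
        exact ⟨a * u, K.mul_mem ha hu, v * b, K.mul_mem hv hb, by group⟩
    refine ⟨fun k hk x => ?_, fun k hk x => ?_, h.subset fun c hc => ?_⟩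
    · have := key k hk 1 K.one_mem x
      rw [mul_one] at this
      simp only [Set.indicator_apply, this, Pi.one_apply]
    · have := key 1 K.one_mem k hk x
      rw [one_mul] at this
      simp only [Set.indicator_apply, this, Pi.one_apply]
    · by_contra h'
      exact hc (Set.indicator_of_notMem (s := DoubleCoset.doubleCoset g (K : Set G) K) h' _)⟩

theorem finite_doubleCoset_one :
    {c : G ⧸ K | c.out ∈ DoubleCoset.doubleCoset (1 : G) K K}.Finite := by
  refine (Set.finite_singleton ((1 : G) : G ⧸ K)).subset ?_
  intro c hc
  obtain ⟨a, ha, b, hb, e⟩ := (DoubleCoset.mem_doubleCoset).1 hc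
  have : c.out ∈ K := by rw [e, mul_one]; exact K.mul_mem ha hb
  rw [Set.mem_singleton_iff, ← QuotientGroup.out_eq' c]
  exact QuotientGroup.eq.2 (by simpa using this)

noncomputable instance : One (HeckeAlgebra A K) := ⟨doubleCoset A K 1 finite_doubleCoset_one⟩

theorem one_apply [DecidablePred (· ∈ K)] (x : G) :
    (1 : HeckeAlgebra A K) x = if x ∈ K then 1 else 0 := by
  classical
  have : x ∈ DoubleCoset.doubleCoset (1 : G) (K : Set G) K ↔ x ∈ K := by
    simp only [DoubleCoset.mem_doubleCoset, SetLike.mem_coe]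
    constructor
    · rintro ⟨a, ha, b, hb, rfl⟩
      simpa using K.mul_mem ha hb
    · intro hx
      exact ⟨x, hx, 1, K.one_mem, by simp⟩
  change Set.indicator (DoubleCoset.doubleCoset (1 : G) (K : Set G) K) (1 : G → A) x = _
  simp only [Set.indicator_apply, this, Pi.one_apply]

protected theorem mul_assoc' (f g h : HeckeAlgebra A K) : f * g * h = f * (g * h) := by
  classical
  ext x
  set S₁ := (finite_conv f g).toFinset with hS₁
  set S₂ := f.finite_supp.toFinset with hS₂
  have e1 : (f * g * h) x = ∑ c ∈ S₁, ∑ d ∈ S₂,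
      f d.out * (g (d.out⁻¹ * c.out) * h (c.out⁻¹ * x)) := by
    rw [mul_apply, finsum_eq_sum_of_support_subset (s := S₁)]
    · refine Finset.sum_congr rfl fun c _ => ?_
      rw [mul_apply, finsum_eq_sum_of_support_subset (s := S₂), Finset.sum_mul]
      · simp only [mul_assoc]
      · intro d hd
        simpa [hS₂] using left_ne_zero_of_mul hd
    · intro c hc
      have h0 : (f * g) c.out ≠ 0 := left_ne_zero_of_mul hc
      rw [mul_apply] at h0
      obtain ⟨d, hd⟩ : ∃ d : G ⧸ K, f d.out * g (d.out⁻¹ * c.out) ≠ 0 := by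
        by_contra hno
        simp only [not_exists, not_not] at hno
        exact h0 (by simp only [hno]; exact finsum_zero)
      exact (Set.Finite.mem_toFinset _).2 ⟨d, hd⟩
  have e2 : (f * (g * h)) x = ∑ d ∈ S₂, ∑ c ∈ S₁,
      f d.out * (g (d.out⁻¹ * c.out) * h (c.out⁻¹ * x)) := by
    rw [mul_apply, finsum_eq_sum_of_support_subset (s := S₂)]
    · refine Finset.sum_congr rfl fun d _ => ?_
      rw [mul_apply, ← finsum_translate (φ := fun y => g y * h (y⁻¹ * (d.out⁻¹ * x)))
        (term_inv g h _) d.out⁻¹, mul_finsum', finsum_eq_sum_of_support_subset (s := S₁)]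
      · refine Finset.sum_congr rfl fun c _ => ?_
        rw [show (d.out⁻¹ * c.out)⁻¹ * (d.out⁻¹ * x) = c.out⁻¹ * x by group]
      · intro c hc
        rw [Function.mem_support, ← mul_assoc] at hc
        exact (Set.Finite.mem_toFinset _).2 ⟨d, left_ne_zero_of_mul hc⟩
      · exact (finite_translate g _).subset fun c hc => left_ne_zero_of_mul hc
    · intro d hd
      simpa [hS₂] using left_ne_zero_of_mul hd
  rw [e1, e2, Finset.sum_comm]

protected theorem one_mul' (f : HeckeAlgebra A K) : 1 * f = f := by
  classical
  ext x
  rw [mul_apply, finsum_eq_single _ ((1 : G) : G ⧸ K)]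
  · rw [apply_out (φ := fun y => (1 : HeckeAlgebra A K) y * f (y⁻¹ * x)) (term_inv 1 f x)]
    simp [one_apply]
  · intro c hc
    rw [one_apply, if_neg, zero_mul]
    intro h
    apply hc
    rw [← QuotientGroup.out_eq' c]
    exact QuotientGroup.eq.2 (by simpa using h)

protected theorem mul_one' (f : HeckeAlgebra A K) : f * 1 = f := by
  classical
  ext x
  rw [mul_apply, finsum_eq_single _ (x : G ⧸ K)]
  · rw [apply_out (φ := fun y => f y * (1 : HeckeAlgebra A K) (y⁻¹ * x)) (term_inv f 1 x)]
    simp [one_apply]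
  · intro c hc
    rw [one_apply, if_neg, mul_zero]
    intro h
    apply hc
    rw [← QuotientGroup.out_eq' c]
    exact QuotientGroup.eq.2 h

theorem finite_term (f : HeckeAlgebra A K) (φ : G ⧸ K → A) :
    (Function.support fun c : G ⧸ K => f c.out * φ c).Finite :=
  f.finite_supp.subset fun _ hc => left_ne_zero_of_mul hc

noncomputable instance : Ring (HeckeAlgebra A K) :=
  { (inferInstance : AddCommGroup (HeckeAlgebra A K)) with
    mul := (· * ·)
    one := 1
    mul_assoc := HeckeAlgebra.mul_assoc'
    one_mul := HeckeAlgebra.one_mul'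
    mul_one := HeckeAlgebra.mul_one'
    zero_mul := fun f => by ext x; simp [mul_apply]
    mul_zero := fun f => by ext x; simp [mul_apply]
    left_distrib := fun f g h => by
      ext x
      simp only [mul_apply, add_apply, mul_add]
      exact finsum_add_distrib (finite_term f _) (finite_term f _)
    right_distrib := fun f g h => by
      ext x
      simp only [mul_apply, add_apply, add_mul]
      exact finsum_add_distrib (finite_term f _) (finite_term g _) }

noncomputable instance : Algebra A (HeckeAlgebra A K) :=
  Algebra.ofModule
    (fun a f g => by
      ext x
      simp only [mul_apply, smul_apply, mul_assoc]
      exact (mul_finsum' _ a (finite_term f _)).symm)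
    (fun a f g => by
      ext x
      simp only [mul_apply, smul_apply, mul_left_comm _ a]
      exact (mul_finsum' _ a (finite_term f _)).symm)

/-- The action of the Hecke algebra on `K`-fixed functions on `G`, for the right translation
action of `G`: `(z * W)(x) = ∑ z(h) W(xh)` over representatives `h` of `G ⧸ K`; thus `[KgK]`
acts as the sum of the right translations by representatives of the cosets `hK` in `KgK`. -/
noncomputable def act {R : Type*} [CommRing R] [Algebra A R] (z : HeckeAlgebra A K) (W : G → R) :
    G → R :=
  fun x => ∑ᶠ c : G ⧸ K, z c.out • W (x * c.out)

section
variable {R : Type*} [CommRing R] [Algebra A R]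

theorem finite_act (z : HeckeAlgebra A K) (φ : G ⧸ K → R) :
    (Function.support fun c : G ⧸ K => z c.out • φ c).Finite :=
  z.finite_supp.subset fun _ hc h => hc (by simp [h])

theorem act_add (z : HeckeAlgebra A K) (V W : G → R) : act z (V + W) = act z V + act z W := by
  ext x
  simp only [act, Pi.add_apply, smul_add]
  exact finsum_add_distrib (finite_act z _) (finite_act z _)

theorem act_smul (z : HeckeAlgebra A K) (r : R) (W : G → R) : act z (r • W) = r • act z W := by
  ext x
  simp only [act, Pi.smul_apply, smul_comm _ r]
  exact (smul_finsum' r (finite_act z _)).symm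

end

end HeckeAlgebra
end Hecke
section Schur
open MvPolynomial

/-- `P ∈ ℤ[T₁, …, Tₙ]` is the expression of the Schur polynomial
`det (X_j ^ (μ_i + n - i)) / ∏_{i<j} (X_i - X_j)` in terms of the elementary symmetric
polynomials: the variable with (zero-based) index `i` stands for `T_{i+1}`. -/
def IsSchurPoly {n : ℕ} (μ : Fin n → ℕ) (P : MvPolynomial (Fin n) ℤ) : Prop :=
  (Matrix.of fun i j : Fin n => (X j : MvPolynomial (Fin n) ℤ) ^ (μ i + (n - 1 - i))).det =
    aeval (fun i : Fin n => esymm (Fin n) ℤ (i + 1)) P *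
      ∏ i : Fin n, ∏ j ∈ Finset.Ioi i, (X i - X j)

theorem det_descending {n : ℕ} {S : Type*} [CommRing S] (v : Fin n → S) :
    (Matrix.of fun i j : Fin n => v j ^ (n - 1 - (i : ℕ))).det =
      ∏ i : Fin n, ∏ j ∈ Finset.Ioi i, (v i - v j) := by
  have h := Matrix.det_projVandermonde (fun _ : Fin n => (1 : S)) v
  simp only [one_mul] at h
  rw [← h, ← Matrix.det_transpose]
  congr 1
  ext i j
  simp only [Matrix.transpose_apply, Matrix.of_apply, Matrix.projVandermonde,
    Matrix.rectVandermonde, one_pow, one_mul, Fin.val_rev]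
  congr 1
  omega

theorem pow_reduction (n a : ℕ) : ∃ c : Fin n → MvPolynomial (Fin n) ℤ, ∀ j : Fin n,
    (X j : MvPolynomial (Fin n) ℤ) ^ a =
      ∑ l : Fin n, aeval (fun i : Fin n => esymm (Fin n) ℤ (i + 1)) (c l) * X j ^ (n - 1 - (l : ℕ)) := by
  induction a with
  | zero =>
    rcases Nat.eq_zero_or_pos n with rfl | hn
    · exact ⟨fun _ => 0, fun j => j.elim0⟩
    · refine ⟨Pi.single ⟨n - 1, by omega⟩ 1, fun j => ?_⟩
      rw [Finset.sum_eq_single ⟨n - 1, by omega⟩]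
      · simp
      · intro b _ hb
        simp [Pi.single_eq_of_ne hb]
      · simp
  | succ a ih =>
    obtain ⟨c, hc⟩ := ih
    rcases Nat.eq_zero_or_pos n with rfl | hn
    · exact ⟨fun _ => 0, fun j => j.elim0⟩
    have vieta : ∀ j : Fin n, (X j : MvPolynomial (Fin n) ℤ) ^ n =
        ∑ l : Fin n, ((-1) ^ (l : ℕ) * esymm (Fin n) ℤ (l + 1)) * X j ^ (n - 1 - (l : ℕ)) := by
      intro j
      have h := congrArg (Polynomial.eval (-(X j : MvPolynomial (Fin n) ℤ)))
        (MvPolynomial.prod_C_add_X_eq_sum_esymm ℤ (Fin n))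
      rw [Polynomial.eval_prod, Finset.prod_eq_zero (Finset.mem_univ j) (by simp),
        Polynomial.eval_finsetSum, Fintype.card_fin, Finset.sum_range_succ'] at h
      simp only [Polynomial.eval_mul, Polynomial.eval_C, Polynomial.eval_pow, Polynomial.eval_X,
        esymm_zero, one_mul, Nat.sub_zero] at h
      have h2 : (X j : MvPolynomial (Fin n) ℤ) ^ n = (-1) ^ n * (-X j) ^ n := by
        rw [← mul_pow]; simp
      rw [h2, eq_neg_of_add_eq_zero_right h.symm, Finset.sum_range, ← Finset.sum_neg_distrib,
        Finset.mul_sum]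
      refine Finset.sum_congr rfl fun l _ => ?_
      obtain ⟨m, hm⟩ : ∃ m, n = l + 1 + m := ⟨n - (l + 1), by omega⟩
      have e1 : n - ((l : ℕ) + 1) = m := by omega
      have e2 : n - 1 - (l : ℕ) = m := by omega
      rw [e1, e2, neg_pow (X j : MvPolynomial (Fin n) ℤ) m]
      have e3 : (-1 : MvPolynomial (Fin n) ℤ) ^ n = (-1) ^ ((l : ℕ) + 1 + m) := by rw [← hm]
      rw [e3]
      have : ((-1 : MvPolynomial (Fin n) ℤ)) ^ m * (-1) ^ m = 1 := by
        rw [← mul_pow]; simp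
      linear_combination ((-1) ^ (l : ℕ) * esymm (Fin n) ℤ (l + 1) * X j ^ m) * this
    let i₀ : Fin n := ⟨0, hn⟩
    refine ⟨fun l => (if h : (l : ℕ) + 1 < n then c ⟨l + 1, h⟩ else 0) +
      c i₀ * ((-1) ^ (l : ℕ) * X l), fun j => ?_⟩
    simp only [map_add, map_mul, map_pow, map_neg, map_one, aeval_X, add_mul,
      Finset.sum_add_distrib]
    obtain ⟨m, rfl⟩ : ∃ m, n = m + 1 := ⟨n - 1, by omega⟩
    have hs : ∑ l : Fin (m + 1), aeval (fun i : Fin (m + 1) => esymm (Fin (m + 1)) ℤ (i + 1)) (c i₀) *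
        ((-1) ^ (l : ℕ) * esymm (Fin (m + 1)) ℤ (l + 1)) * X j ^ (m + 1 - 1 - (l : ℕ)) =
        aeval (fun i : Fin (m + 1) => esymm (Fin (m + 1)) ℤ (i + 1)) (c i₀) * X j ^ (m + 1) := by
      rw [vieta j, Finset.mul_sum]
      exact Finset.sum_congr rfl fun l _ => by ring
    rw [hs, pow_succ (X j) a, hc j, Fin.sum_univ_succ, Fin.sum_univ_castSucc, add_mul, Finset.sum_mul]
    rw [add_comm (_ * _ * _)]
    simp only [Fin.val_castSucc, Fin.val_last, lt_self_iff_false, dite_false, map_zero, zero_mul,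
      add_zero, Fin.is_lt, Nat.add_lt_add_iff_right, dite_true]
    congr 1
    · refine Finset.sum_congr rfl fun l _ => ?_
      rw [mul_assoc, ← pow_succ]
      congr 2
      simp only [Fin.val_succ]
      omega
    · rw [mul_assoc, ← pow_succ]
      rfl

theorem existsUnique_isSchurPoly {n : ℕ} (μ : Fin n → ℕ) : ∃! P, IsSchurPoly μ P := by
  choose c hc using fun i : Fin n => pow_reduction n (μ i + (n - 1 - i))
  have hQ : IsSchurPoly μ (Matrix.of c).det := by
    unfold IsSchurPoly
    rw [← det_descending, AlgHom.map_det, ← Matrix.det_mul]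
    congr 1
    ext1 i j
    simp only [Matrix.of_apply, Matrix.mul_apply, hc i j]
    rfl
  refine ⟨(Matrix.of c).det, hQ, fun P hP => ?_⟩
  · have hD : (∏ i : Fin n, ∏ j ∈ Finset.Ioi i, (X i - X j : MvPolynomial (Fin n) ℤ)) ≠ 0 := by
      refine Finset.prod_ne_zero_iff.2 fun i _ => Finset.prod_ne_zero_iff.2 fun j hj => ?_
      rw [sub_ne_zero]
      exact fun h => (Finset.mem_Ioi.1 hj).ne (X_injective h)
    have h := mul_right_cancel₀ hD (hP.symm.trans hQ)
    refine esymmAlgHom_injective (σ := Fin n) ℤ (by simp) (Subtype.ext ?_)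
    rwa [esymmAlgHom_apply, esymmAlgHom_apply]

/-- The Schur polynomial `S_μ(T₁, …, Tₙ)` as a polynomial in the elementary symmetric
functions `T₁, …, Tₙ` (with zero-based indices). -/
noncomputable def schurPoly {n : ℕ} (μ : Fin n → ℕ) : MvPolynomial (Fin n) ℤ :=
  (existsUnique_isSchurPoly μ).choose

theorem schurPoly_spec {n : ℕ} (μ : Fin n → ℕ) : IsSchurPoly μ (schurPoly μ) :=
  (existsUnique_isSchurPoly μ).choose_spec.1

end Schur
section GLn

open HeckeAlgebra

theorem finite_of_isOpen_isCompact {G : Type*} [Group G] [TopologicalSpace G]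
    [IsTopologicalGroup G] {K : Subgroup G} (ho : IsOpen (K : Set G)) (hc : IsCompact (K : Set G))
    (g : G) : {c : G ⧸ K | c.out ∈ DoubleCoset.doubleCoset g K K}.Finite := by
  have hd : DiscreteTopology (G ⧸ K) := QuotientGroup.discreteTopology ho
  have hcont : Continuous fun k : G => ((k * g : G) : G ⧸ K) :=
    QuotientGroup.continuous_mk.comp (continuous_mul_const g)
  refine ((hc.image hcont).finite_of_discrete).subset fun c hx => ?_
  obtain ⟨a, ha, b, hb, e⟩ := DoubleCoset.mem_doubleCoset.1 hx
  refine ⟨a, ha, ?_⟩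
  change ((a * g : G) : G ⧸ K) = c
  rw [← QuotientGroup.out_eq' c, e]
  exact (QuotientGroup.mk_mul_of_mem _ hb).symm

variable (F : Type*) [Field F] [ValuativeRel F] (n : ℕ)

/-- `K = GLₙ(𝒪_F)` as a subgroup of `GLₙ(F)`. -/
noncomputable def maxCompact : Subgroup (Matrix.GeneralLinearGroup (Fin n) F) :=
  (Matrix.GeneralLinearGroup.map (n := Fin n) (algebraMap 𝒪[F] F)).range

variable {F n}

theorem mem_maxCompact_iff (g : Matrix.GeneralLinearGroup (Fin n) F) :
    g ∈ maxCompact F n ↔ (∀ i j, g.1 i j ∈ 𝒪[F]) ∧ ∀ i j, (g⁻¹).1 i j ∈ 𝒪[F] := by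
  constructor
  · rintro ⟨x, rfl⟩
    refine ⟨fun i j => (x.1 i j).2, fun i j => ?_⟩
    rw [← map_inv]
    exact ((x⁻¹).1 i j).2
  · rintro ⟨h1, h2⟩
    have hinj : Function.Injective
        (RingHom.mapMatrix (m := Fin n) (algebraMap 𝒪[F] F)) := by
      intro a b hab
      ext i j
      exact congrFun (congrFun hab i) j
    refine ⟨⟨Matrix.of fun i j => ⟨g.1 i j, h1 i j⟩, Matrix.of fun i j => ⟨(g⁻¹).1 i j, h2 i j⟩,
      hinj ?_, hinj ?_⟩, ?_⟩
    · rw [map_mul, map_one]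
      exact g.mul_inv
    · rw [map_mul, map_one]
      exact g.inv_mul
    · ext i j
      rfl

variable [TopologicalSpace F] [IsNonarchimedeanLocalField F]

theorem isOpen_maxCompact :
    IsOpen (maxCompact F n : Set (Matrix.GeneralLinearGroup (Fin n) F)) := by
  have hO : IsOpen ((𝒪[F] : Subring F) : Set F) := Valuation.isOpen_integer (v := valuation F)
  have : (maxCompact F n : Set (Matrix.GeneralLinearGroup (Fin n) F)) =
      (⋂ i, ⋂ j, {g | g.1 i j ∈ 𝒪[F]}) ∩ ⋂ i, ⋂ j, {g | (g⁻¹).1 i j ∈ 𝒪[F]} := by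
    ext g
    simp [mem_maxCompact_iff]
  rw [this]
  refine IsOpen.inter ?_ ?_
  · exact isOpen_iInter_of_finite fun i => isOpen_iInter_of_finite fun j =>
      hO.preimage ((Units.continuous_val).matrix_elem i j)
  · exact isOpen_iInter_of_finite fun i => isOpen_iInter_of_finite fun j =>
      hO.preimage ((Units.continuous_val.comp continuous_inv).matrix_elem i j)

theorem isCompact_maxCompact :
    IsCompact (maxCompact F n : Set (Matrix.GeneralLinearGroup (Fin n) F)) := by
  have : CompactSpace (Matrix (Fin n) (Fin n) 𝒪[F]) :=
    inferInstanceAs (CompactSpace (Fin n → Fin n → 𝒪[F]))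
  have hT : T2Space F := by
    let := IsTopologicalAddGroup.rightUniformSpace F
    have := isUniformAddGroup_of_addCommGroup (G := F)
    exact inferInstance
  have : CompactSpace (Matrix (Fin n) (Fin n) 𝒪[F])ˣ := inferInstance
  have hc : Continuous (Matrix.GeneralLinearGroup.map (n := Fin n) (algebraMap 𝒪[F] F)) :=
    Continuous.units_map _ (Continuous.matrix_map continuous_id continuous_subtype_val)
  have := isCompact_range hc
  rwa [← MonoidHom.coe_range] at this

/-- The diagonal matrix with entries `t₁, …, tₙ`. -/
def diag (t : Fin n → Fˣ) : Matrix.GeneralLinearGroup (Fin n) F :=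
  Units.map (Matrix.diagonalRingHom (Fin n) F).toMonoidHom (MulEquiv.piUnits.symm t)

/-- `ϖ^μ = diag(ϖ^{μ₁}, …, ϖ^{μₙ})`. -/
def powDiag (ϖ : Fˣ) (μ : Fin n → ℤ) : Matrix.GeneralLinearGroup (Fin n) F :=
  diag fun i => ϖ ^ μ i

/-- `ϖ` is a uniformizer of `F`. -/
def IsUniformizer (ϖ : Fˣ) : Prop := ∃ a : 𝒪[F], Irreducible a ∧ (a : F) = ϖ

variable (n) in
/-- The Hecke operator `T^{(j)} = [K diag(ϖ, …, ϖ, 1, …, 1) K]`, with `ϖ` occurring `j` times. -/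
noncomputable def heckeT (A : Type*) [CommRing A] (ϖ : Fˣ) (j : ℕ) :
    HeckeAlgebra A (maxCompact F n) :=
  doubleCoset A (maxCompact F n) (powDiag ϖ fun i => if (i : ℕ) < j then 1 else 0)
    (finite_of_isOpen_isCompact isOpen_maxCompact isCompact_maxCompact _)

variable (F n) in
/-- `U`: the upper triangular unipotent matrices in `GLₙ(F)`. -/
def unipotent : Set (Matrix.GeneralLinearGroup (Fin n) F) :=
  {u | (∀ i, u.1 i i = 1) ∧ ∀ i j, j < i → u.1 i j = 0}

/-- `ψ` has conductor zero: the largest fractional ideal on which it is trivial is `𝒪_F`. -/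
def HasConductorZero {A : Type*} [CommRing A] (ψ : AddChar F A) : Prop :=
  ∀ y : F, (∀ x ∈ 𝒪[F], ψ (y * x) = 1) ↔ y ∈ 𝒪[F]

/-- The sum `u₁₂ + u₂₃ + ⋯ + u_{n-1,n}` of the entries above the diagonal. -/
def superdiagSum (u : Matrix.GeneralLinearGroup (Fin n) F) : F :=
  ∑ i : Fin n, ∑ j : Fin n, if (j : ℕ) = i + 1 then u.1 i j else 0

variable {A : Type*} [CommRing A] (ψ : AddChar F A) (R : Type*) [CommRing R] [Algebra A R]

variable (n) in
/-- `Ind_U^G ψ_R`: the locally constant `W : GLₙ(F) → R` with `W(ug) = ψ(u) W(g)` for `u ∈ U`,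
where `ψ(u) = ψ(u₁₂ + ⋯ + u_{n-1,n})`. -/
def whittakerSpace : Submodule R (Matrix.GeneralLinearGroup (Fin n) F → R) where
  carrier := {W | IsLocallyConstant W ∧
    ∀ u ∈ unipotent F n, ∀ g, W (u * g) = algebraMap A R (ψ (superdiagSum u)) * W g}
  zero_mem' := ⟨IsLocallyConstant.const 0, by simp⟩
  add_mem' := fun hV hW => ⟨hV.1.add hW.1, fun u hu g => by
    simp [hV.2 u hu g, hW.2 u hu g, mul_add]⟩
  smul_mem' := fun r W hW => ⟨hW.1.comp (fun x => r * x), fun u hu g => by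
    simp [hW.2 u hu g, mul_left_comm]⟩

variable (n) in
/-- `(Ind_U^G ψ_R)^K`: the Whittaker functions fixed by right translation by `K`. -/
def sphericalWhittaker : Submodule R (Matrix.GeneralLinearGroup (Fin n) F → R) where
  carrier := {W | W ∈ whittakerSpace n ψ R ∧ ∀ k ∈ maxCompact F n, ∀ g, W (g * k) = W g}
  zero_mem' := ⟨zero_mem _, by simp⟩
  add_mem' := fun hV hW => ⟨add_mem hV.1 hW.1, fun k hk g => by simp [hV.2 k hk g, hW.2 k hk g]⟩
  smul_mem' := fun r W hW => ⟨Submodule.smul_mem _ r hW.1, fun k hk g => by simp [hW.2 k hk g]⟩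

variable {R} in
/-- `(Ind_U^G ψ_R)^{K,χ}`: the `W` in `(Ind_U^G ψ_R)^K` with `z * W = χ(z) W` for all `z` in the
Hecke algebra. -/
def eigenWhittaker (χ : HeckeAlgebra A (maxCompact F n) →ₐ[A] R) :
    Submodule R (Matrix.GeneralLinearGroup (Fin n) F → R) where
  carrier := {W | W ∈ sphericalWhittaker n ψ R ∧ ∀ z, act z W = χ z • W}
  zero_mem' := ⟨zero_mem _, fun z => by ext x; simp [act]⟩
  add_mem' := fun {V W} hV hW => ⟨add_mem hV.1 hW.1, fun z => by
    rw [smul_add, ← hV.2 z, ← hW.2 z, act_add]⟩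
  smul_mem' := fun r W hW => ⟨Submodule.smul_mem _ r hW.1, fun z => by
    rw [smul_comm, ← hW.2 z, act_smul]⟩

variable {R} in
/-- Evaluation at `1`, as an `R`-linear map `(Ind_U^G ψ_R)^{K,χ} → R`. -/
def evalOne (χ : HeckeAlgebra A (maxCompact F n) →ₐ[A] R) : eigenWhittaker ψ χ →ₗ[R] R :=
  (LinearMap.proj 1).comp (eigenWhittaker ψ χ).subtype

end GLn

end Shintani

set_option linter.unusedSectionVars false

/-! By the Iwasawa decomposition every element of `G` has the form `u ϖ^μ k`, so a spherical
Whittaker function is known from its values `W(ϖ^μ)`. If `μ` is not decreasing, some `u ∈ U` with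
`ψ(u) ≠ 1` moves through `ϖ^μ` into `K`, which gives `(ψ(u) - 1) W(ϖ^μ) = 0`. Here `ψ(u)` is a root
of unity of `p`-power order and `ℓ ≠ p`, so `ψ(u) - 1` is a unit of `W(k)` and `W(ϖ^μ) = 0`
(`sphericalWhittaker_eq_zero`).

The cosets `gK` in the double coset of `T^{(j)}` are represented by `u ϖ^{1_I}` with `|I| = j`,
where the entries of `u` run through the residue field at the places `(a, b)`, `a < b`, `a ∈ I`, `b
∉ I` (`finsum_heckeT`). For decreasing `μ` the character is trivial on `ϖ^μ u ϖ^{-μ}`. Hence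
`(T^{(j)} * W)(ϖ^μ)` is the sum of `q^{|pairs I|} W(ϖ^{μ + 1_I})`. After weighting by `q^{∑ (n-i)
μ_i}` the powers of `q` collapse to a constant depending only on `j` (`heightZ_indZ`), and the
eigenvalue equations become Pieri's rule `e_j s_μ = ∑ s_{μ + 1_I}`, in which the terms that are not
partitions vanish (`pieri_whittaker`).

Pieri's rule determines a function on partitions from its value at `0`. To see this, a linear
functional on polynomials that sends the alternant with exponent `μ + ρ` (`ρ` the staircase) to
`f(μ)` is applied to the identity defining the Schur polynomial (`eq_aeval_schurPoly`). This is the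
formula in (1). The shift by `m` holds because `T^{(n)}` acts as translation by the central element
`ϖ`.

For (2), injectivity follows from the formula and the shift. For surjectivity, the weighted Schur
values are extended to a function on `G`; Pieri's rule for Schur polynomials makes it an
eigenfunction of the `T^{(j)}`. It is then an eigenfunction of the whole Hecke algebra, because the
`T^{(j)}` and the inverse of `T^{(n)}` generate it, by a triangularity argument on the indicator
functions of double cosets (`subalgebra_eq_top`). -/

namespace Shintani

/-! ### Alternants, Schur polynomials and Pieri's rule. -/

section Alternant
open MvPolynomial

variable {n : ℕ}

/-- The indicator function of `I`, with values in `ℕ`. -/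
def ind (I : Finset (Fin n)) : Fin n → ℕ := fun i => if i ∈ I then 1 else 0

/-- The staircase `(n - 1, …, 1, 0)`. -/
def staircase (n : ℕ) : Fin n → ℕ := fun i => n - 1 - i

/-- The alternating polynomial `det (X_j ^ α_i)`. -/
noncomputable def alternant (α : Fin n → ℕ) : MvPolynomial (Fin n) ℤ :=
  (Matrix.of fun i j : Fin n => (X j : MvPolynomial (Fin n) ℤ) ^ α i).det

theorem alternant_eq_sum (α : Fin n → ℕ) :
    alternant α = ∑ σ : Equiv.Perm (Fin n),
      ((Equiv.Perm.sign σ : ℤ) : MvPolynomial (Fin n) ℤ) * ∏ i, X (σ i) ^ α i := by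
  unfold alternant
  rw [← Matrix.det_transpose, Matrix.det_apply']
  rfl

theorem prod_X_pow_ind (σ : Equiv.Perm (Fin n)) (I : Finset (Fin n)) :
    ∏ i, (X (σ i) : MvPolynomial (Fin n) ℤ) ^ ind I i = ∏ i ∈ I, X (σ i) := by
  simp only [ind, pow_ite, pow_one, pow_zero, Finset.prod_ite_mem, Finset.univ_inter]

theorem powersetCard_univ_self :
    Finset.powersetCard n (Finset.univ : Finset (Fin n)) = {Finset.univ} := by
  have h := Finset.powersetCard_self (Finset.univ : Finset (Fin n))
  rwa [Finset.card_univ, Fintype.card_fin] at h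

/-- As `e_j` is symmetric, it may be written in the permuted variables `X (σ i)` separately in each
term `σ` of the alternant; there the monomial of `I` raises the exponents `α i`, `i ∈ I`, by one. -/
theorem esymm_mul_alternant (j : ℕ) (α : Fin n → ℕ) :
    esymm (Fin n) ℤ j * alternant α =
      ∑ I ∈ Finset.powersetCard j Finset.univ, alternant (α + ind I) := by
  simp only [alternant_eq_sum]
  rw [Finset.mul_sum, Finset.sum_comm]
  refine Finset.sum_congr rfl fun σ _ => ?_
  have hσ : esymm (Fin n) ℤ j =
      ∑ I ∈ Finset.powersetCard j Finset.univ, ∏ i ∈ I, X (σ i) := by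
    rw [← esymm_isSymmetric (Fin n) ℤ j σ]
    simp [esymm, map_sum, map_prod]
  rw [hσ, Finset.sum_mul]
  refine Finset.sum_congr rfl fun I _ => ?_
  simp only [Pi.add_apply, pow_add, Finset.prod_mul_distrib, prod_X_pow_ind]
  ring

theorem alternant_eq_zero {α : Fin n → ℕ} (h : ¬ Function.Injective α) : alternant α = 0 := by
  simp only [Function.Injective, not_forall] at h
  obtain ⟨a, b, hab, hne⟩ := h
  refine Matrix.det_zero_of_row_eq hne ?_
  ext j
  simp [hab]

theorem strictAnti_staircase : StrictAnti (staircase n) := by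
  intro a b hab
  have : (a : ℕ) < b := hab
  have := b.2
  simp only [staircase]
  omega

theorem strictAnti_add_staircase {μ : Fin n → ℕ} (hμ : Antitone μ) :
    StrictAnti (μ + staircase n) := fun _ _ h =>
  Nat.add_lt_add_of_le_of_lt (hμ h.le) (strictAnti_staircase h)

theorem antitone_iff_adjacent {M : Type*} [Preorder M] {μ : Fin n → M} :
    Antitone μ ↔ ∀ i j : Fin n, (j : ℕ) = i + 1 → μ j ≤ μ i := by
  constructor
  · intro h i j hij
    exact h (Fin.le_def.2 (by omega))
  · intro h
    have key : ∀ (d : ℕ) (i j : Fin n), (j : ℕ) = i + d → μ j ≤ μ i := by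
      intro d
      induction d with
      | zero => intro i j hij; rw [Fin.ext hij]
      | succ d ih =>
        intro i j hij
        have hj := j.2
        exact (h ⟨i + d, by omega⟩ j (by simp only; omega)).trans (ih i ⟨i + d, by omega⟩ rfl)
    intro i j hij
    exact key (j - i) i j (by have := Fin.le_def.1 hij; omega)

theorem staircase_le_of_strictAnti {α : Fin n → ℕ} (hα : StrictAnti α) : staircase n ≤ α := by
  have key : ∀ (d : ℕ) (i : Fin n), d = n - 1 - i → d ≤ α i := by
    intro d
    induction d with
    | zero => intro i _; exact Nat.zero_le _
    | succ d ih =>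
      intro i hi
      have h1 := ih ⟨i + 1, by omega⟩ (by simp only; omega)
      have h2 : α ⟨i + 1, by omega⟩ < α i := hα (Fin.lt_def.2 (by simp))
      omega
  exact fun i => key _ i rfl

theorem antitone_sub_staircase {α : Fin n → ℕ} (hα : StrictAnti α) :
    Antitone (α - staircase n) := by
  rw [antitone_iff_adjacent]
  intro i j hij
  have h1 := staircase_le_of_strictAnti hα i
  have h2 := staircase_le_of_strictAnti hα j
  have h3 : α j < α i := hα (Fin.lt_def.2 (by omega))
  have := j.2
  simp only [Pi.sub_apply, staircase] at *
  omega

/-- The linear functional on `ℤ[X₁, …, Xₙ]` that maps `X^α` to `f (α - ρ)`, where `ρ` is the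
staircase, if `α` is strictly decreasing, and to `0` otherwise. -/
noncomputable def strictFunctional {R : Type*} [CommRing R] (f : (Fin n → ℕ) → R) :
    MvPolynomial (Fin n) ℤ →ₗ[ℤ] R :=
  open Classical in
  (basisMonomials (Fin n) ℤ).constr ℤ fun β =>
    if StrictAnti β then f (β - staircase n) else 0

theorem strictFunctional_monomial {R : Type*} [CommRing R] (f : (Fin n → ℕ) → R)
    (β : Fin n → ℕ) [Decidable (StrictAnti β)] :
    strictFunctional f (monomial (Finsupp.equivFunOnFinite.symm β) 1) =
      if StrictAnti β then f (β - staircase n) else 0 := by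
  classical
  have := (basisMonomials (Fin n) ℤ).constr_basis ℤ
    (fun β => if StrictAnti β then f (β - staircase n) else 0) (Finsupp.equivFunOnFinite.symm β)
  rw [show basisMonomials (Fin n) ℤ (Finsupp.equivFunOnFinite.symm β) = monomial _ 1 from
    congrFun (coe_basisMonomials (Fin n) ℤ) _] at this
  by_cases h : StrictAnti β
  · rw [if_pos h]
    exact this.trans (if_pos h)
  · rw [if_neg h]
    exact this.trans (if_neg h)

/-- Among the rearrangements of a strictly decreasing exponent only the trivial one is strictly
decreasing, so the functional sees a single monomial of the alternant. -/
theorem strictFunctional_alternant {R : Type*} [CommRing R] (f : (Fin n → ℕ) → R)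
    {α : Fin n → ℕ} (hα : StrictAnti α) :
    strictFunctional f (alternant α) = f (α - staircase n) := by
  classical
  have hmon : ∀ σ : Equiv.Perm (Fin n), ∏ i, (X (σ i) : MvPolynomial (Fin n) ℤ) ^ α i =
      monomial (Finsupp.equivFunOnFinite.symm (α ∘ σ.symm)) 1 := by
    intro σ
    rw [monomial_eq, map_one, one_mul,
      Finsupp.prod_fintype _ _ (fun i => pow_zero _)]
    exact Fintype.prod_equiv σ _ _ (by simp)
  rw [alternant_eq_sum, map_sum, Finset.sum_eq_single (1 : Equiv.Perm (Fin n))]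
  · rw [hmon]
    simp only [Equiv.Perm.sign_one, Units.val_one, Int.cast_one, one_mul]
    rw [strictFunctional_monomial]
    exact if_pos hα
  · intro σ _ hσ
    rw [hmon, ← zsmul_eq_mul, map_zsmul, strictFunctional_monomial, if_neg,
      smul_zero]
    intro h
    apply hσ
    have hm : StrictMono σ.symm := fun a b hab => by
      have := h hab
      simp only [Function.comp] at this
      exact hα.lt_iff_gt.1 this
    -- A strictly increasing permutation is an order automorphism of `Fin n`, and there is only one.
    have h2 : σ.symm = 1 := by
      ext i
      have := congrFun (Subsingleton.elim (hm.orderIsoOfSurjective _ σ.symm.surjective)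
        (OrderIso.refl _) ▸ rfl : (hm.orderIsoOfSurjective _ σ.symm.surjective : Fin n → Fin n)
          = OrderIso.refl _) i
      simpa using congrArg Fin.val this
    rw [← Equiv.symm_symm σ, h2]
    rfl
  · simp

/-- On alternants the functional turns multiplication by `e_{i+1}` into multiplication by `c i`:
this is what Pieri's rule for `f` says. Induction on `P` then replaces all the `e_{i+1}` by `c i`;
`α` varies because each factor `e_{i+1}` changes the exponent. -/
theorem strictFunctional_mul_alternant {R : Type*} [CommRing R] (f : (Fin n → ℕ) → R)
    (c : Fin n → R)
    (h : ∀ μ, Antitone μ → ∀ i : Fin n, c i * f μ =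
      ∑ I ∈ Finset.powersetCard (i + 1) Finset.univ with Antitone (μ + ind I), f (μ + ind I))
    (P : MvPolynomial (Fin n) ℤ) {α : Fin n → ℕ} (hα : StrictAnti α) :
    strictFunctional f (aeval (fun i : Fin n => esymm (Fin n) ℤ (i + 1)) P * alternant α) =
      aeval c P * f (α - staircase n) := by
  classical
  induction P using MvPolynomial.induction_on generalizing α with
  | C a =>
    simp only [eq_intCast, map_intCast]
    rw [← zsmul_eq_mul, map_zsmul, strictFunctional_alternant f hα, zsmul_eq_mul]
  | add P Q hP hQ => simp only [map_add, add_mul, hP hα, hQ hα]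
  | mul_X P i ih =>
    rw [map_mul (aeval _), map_mul (aeval _), aeval_X, aeval_X, mul_assoc, esymm_mul_alternant, Finset.mul_sum,
      map_sum, mul_assoc, h _ (antitone_sub_staircase hα), Finset.mul_sum, Finset.sum_filter]
    refine Finset.sum_congr rfl fun I _ => ?_
    have hle := staircase_le_of_strictAnti hα
    have e : α + ind I - staircase n = α - staircase n + ind I := by
      funext a
      have : staircase n a ≤ α a := hle a
      change α a + ind I a - staircase n a = α a - staircase n a + ind I a
      omega
    by_cases hs : StrictAnti (α + ind I)
    · rw [ih hs, e, if_pos (e ▸ antitone_sub_staircase hs)]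
    -- Adding an indicator to a strictly decreasing `α` leaves it weakly decreasing, so if
    -- strictness fails, two exponents coincide and the alternant is zero; on the other side the
    -- index `I` is filtered out.
    · rw [if_neg, alternant_eq_zero, mul_zero, map_zero]
      · intro hinj
        refine hs (Antitone.strictAnti_of_injective ?_ hinj)
        intro a b hab
        rcases hab.eq_or_lt with rfl | hab
        · exact le_rfl
        · have := hα hab
          simp only [Pi.add_apply, ind]
          split_ifs <;> omega
      · intro ha
        apply hs
        have := strictAnti_add_staircase ha
        rw [← e, tsub_add_cancel_of_le (hle.trans (le_add_of_nonneg_right (fun _ => Nat.zero_le _)))] at this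
        exact this

theorem alternant_staircase_ne_zero : alternant (staircase n) ≠ 0 := by
  unfold alternant staircase
  rw [det_descending]
  refine Finset.prod_ne_zero_iff.2 fun i _ => Finset.prod_ne_zero_iff.2 fun j hj => ?_
  rw [sub_ne_zero]
  exact fun h => (Finset.mem_Ioi.1 hj).ne (X_injective h)

theorem isSchurPoly_iff {μ : Fin n → ℕ} {P : MvPolynomial (Fin n) ℤ} :
    IsSchurPoly μ P ↔ alternant (μ + staircase n) =
      aeval (fun i : Fin n => esymm (Fin n) ℤ (i + 1)) P * alternant (staircase n) := by
  unfold IsSchurPoly alternant staircase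
  rw [det_descending]
  rfl

theorem alternant_add_staircase (μ : Fin n → ℕ) : alternant (μ + staircase n) =
    aeval (fun i : Fin n => esymm (Fin n) ℤ (i + 1)) (schurPoly μ) * alternant (staircase n) :=
  isSchurPoly_iff.1 (schurPoly_spec μ)

theorem schurPoly_eq {μ : Fin n → ℕ} {P : MvPolynomial (Fin n) ℤ} (h : IsSchurPoly μ P) :
    schurPoly μ = P := (existsUnique_isSchurPoly μ).unique (schurPoly_spec μ) h

/-- A function on partitions that satisfies Pieri's rule is a specialisation of the Schur
polynomials. -/
theorem eq_aeval_schurPoly {R : Type*} [CommRing R] (f : (Fin n → ℕ) → R)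
    (c : Fin n → R)
    (h : ∀ μ, Antitone μ → ∀ i : Fin n, c i * f μ =
      ∑ I ∈ Finset.powersetCard (i + 1) Finset.univ with Antitone (μ + ind I), f (μ + ind I))
    {μ : Fin n → ℕ} (hμ : Antitone μ) : f μ = aeval c (schurPoly μ) * f 0 := by
  -- The functional is evaluated on both sides of `alternant (μ + ρ) = S_μ(e) * alternant ρ`; the
  -- left side gives `f μ`, the right side a multiple of `f 0`.
  have h1 := strictFunctional_mul_alternant f c h (schurPoly μ) (strictAnti_staircase (n := n))
  rw [← alternant_add_staircase, strictFunctional_alternant f (strictAnti_add_staircase hμ)] at h1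
  simpa using h1

/-- Pieri's rule. -/
theorem X_mul_schurPoly (μ : Fin n → ℕ) (i : Fin n) :
    X i * schurPoly μ = ∑ I ∈ Finset.powersetCard (i + 1) Finset.univ, schurPoly (μ + ind I) := by
  refine esymmAlgHom_injective (σ := Fin n) ℤ (by simp) (Subtype.ext ?_)
  rw [esymmAlgHom_apply, esymmAlgHom_apply]
  -- The elementary symmetric polynomials are algebraically independent, so the identity may be
  -- tested after substituting them and multiplying by the Vandermonde product.
  refine mul_right_cancel₀ alternant_staircase_ne_zero ?_
  rw [map_mul, aeval_X, mul_assoc, ← alternant_add_staircase, esymm_mul_alternant, map_sum,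
    Finset.sum_mul]
  refine Finset.sum_congr rfl fun I _ => ?_
  rw [← alternant_add_staircase, add_right_comm]

theorem schurPoly_zero : schurPoly (0 : Fin n → ℕ) = 1 :=
  schurPoly_eq (isSchurPoly_iff.2 (by simp))

theorem schurPoly_eq_zero {μ : Fin n → ℕ} (h : ¬ Function.Injective (μ + staircase n)) :
    schurPoly μ = 0 :=
  schurPoly_eq (isSchurPoly_iff.2 (by rw [alternant_eq_zero h]; simp))

/-- If `μ + ind I` is not a partition, then, after adding the staircase, two exponents coincide and
its Schur polynomial is zero. -/
theorem pieri_antitone {μ : Fin n → ℕ} (hμ : Antitone μ) (i : Fin n) :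
    X i * schurPoly μ = ∑ I ∈ Finset.powersetCard (i + 1) Finset.univ with Antitone (μ + ind I),
      schurPoly (μ + ind I) := by
  rw [X_mul_schurPoly, Finset.sum_filter]
  refine Finset.sum_congr rfl fun I _ => ?_
  split_ifs with h
  · rfl
  · refine schurPoly_eq_zero fun hinj => h ?_
    have hs : StrictAnti (μ + ind I + staircase n) := by
      refine Antitone.strictAnti_of_injective ?_ hinj
      intro a b hab
      rcases hab.eq_or_lt with rfl | hab
      · exact le_rfl
      · have := strictAnti_add_staircase hμ hab
        simp only [Pi.add_apply, ind] at *
        split_ifs <;> omega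
    have := antitone_sub_staircase hs
    rwa [add_tsub_cancel_right] at this

end Alternant
-- Valuations and powers of a uniformizer.
section Uniformizer

variable {F : Type*} [Field F] [ValuativeRel F]

theorem mem_integer_iff {x : F} : x ∈ 𝒪[F] ↔ valuation F x ≤ 1 := Iff.rfl

theorem IsUniformizer.valuation_lt_one {ϖ : Fˣ} (hϖ : IsUniformizer ϖ) :
    valuation F (ϖ : F) < 1 := by
  obtain ⟨a, ha, haϖ⟩ := hϖ
  rw [← haϖ]
  refine lt_of_le_of_ne a.2 fun h => ha.not_isUnit ?_
  exact (Valuation.integer.integers (valuation F)).isUnit_iff_valuation_eq_one.2 h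

theorem IsUniformizer.zpow_mem_iff {ϖ : Fˣ} (hϖ : IsUniformizer ϖ) {m : ℤ} :
    ((ϖ ^ m : Fˣ) : F) ∈ 𝒪[F] ↔ 0 ≤ m := by
  rw [mem_integer_iff, Units.val_zpow_eq_zpow_val, map_zpow₀]
  exact zpow_le_one_iff_right_of_lt_one₀
    (zero_lt_iff.2 ((valuation F).ne_zero_iff.2 ϖ.ne_zero)) hϖ.valuation_lt_one

theorem IsUniformizer.valuation_zpow_eq_one_iff {ϖ : Fˣ} (hϖ : IsUniformizer ϖ) {m : ℤ} :
    valuation F ((ϖ ^ m : Fˣ) : F) = 1 ↔ m = 0 := by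
  constructor
  · intro h
    have h1 : 0 ≤ m := hϖ.zpow_mem_iff.1 h.le
    have h2 : 0 ≤ -m := hϖ.zpow_mem_iff.1 (by
      rw [mem_integer_iff, zpow_neg, Units.val_inv_eq_inv_val, map_inv₀, h, inv_one])
    omega
  · rintro rfl
    simp

/-- Otherwise `ϖ x⁻¹` is integral and `ϖ = x * (ϖ x⁻¹)` factors the irreducible `ϖ` in `𝒪[F]`. The
factor `x` is not a unit, and if `ϖ x⁻¹` is one then `ϖ⁻¹ x` is integral after all. -/
theorem IsUniformizer.exists_eq_mul_of_lt_one {ϖ : Fˣ} (hϖ : IsUniformizer ϖ) {x : F}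
    (hx : valuation F x < 1) : ((ϖ⁻¹ : Fˣ) : F) * x ∈ 𝒪[F] := by
  obtain ⟨a, ha, haϖ⟩ := hϖ
  by_contra h
  rw [mem_integer_iff, not_le] at h
  have hinv : ((ϖ : F) * x⁻¹) ∈ 𝒪[F] := by
    rw [mem_integer_iff]
    have : (ϖ : F) * x⁻¹ = (((ϖ⁻¹ : Fˣ) : F) * x)⁻¹ := by
      rw [mul_inv, Units.val_inv_eq_inv_val, inv_inv]
    rw [this, map_inv₀]
    exact inv_le_one_of_one_le₀ h.le
  have hx0 : x ≠ 0 := by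
    rintro rfl
    simp at h
  have hfac : a = ⟨x, hx.le⟩ * ⟨_, hinv⟩ := by
    ext
    simp only [Subring.coe_mul, haϖ]
    field_simp
  have isU : ∀ b : 𝒪[F], IsUnit b → valuation F (b : F) = 1 := fun b hb =>
    (Valuation.integer.integers (valuation F)).isUnit_iff_valuation_eq_one.1 hb
  rcases ha.isUnit_or_isUnit hfac with h1 | h1
  · exact hx.ne (isU _ h1)
  · have := isU _ h1
    simp only [map_mul, map_inv₀] at this h
    rw [Units.val_inv_eq_inv_val, map_inv₀] at h
    have hv : valuation F (ϖ : F) ≠ 0 := (valuation F).ne_zero_iff.2 ϖ.ne_zero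
    have hxv : valuation F x ≠ 0 := (valuation F).ne_zero_iff.2 hx0
    have : valuation F (ϖ : F) = valuation F x := by
      field_simp at this
      exact this
    rw [this, inv_mul_cancel₀ hxv] at h
    exact lt_irrefl _ h

variable [TopologicalSpace F] [IsNonarchimedeanLocalField F]

theorem IsUniformizer.exists_zpow {ϖ : Fˣ} (hϖ : IsUniformizer ϖ) (x : Fˣ) :
    ∃ (m : ℤ) (y : Fˣ), valuation F (y : F) = 1 ∧ x = ϖ ^ m * y := by
  obtain ⟨a, ha, haϖ⟩ := hϖ
  have key : ∀ x : Fˣ, (x : F) ∈ 𝒪[F] →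
      ∃ (m : ℤ) (y : Fˣ), valuation F (y : F) = 1 ∧ x = ϖ ^ m * y := by
    intro x hx
    obtain ⟨m, u, hu⟩ := IsDiscreteValuationRing.eq_unit_mul_pow_irreducible
      (x := (⟨x, hx⟩ : 𝒪[F])) (fun h => x.ne_zero (congrArg Subtype.val h)) ha
    refine ⟨m, Units.map (algebraMap 𝒪[F] F).toMonoidHom u,
      (Valuation.integer.integers (valuation F)).isUnit_iff_valuation_eq_one.1 u.isUnit, ?_⟩
    ext
    have := congrArg (Subtype.val) hu
    simp only [Subring.coe_mul, SubmonoidClass.coe_pow, haϖ] at this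
    rw [this, mul_comm]
    simp
    rfl
  rcases le_total (valuation F (x : F)) 1 with h | h
  · exact key x h
  · obtain ⟨m, y, hy, e⟩ := key x⁻¹ (by
      rw [mem_integer_iff, Units.val_inv_eq_inv_val, map_inv₀]
      exact inv_le_one_of_one_le₀ h)
    refine ⟨-m, y⁻¹, by rw [Units.val_inv_eq_inv_val, map_inv₀, hy, inv_one], ?_⟩
    rw [← inv_inv x, e, mul_inv, zpow_neg]

end Uniformizer

/-! ### Elimination by row and column operations in `K`. -/

section MaxCompact

variable {F : Type*} [Field F] [ValuativeRel F] {n : ℕ}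

local notation "GL" => Matrix.GeneralLinearGroup (Fin n) F

theorem coe_mem_of_mem_maxCompact {g : GL} (hg : g ∈ maxCompact F n) (i j : Fin n) :
    g.1 i j ∈ 𝒪[F] := ((mem_maxCompact_iff g).1 hg).1 i j

theorem inv_coe_mem_of_mem_maxCompact {g : GL} (hg : g ∈ maxCompact F n) (i j : Fin n) :
    (g⁻¹).1 i j ∈ 𝒪[F] := ((mem_maxCompact_iff g).1 hg).2 i j

theorem valuation_det_of_mem_maxCompact {g : GL} (hg : g ∈ maxCompact F n) :
    valuation F g.1.det = 1 := by
  obtain ⟨x, rfl⟩ := hg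
  have h : (Matrix.GeneralLinearGroup.map (n := Fin n) (algebraMap 𝒪[F] F) x).1.det =
      algebraMap 𝒪[F] F x.1.det := by
    rw [RingHom.map_det]
    rfl
  rw [h]
  exact (Valuation.integer.integers (valuation F)).isUnit_iff_valuation_eq_one.1
    ((Matrix.isUnit_iff_isUnit_det _).1 x.isUnit)

theorem mem_maxCompact_of_det {g : GL} (hg : ∀ i j, g.1 i j ∈ 𝒪[F])
    (hdet : valuation F g.1.det = 1) : g ∈ maxCompact F n := by
  set M : Matrix (Fin n) (Fin n) 𝒪[F] := Matrix.of fun i j => ⟨g.1 i j, hg i j⟩ with hM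
  have hMg : (algebraMap 𝒪[F] F).mapMatrix M = g.1 := rfl
  have hu : IsUnit M := by
    rw [Matrix.isUnit_iff_isUnit_det]
    refine (Valuation.integer.integers (valuation F)).isUnit_iff_valuation_eq_one.2 ?_
    rw [RingHom.map_det, hMg, hdet]
  refine ⟨hu.unit, ?_⟩
  ext i j
  rfl

/-- The permutation matrices. -/
def permGL (σ : Equiv.Perm (Fin n)) : GL where
  val := σ.toPEquiv.toMatrix
  inv := σ.symm.toPEquiv.toMatrix
  val_inv := by
    rw [PEquiv.toMatrix_toPEquiv_mul]
    ext i j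
    simp [PEquiv.toMatrix_apply, Matrix.one_apply]
  inv_val := by
    rw [PEquiv.toMatrix_toPEquiv_mul]
    ext i j
    simp [PEquiv.toMatrix_apply, Matrix.one_apply]

theorem permGL_mul_apply (σ : Equiv.Perm (Fin n)) (g : GL) (i j : Fin n) :
    (permGL σ * g).1 i j = g.1 (σ i) j := by
  change (σ.toPEquiv.toMatrix * g.1 : Matrix (Fin n) (Fin n) F) i j = _
  rw [PEquiv.toMatrix_toPEquiv_mul]
  rfl

theorem mul_permGL_apply (σ : Equiv.Perm (Fin n)) (g : GL) (i j : Fin n) :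
    (g * permGL σ).1 i j = g.1 i (σ.symm j) := by
  change (g.1 * σ.toPEquiv.toMatrix : Matrix (Fin n) (Fin n) F) i j = _
  rw [PEquiv.mul_toMatrix_toPEquiv]
  rfl

theorem permGL_mem (σ : Equiv.Perm (Fin n)) : (permGL σ : GL) ∈ maxCompact F n := by
  have key : ∀ (τ : Equiv.Perm (Fin n)) (i j : Fin n),
      (τ.toPEquiv.toMatrix : Matrix (Fin n) (Fin n) F) i j ∈ 𝒪[F] := by
    intro τ i j
    rw [PEquiv.toMatrix_apply]
    split_ifs
    · exact one_mem _
    · exact zero_mem _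
  exact (mem_maxCompact_iff _).2 ⟨key σ, key σ.symm⟩

/-- The matrix `1 + v wᵗ`, where `v` and `w` are orthogonal. -/
def rankOneGL (v w : Fin n → F) (h : w ⬝ᵥ v = 0) : GL where
  val := 1 + Matrix.vecMulVec v w
  inv := 1 - Matrix.vecMulVec v w
  val_inv := by
    rw [add_mul, one_mul, mul_sub, mul_one, Matrix.vecMulVec_mul_vecMulVec, h]
    simp
  inv_val := by
    rw [sub_mul, one_mul, mul_add, mul_one, Matrix.vecMulVec_mul_vecMulVec, h]
    simp

theorem rankOneGL_mem {v w : Fin n → F} (h : w ⬝ᵥ v = 0) (hv : ∀ i, v i ∈ 𝒪[F])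
    (hw : ∀ i, w i ∈ 𝒪[F]) : rankOneGL v w h ∈ maxCompact F n := by
  have h1 : ∀ i j, (1 : Matrix (Fin n) (Fin n) F) i j ∈ 𝒪[F] := by
    intro i j
    rw [Matrix.one_apply]
    split_ifs
    · exact one_mem _
    · exact zero_mem _
  exact (mem_maxCompact_iff _).2 ⟨fun i j => add_mem (h1 i j) (mul_mem (hv i) (hw j)),
    fun i j => sub_mem (h1 i j) (mul_mem (hv i) (hw j))⟩

theorem rankOneGL_mul_apply {v w : Fin n → F} (h : w ⬝ᵥ v = 0) (g : GL) (i j : Fin n) :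
    (rankOneGL v w h * g).1 i j = g.1 i j + v i * ∑ k, w k * g.1 k j := by
  change ((1 + Matrix.vecMulVec v w) * g.1) i j = _
  rw [add_mul, one_mul, Matrix.vecMulVec_mul]
  rfl

theorem mul_rankOneGL_apply {v w : Fin n → F} (h : w ⬝ᵥ v = 0) (g : GL) (i j : Fin n) :
    (g * rankOneGL v w h).1 i j = g.1 i j + (∑ k, g.1 i k * v k) * w j := by
  change (g.1 * (1 + Matrix.vecMulVec v w)) i j = _
  rw [mul_add, mul_one, Matrix.mul_vecMulVec]
  rfl

theorem div_mem_integer {x y : F} (h : valuation F x ≤ valuation F y) : x / y ∈ 𝒪[F] := by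
  rw [mem_integer_iff, map_div₀]
  exact div_le_one_of_le₀ h zero_le

/-- The bound on the valuation covers the case `y = 0`: then `x = 0` too, so a zero pivot needs no
separate treatment in the elimination. -/
theorem sub_div_mul_eq_zero {x y : F} (h : valuation F x ≤ valuation F y) :
    x + -(x / y) * y = 0 := by
  rcases eq_or_ne y 0 with rfl | hy
  · rw [map_zero, le_zero_iff, map_eq_zero] at h
    simp [h]
  · field_simp
    ring

/-- Clearing the entries of column `m` below an entry of maximal valuation by row operations. -/
theorem exists_clear_column (g : GL) (m : Fin n)
    (hmax : ∀ i, m < i → valuation F (g.1 i m) ≤ valuation F (g.1 m m)) :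
    ∃ k ∈ maxCompact F n, (∀ i, m < i → (k * g).1 i m = 0) ∧
      (∀ i j, g.1 m j = 0 → (k * g).1 i j = g.1 i j) ∧
      (∀ i j, i ≤ m → (k * g).1 i j = g.1 i j) := by
  let v : Fin n → F := fun i => if m < i then -(g.1 i m / g.1 m m) else 0
  have hvm : Pi.single m (1 : F) ⬝ᵥ v = 0 := by simp [v]
  have e : ∀ i j, (rankOneGL v _ hvm * g).1 i j = g.1 i j + v i * g.1 m j := by
    intro i j
    rw [rankOneGL_mul_apply]
    simp [Pi.single_apply]
  refine ⟨rankOneGL v _ hvm, rankOneGL_mem hvm ?_ ?_, ?_, ?_, ?_⟩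
  · intro i
    simp only [v]
    split_ifs with h
    · exact neg_mem (div_mem_integer (hmax i h))
    · exact zero_mem _
  · intro i
    rw [Pi.single_apply]
    split_ifs
    · exact one_mem _
    · exact zero_mem _
  · intro i hi
    rw [e]
    simp only [v, if_pos hi]
    exact sub_div_mul_eq_zero (hmax i hi)
  · intro i j h
    rw [e, h, mul_zero, add_zero]
  · intro i j h
    rw [e]
    simp [v, not_lt.2 h]

/-- Clearing the entries of row `m` to the right of an entry of maximal valuation by column
operations. -/
theorem exists_clear_row (g : GL) (m : Fin n)
    (hmax : ∀ j, m < j → valuation F (g.1 m j) ≤ valuation F (g.1 m m)) :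
    ∃ k ∈ maxCompact F n, (∀ j, m < j → (g * k).1 m j = 0) ∧
      (∀ i j, g.1 i m = 0 → (g * k).1 i j = g.1 i j) ∧
      (∀ i j, j ≤ m → (g * k).1 i j = g.1 i j) := by
  let w : Fin n → F := fun j => if m < j then -(g.1 m j / g.1 m m) else 0
  have hwm : w ⬝ᵥ Pi.single m (1 : F) = 0 := by simp [w]
  have e : ∀ i j, (g * rankOneGL _ w hwm).1 i j = g.1 i j + w j * g.1 i m := by
    intro i j
    rw [mul_rankOneGL_apply]
    simp [Pi.single_apply, mul_comm]
  refine ⟨rankOneGL _ w hwm, rankOneGL_mem hwm ?_ ?_, ?_, ?_, ?_⟩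
  · intro i
    rw [Pi.single_apply]
    split_ifs
    · exact one_mem _
    · exact zero_mem _
  · intro i
    simp only [w]
    split_ifs with h
    · exact neg_mem (div_mem_integer (hmax i h))
    · exact zero_mem _
  · intro j hj
    rw [e]
    simp only [w, if_pos hj]
    exact sub_div_mul_eq_zero (hmax j hj)
  · intro i j h
    rw [e, h, mul_zero, add_zero]
  · intro i j h
    rw [e]
    simp [w, not_lt.2 h]

/-- Gaussian elimination over `𝒪[F]`: with the entry of largest valuation as pivot, all multipliers
are integral. Columns cleared earlier survive because the pivot row is zero there. -/
theorem exists_mul_upperTriangular (g : GL) :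
    ∃ k ∈ maxCompact F n, ∀ i j, j < i → (k * g).1 i j = 0 := by
  have key : ∀ m : ℕ, m ≤ n → ∃ k ∈ maxCompact F n, ∀ i j : Fin n, j < i → (j : ℕ) < m →
      (k * g).1 i j = 0 := by
    intro m
    induction m with
    | zero => exact fun _ => ⟨1, one_mem _, fun i j _ h => absurd h (Nat.not_lt_zero _)⟩
    | succ m ih =>
      intro hm
      obtain ⟨k, hk, hz⟩ := ih (by omega)
      let c : Fin n := ⟨m, by omega⟩
      obtain ⟨a, ha, hmax⟩ := Finset.exists_max_image (Finset.Ici c)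
        (fun i => valuation F ((k * g).1 i c)) ⟨c, by simp⟩
      rw [Finset.mem_Ici] at ha
      have hmov : ∀ i, c ≤ i → c ≤ Equiv.swap c a i := by
        intro i hi
        rw [Equiv.swap_apply_def]
        split_ifs <;> first | assumption | exact le_rfl
      have hfix : ∀ i, i < c → Equiv.swap c a i = i := fun i hi =>
        Equiv.swap_apply_of_ne_of_ne hi.ne (hi.trans_le ha).ne
      set h : GL := permGL (Equiv.swap c a) * (k * g) with hh
      have hzero : ∀ i j : Fin n, j < i → j < c → h.1 i j = 0 := by
        intro i j hij hj
        rw [hh, permGL_mul_apply]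
        rcases lt_or_ge i c with hi | hi
        · rw [hfix i hi]
          exact hz i j hij hj
        · exact hz _ j (hj.trans_le (hmov i hi)) hj
      obtain ⟨k', hk', h1, h2, h3⟩ := exists_clear_column h c (fun i hi => by
        rw [hh, permGL_mul_apply, permGL_mul_apply, Equiv.swap_apply_left]
        exact hmax _ (Finset.mem_Ici.2 (hmov i hi.le)))
      refine ⟨k' * (permGL (Equiv.swap c a) * k),
        mul_mem hk' (mul_mem (permGL_mem _) hk), fun i j hij hj => ?_⟩
      rw [mul_assoc, mul_assoc]
      rcases eq_or_lt_of_le (show j ≤ c from Nat.lt_succ_iff.1 hj) with rfl | hj'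
      · exact h1 i hij
      · rw [h2 i j (hzero c j hj' hj')]
        exact hzero i j hij hj'
  obtain ⟨k, hk, h⟩ := key n le_rfl
  exact ⟨k, hk, fun i j hij => h i j hij j.2⟩

/-- Elimination on both sides, where the pivot is an entry of largest valuation in the whole
remaining block, so that its row and its column can both be cleared integrally. -/
theorem exists_mul_mul_diagonal (g : GL) :
    ∃ k₁ ∈ maxCompact F n, ∃ k₂ ∈ maxCompact F n, ∀ i j, i ≠ j → (k₁ * g * k₂).1 i j = 0 := by
  have key : ∀ m : ℕ, m ≤ n → ∃ k₁ ∈ maxCompact F n, ∃ k₂ ∈ maxCompact F n,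
      ∀ i j : Fin n, i ≠ j → ((i : ℕ) < m ∨ (j : ℕ) < m) → (k₁ * g * k₂).1 i j = 0 := by
    intro m
    induction m with
    | zero =>
      exact fun _ => ⟨1, one_mem _, 1, one_mem _, fun i j _ h => absurd h (by simp)⟩
    | succ m ih =>
      intro hm
      obtain ⟨k₁, hk₁, k₂, hk₂, hz⟩ := ih (by omega)
      let c : Fin n := ⟨m, by omega⟩
      obtain ⟨⟨a, b⟩, hab, hmax⟩ := Finset.exists_max_image (Finset.Ici c ×ˢ Finset.Ici c)
        (fun i => valuation F ((k₁ * g * k₂).1 i.1 i.2)) ⟨(c, c), by simp⟩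
      rw [Finset.mem_product, Finset.mem_Ici, Finset.mem_Ici] at hab
      obtain ⟨ha, hb⟩ := hab
      simp only at ha hb hmax
      have hmov : ∀ a i, c ≤ a → c ≤ i → c ≤ Equiv.swap c a i := by
        intro a i ha hi
        rw [Equiv.swap_apply_def]
        split_ifs <;> first | assumption | exact le_rfl
      have hfix : ∀ a i, c ≤ a → i < c → Equiv.swap c a i = i := fun a i ha hi =>
        Equiv.swap_apply_of_ne_of_ne hi.ne (hi.trans_le ha).ne
      set h : GL := permGL (Equiv.swap c a) * (k₁ * g * k₂) * permGL (Equiv.swap c b) with hh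
      have happ : ∀ i j, h.1 i j = (k₁ * g * k₂).1 (Equiv.swap c a i) (Equiv.swap c b j) := by
        intro i j
        rw [hh, mul_permGL_apply, permGL_mul_apply, Equiv.symm_swap]
      have hzero : ∀ i j : Fin n, i ≠ j → (i < c ∨ j < c) → h.1 i j = 0 := by
        intro i j hij hc
        rw [happ]
        rcases lt_or_ge i c with hi | hi
        · rw [hfix a i ha hi]
          refine hz _ _ ?_ (Or.inl hi)
          rcases lt_or_ge j c with hj | hj
          · rwa [hfix b j hb hj]
          · exact (hi.trans_le (hmov b j hb hj)).ne
        · have hj : j < c := hc.resolve_left (not_lt.2 hi)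
          rw [hfix b j hb hj]
          exact hz _ _ (hj.trans_le (hmov a i ha hi)).ne' (Or.inr hj)
      have hmax' : ∀ i j, c ≤ i → c ≤ j → valuation F (h.1 i j) ≤ valuation F (h.1 c c) := by
        intro i j hi hj
        rw [happ, happ, Equiv.swap_apply_left, Equiv.swap_apply_left]
        exact hmax (_, _) (Finset.mem_product.2 ⟨Finset.mem_Ici.2 (hmov a i ha hi),
          Finset.mem_Ici.2 (hmov b j hb hj)⟩)
      obtain ⟨l, hl, h1, h2, h3⟩ := exists_clear_column h c
        (fun i hi => hmax' i c hi.le le_rfl)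
      -- Clearing the column does not alter row `c`, so the pivot is still maximal in that row.
      obtain ⟨r, hr, h4, h5, h6⟩ := exists_clear_row (l * h) c (fun j hj => by
        rw [h3 c j le_rfl, h3 c c le_rfl]
        exact hmax' c j le_rfl hj.le)
      have hcol : ∀ i, i ≠ c → (l * h).1 i c = 0 := by
        intro i hi
        rcases lt_or_gt_of_ne hi with hi' | hi'
        · rw [h3 i c hi'.le]
          exact hzero i c hi (Or.inl hi')
        · exact h1 i hi'
      refine ⟨l * (permGL (Equiv.swap c a) * k₁), mul_mem hl (mul_mem (permGL_mem _) hk₁),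
        k₂ * permGL (Equiv.swap c b) * r, mul_mem (mul_mem hk₂ (permGL_mem _)) hr,
        fun i j hij hc => ?_⟩
      have e : l * (permGL (Equiv.swap c a) * k₁) * g * (k₂ * permGL (Equiv.swap c b) * r) =
          l * h * r := by
        rw [hh]
        simp only [mul_assoc]
      rw [e]
      rcases eq_or_ne i c with rfl | hi
      · rcases lt_or_gt_of_ne hij with hj | hj
        · exact h4 j hj
        · rw [h6 _ j hj.le, h3 _ j le_rfl]
          exact hzero _ j hij (Or.inr hj)
      · rw [h5 i j (hcol i hi)]
        rcases eq_or_ne j c with rfl | hj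
        · exact hcol i hi
        · have hc' : i < c ∨ j < c := by
            refine hc.imp (fun h => lt_of_le_of_ne ?_ hi) (fun h => lt_of_le_of_ne ?_ hj) <;>
            exact Nat.lt_succ_iff.1 h
          rcases lt_or_ge j c with hj' | hj'
          · rw [h2 i j (hzero c j hj'.ne' (Or.inr hj'))]
            exact hzero i j hij hc'
          · have hi' : i < c := hc'.resolve_right (not_lt.2 hj')
            rw [h3 i j hi'.le]
            exact hzero i j hij hc'
  obtain ⟨k₁, hk₁, k₂, hk₂, h⟩ := key n le_rfl
  exact ⟨k₁, hk₁, k₂, hk₂, fun i j hij => h i j hij (Or.inl i.2)⟩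

end MaxCompact
-- Iwasawa and Cartan decompositions, with uniqueness of the exponents.
section Decomposition

variable {F : Type*} [Field F] [ValuativeRel F] {n : ℕ}

local notation "GL" => Matrix.GeneralLinearGroup (Fin n) F

theorem diag_coe (t : Fin n → Fˣ) : (diag t).1 = Matrix.diagonal fun i => (t i : F) := rfl

theorem diag_mul (s t : Fin n → Fˣ) : diag s * diag t = diag (s * t) := by
  unfold diag
  rw [← map_mul, ← map_mul]

theorem diag_mul_apply (t : Fin n → Fˣ) (g : GL) (i j : Fin n) :
    (diag t * g).1 i j = t i * g.1 i j := by
  change (Matrix.diagonal (fun i => (t i : F)) * g.1) i j = _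
  rw [Matrix.diagonal_mul]

theorem mul_diag_apply (t : Fin n → Fˣ) (g : GL) (i j : Fin n) :
    (g * diag t).1 i j = g.1 i j * t j := by
  change (g.1 * Matrix.diagonal (fun i => (t i : F))) i j = _
  rw [Matrix.mul_diagonal]

theorem powDiag_mul_apply (ϖ : Fˣ) (μ : Fin n → ℤ) (g : GL) (i j : Fin n) :
    (powDiag ϖ μ * g).1 i j = ((ϖ ^ μ i : Fˣ) : F) * g.1 i j := diag_mul_apply _ g i j

theorem mul_powDiag_apply (ϖ : Fˣ) (μ : Fin n → ℤ) (g : GL) (i j : Fin n) :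
    (g * powDiag ϖ μ).1 i j = g.1 i j * ((ϖ ^ μ j : Fˣ) : F) := mul_diag_apply _ g i j

theorem diag_one : (diag 1 : GL) = 1 := by
  have h := diag_mul (1 : Fin n → Fˣ) 1
  rw [mul_one] at h
  exact mul_eq_left.1 h

theorem diag_mem {t : Fin n → Fˣ} (ht : ∀ i, valuation F (t i : F) = 1) :
    diag t ∈ maxCompact F n := by
  refine mem_maxCompact_of_det (fun i j => ?_) ?_
  · rw [diag_coe, Matrix.diagonal_apply]
    split_ifs
    · exact (ht i).le
    · exact zero_mem _
  · rw [diag_coe, Matrix.det_diagonal, map_prod]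
    exact Finset.prod_eq_one fun i _ => ht i

theorem powDiag_add (ϖ : Fˣ) (μ ν : Fin n → ℤ) :
    powDiag ϖ (μ + ν) = powDiag ϖ μ * powDiag ϖ ν := by
  unfold powDiag
  rw [diag_mul]
  congr 1
  ext i
  simp [zpow_add]

theorem powDiag_zero (ϖ : Fˣ) : powDiag ϖ (0 : Fin n → ℤ) = 1 := by
  have h := powDiag_add ϖ (0 : Fin n → ℤ) 0
  rw [add_zero] at h
  exact (left_eq_mul.1 h)

theorem powDiag_neg (ϖ : Fˣ) (μ : Fin n → ℤ) : powDiag ϖ (-μ) = (powDiag ϖ μ)⁻¹ := by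
  rw [eq_inv_iff_mul_eq_one, ← powDiag_add, neg_add_cancel, powDiag_zero]

theorem det_powDiag (ϖ : Fˣ) (μ : Fin n → ℤ) :
    (powDiag ϖ μ).1.det = ((ϖ ^ (∑ i, μ i) : Fˣ) : F) := by
  unfold powDiag
  rw [diag_coe, Matrix.det_diagonal, ← Units.coe_prod]
  congr 1
  have h := map_prod (zpowersHom Fˣ ϖ) (fun i => Multiplicative.ofAdd (μ i)) Finset.univ
  simp only [zpowersHom_apply, toAdd_prod, toAdd_ofAdd] at h
  exact h.symm

theorem powDiag_conj_apply (ϖ : Fˣ) (μ : Fin n → ℤ) (g : GL) (i j : Fin n) :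
    (powDiag ϖ (-μ) * g * powDiag ϖ μ).1 i j = ((ϖ ^ (μ j - μ i) : Fˣ) : F) * g.1 i j := by
  unfold powDiag
  rw [mul_diag_apply, diag_mul_apply, sub_eq_add_neg, zpow_add, Units.val_mul]
  simp only [Pi.neg_apply]
  ring

/-- Conjugation of a diagonal matrix by a permutation matrix. -/
theorem permGL_conj_powDiag (ϖ : Fˣ) (μ : Fin n → ℤ) (σ : Equiv.Perm (Fin n)) :
    permGL σ * powDiag ϖ μ * permGL σ.symm = powDiag ϖ (μ ∘ σ) := by
  ext i j
  rw [mul_permGL_apply, permGL_mul_apply]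
  simp only [powDiag, diag_coe, Matrix.diagonal_apply, Function.comp, Equiv.symm_symm]
  simp

theorem unipotent_blockTriangular {u : GL} (hu : u ∈ unipotent F n) :
    Matrix.BlockTriangular u.1 id := fun i j h => hu.2 i j h

theorem mul_apply_diag_of_upper {M N : Matrix (Fin n) (Fin n) F}
    (hM : ∀ i j, j < i → M i j = 0) (hN : ∀ i j, j < i → N i j = 0) (i : Fin n) :
    (M * N) i i = M i i * N i i := by
  rw [Matrix.mul_apply, Finset.sum_eq_single i]
  · intro j _ hj
    rcases lt_or_gt_of_ne hj with h | h
    · rw [hM i j h, zero_mul]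
    · rw [hN j i h, mul_zero]
  · simp

theorem mul_apply_superdiag_of_upper {M N : Matrix (Fin n) (Fin n) F}
    (hM : ∀ i j, j < i → M i j = 0) (hN : ∀ i j, j < i → N i j = 0) {i j : Fin n}
    (hij : (j : ℕ) = i + 1) :
    (M * N) i j = M i i * N i j + M i j * N j j := by
  have hne : i ≠ j := fun h => by rw [h] at hij; omega
  rw [Matrix.mul_apply, ← Finset.sum_subset (Finset.subset_univ {i, j}), Finset.sum_pair hne]
  intro a _ ha
  simp only [Finset.mem_insert, Finset.mem_singleton, not_or] at ha
  rcases lt_or_gt_of_ne ha.1 with h | h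
  · rw [hM i a h, zero_mul]
  · rw [hN a j, mul_zero]
    have h1 := Fin.lt_def.1 h
    have h2 : (a : ℕ) ≠ j := fun h => ha.2 (Fin.ext h)
    exact Fin.lt_def.2 (by omega)

theorem inv_upper {g : GL} (hg : ∀ i j, j < i → g.1 i j = 0) :
    ∀ i j, j < i → (g⁻¹).1 i j = 0 := by
  have : Invertible g.1 := g.isUnit.invertible
  have h := Matrix.blockTriangular_inv_of_blockTriangular (M := g.1) (b := id)
    (fun i j h => hg i j h)
  intro i j hij
  rw [Matrix.coe_units_inv]
  exact h hij

theorem mul_upper {g h : GL} (hg : ∀ i j, j < i → g.1 i j = 0) (hh : ∀ i j, j < i → h.1 i j = 0) :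
    ∀ i j, j < i → (g * h).1 i j = 0 := by
  have h1 : Matrix.BlockTriangular g.1 id := fun i j h => hg i j h
  have h2 : Matrix.BlockTriangular h.1 id := fun i j h => hh i j h
  exact fun i j hij => (h1.mul h2) hij

theorem inv_apply_diag_of_upper {g : GL} (hg : ∀ i j, j < i → g.1 i j = 0) (i : Fin n) :
    g.1 i i * (g⁻¹).1 i i = 1 := by
  rw [← mul_apply_diag_of_upper hg (inv_upper hg), ← Units.val_mul, mul_inv_cancel]
  simp

theorem unipotent_mul {u v : GL} (hu : u ∈ unipotent F n) (hv : v ∈ unipotent F n) :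
    u * v ∈ unipotent F n := by
  refine ⟨fun i => ?_, mul_upper hu.2 hv.2⟩
  rw [Units.val_mul, mul_apply_diag_of_upper hu.2 hv.2, hu.1, hv.1, one_mul]

theorem unipotent_inv {u : GL} (hu : u ∈ unipotent F n) : u⁻¹ ∈ unipotent F n := by
  refine ⟨fun i => ?_, inv_upper hu.2⟩
  have := inv_apply_diag_of_upper hu.2 i
  rwa [hu.1, one_mul] at this

theorem unipotent_one : (1 : GL) ∈ unipotent F n :=
  ⟨fun i => by simp, fun i j h => by simp [h.ne']⟩

theorem unipotent_conj (ϖ : Fˣ) (μ : Fin n → ℤ) {u : GL} (hu : u ∈ unipotent F n) :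
    powDiag ϖ (-μ) * u * powDiag ϖ μ ∈ unipotent F n := by
  refine ⟨fun i => ?_, fun i j h => ?_⟩
  · rw [powDiag_conj_apply, hu.1, sub_self, zpow_zero, Units.val_one, one_mul]
  · rw [powDiag_conj_apply, hu.2 i j h, mul_zero]

theorem unipotent_det {u : GL} (hu : u ∈ unipotent F n) : u.1.det = 1 := by
  rw [Matrix.det_of_isUpperTriangular (unipotent_blockTriangular hu)]
  exact Finset.prod_eq_one fun i _ => hu.1 i

theorem unipotent_mem_maxCompact {u : GL} (hu : u ∈ unipotent F n) (h : ∀ i j, u.1 i j ∈ 𝒪[F]) :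
    u ∈ maxCompact F n :=
  mem_maxCompact_of_det h (by rw [unipotent_det hu, map_one])

/-- This additivity is what makes `ψ` a character of `U`. -/
theorem superdiagSum_mul {u v : GL} (hu : u ∈ unipotent F n) (hv : v ∈ unipotent F n) :
    superdiagSum (u * v) = superdiagSum u + superdiagSum v := by
  unfold superdiagSum
  rw [← Finset.sum_add_distrib]
  refine Finset.sum_congr rfl fun i _ => ?_
  rw [← Finset.sum_add_distrib]
  refine Finset.sum_congr rfl fun j _ => ?_
  split_ifs with h
  · rw [Units.val_mul, mul_apply_superdiag_of_upper hu.2 hv.2 h, hu.1, hv.1]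
    ring
  · simp

theorem superdiagSum_mem {u : GL} (h : ∀ i j : Fin n, (j : ℕ) = i + 1 → u.1 i j ∈ 𝒪[F]) :
    superdiagSum u ∈ 𝒪[F] := by
  refine sum_mem fun i _ => sum_mem fun j _ => ?_
  split_ifs with hij
  · exact h i j hij
  · exact zero_mem _

/-- Two representatives `u ϖ^μ` and `v ϖ^ν` of the same right coset of `K` have `μ = ν`. -/
theorem eq_of_unipotent_mul_powDiag {ϖ : Fˣ} (hϖ : IsUniformizer ϖ) {u v : GL}
    (hu : u ∈ unipotent F n) (hv : v ∈ unipotent F n) {μ ν : Fin n → ℤ} {k : GL}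
    (hk : k ∈ maxCompact F n) (h : u * powDiag ϖ μ * k = v * powDiag ϖ ν) :
    μ = ν ∧ powDiag ϖ (-μ) * (u⁻¹ * v) * powDiag ϖ μ ∈ maxCompact F n := by
  have e : k = powDiag ϖ (-μ) * (u⁻¹ * v) * powDiag ϖ ν := by
    rw [mul_assoc, mul_assoc u⁻¹, ← h, powDiag_neg]
    group
  have hw := unipotent_mul (unipotent_inv hu) hv
  have e2 : k = (powDiag ϖ (-μ) * (u⁻¹ * v) * powDiag ϖ μ) * powDiag ϖ (ν - μ) := by
    rw [mul_assoc, ← powDiag_add, add_sub_cancel, e]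
  have hc := unipotent_conj ϖ μ hw
  -- As `k` is upper triangular, `k i i * k⁻¹ i i = 1` with both factors integral. Hence the
  -- diagonal entry `ϖ ^ (ν i - μ i)` has valuation one.
  have hup : ∀ i j, j < i → k.1 i j = 0 := by
    intro i j hij
    rw [e2, mul_powDiag_apply, hc.2 i j hij, zero_mul]
  have hd : ∀ i, k.1 i i = ((ϖ ^ (ν i - μ i) : Fˣ) : F) := by
    intro i
    rw [e2, mul_powDiag_apply, hc.1, one_mul, Pi.sub_apply]
  have hμν : μ = ν := by
    ext i
    have h1 := coe_mem_of_mem_maxCompact hk i i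
    have h2 := inv_coe_mem_of_mem_maxCompact hk i i
    have h3 := inv_apply_diag_of_upper hup i
    rw [hd] at h1 h3
    have h4 : valuation F ((ϖ ^ (ν i - μ i) : Fˣ) : F) = 1 := by
      refine le_antisymm h1 ?_
      have h5 := congrArg (valuation F) h3
      rw [map_mul, map_one] at h5
      rw [← h5]
      exact mul_le_of_le_one_right' h2
    have := hϖ.valuation_zpow_eq_one_iff.1 h4
    omega
  subst hμν
  exact ⟨rfl, e ▸ hk⟩

variable [TopologicalSpace F] [IsNonarchimedeanLocalField F]

/-- The Iwasawa decomposition. -/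
theorem exists_iwasawa {ϖ : Fˣ} (hϖ : IsUniformizer ϖ) (g : GL) :
    ∃ u ∈ unipotent F n, ∃ μ : Fin n → ℤ, ∃ k ∈ maxCompact F n, g = u * powDiag ϖ μ * k := by
  -- Row operations on `g⁻¹` put the factor from `K` on the right of `g`: if `k g⁻¹` is upper
  -- triangular, then `g = b k` with `b` upper triangular.
  obtain ⟨k, hk, hup⟩ := exists_mul_upperTriangular g⁻¹
  set b : GL := (k * g⁻¹)⁻¹ with hb
  have hbup := inv_upper hup
  rw [← hb] at hbup
  have hbd := inv_apply_diag_of_upper hbup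
  choose m y hy hmy using fun i =>
    hϖ.exists_zpow (Units.mk0 (b.1 i i) (left_ne_zero_of_mul_eq_one (hbd i)))
  refine ⟨b * diag (fun i => (ϖ ^ m i * y i)⁻¹), ⟨fun i => ?_, fun i j hij => ?_⟩, m,
    diag y * k, mul_mem (diag_mem hy) hk, ?_⟩
  · rw [mul_diag_apply, ← hmy, Units.val_inv_eq_inv_val, Units.val_mk0,
      mul_inv_cancel₀ (left_ne_zero_of_mul_eq_one (hbd i))]
  · rw [mul_diag_apply, hbup i j hij, zero_mul]
  · have : diag (fun i => (ϖ ^ m i * y i)⁻¹) * powDiag ϖ m * diag y = 1 := by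
      rw [powDiag, diag_mul, diag_mul]
      have : ((fun i => (ϖ ^ m i * y i)⁻¹) * fun i => ϖ ^ m i) * y = 1 := by
        ext1 i
        simp only [Pi.mul_apply, Pi.one_apply]
        rw [mul_assoc, inv_mul_cancel]
      rw [this, diag_one]
    calc g = b * (diag (fun i => (ϖ ^ m i * y i)⁻¹) * powDiag ϖ m * diag y) * k := by
          rw [this, hb]
          group
      _ = _ := by simp only [mul_assoc]

/-- The Cartan decomposition. -/
theorem exists_cartan {ϖ : Fˣ} (hϖ : IsUniformizer ϖ) (g : GL) :
    ∃ k₁ ∈ maxCompact F n, ∃ μ : Fin n → ℤ, ∃ k₂ ∈ maxCompact F n, Monotone μ ∧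
      g = k₁ * powDiag ϖ μ * k₂ := by
  obtain ⟨a, ha, b, hb, hz⟩ := exists_mul_mul_diagonal g
  have hne : ∀ i, (a * g * b).1 i i ≠ 0 := by
    intro i h0
    have hdet : (a * g * b).1.det = 0 := by
      refine Matrix.det_eq_zero_of_row_eq_zero i fun j => ?_
      rcases eq_or_ne i j with rfl | hij
      · exact h0
      · exact hz i j hij
    exact ((Matrix.isUnit_iff_isUnit_det _).1 (a * g * b).isUnit).ne_zero hdet
  choose m y hy hmy using fun i => hϖ.exists_zpow (Units.mk0 _ (hne i))
  have hd : a * g * b = powDiag ϖ m * diag y := by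
    ext i j
    rw [powDiag, diag_mul, diag_coe, Matrix.diagonal_apply]
    split_ifs with hij
    · subst hij
      rw [Pi.mul_apply, ← hmy, Units.val_mk0]
    · exact hz i j hij
  -- Permutation matrices lie in `K`, so the exponents may be sorted.
  set σ := Tuple.sort m with hσ
  refine ⟨a⁻¹ * permGL σ.symm, mul_mem (inv_mem ha) (permGL_mem _), m ∘ σ,
    permGL σ * diag y * b⁻¹, mul_mem (mul_mem (permGL_mem _) (diag_mem hy)) (inv_mem hb),
    Tuple.monotone_sort m, ?_⟩
  have h2 : (permGL σ.symm : GL) * permGL σ = 1 := by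
    have := permGL_conj_powDiag ϖ (0 : Fin n → ℤ) σ.symm
    rw [powDiag_zero, mul_one, Equiv.symm_symm] at this
    rw [this]
    exact powDiag_zero ϖ
  calc g = a⁻¹ * (powDiag ϖ m * diag y) * b⁻¹ := by rw [← hd]; group
    _ = a⁻¹ * ((permGL σ.symm * permGL σ) * powDiag ϖ m * (permGL σ.symm * permGL σ) * diag y) *
        b⁻¹ := by rw [h2, one_mul, mul_one]
    _ = _ := by rw [← permGL_conj_powDiag]; simp only [mul_assoc]

/-- Uniqueness in the Cartan decomposition. -/
theorem exists_perm_of_powDiag_eq {ϖ : Fˣ} (hϖ : IsUniformizer ϖ) {μ ν : Fin n → ℤ} {k₁ k₂ : GL}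
    (hk₁ : k₁ ∈ maxCompact F n) (hk₂ : k₂ ∈ maxCompact F n)
    (h : powDiag ϖ ν = k₁ * powDiag ϖ μ * k₂) : ∃ σ : Equiv.Perm (Fin n), ν = μ ∘ σ := by
  have hsum : ∑ i, μ i = ∑ i, ν i := by
    have hdet := congrArg (fun g : GL => valuation F g.1.det) h
    simp only [Units.val_mul, Matrix.det_mul, map_mul, valuation_det_of_mem_maxCompact hk₁,
      valuation_det_of_mem_maxCompact hk₂, det_powDiag, one_mul, mul_one] at hdet
    have : valuation F ((ϖ ^ (∑ i, ν i - ∑ i, μ i) : Fˣ) : F) = 1 := by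
      rw [zpow_sub, Units.val_mul, Units.val_inv_eq_inv_val, map_mul, map_inv₀, hdet]
      exact mul_inv_cancel₀ ((valuation F).ne_zero_iff.2 (Units.ne_zero _))
    have := hϖ.valuation_zpow_eq_one_iff.1 this
    omega
  have hk : ∀ i j, ((ϖ ^ (ν j - μ i) : Fˣ) : F) * (k₁⁻¹).1 i j ∈ 𝒪[F] := by
    intro i j
    have e : powDiag ϖ (-μ) * k₁⁻¹ * powDiag ϖ ν = k₂ := by
      rw [h, powDiag_neg]
      group
    have := coe_mem_of_mem_maxCompact hk₂ i j
    rw [← e, mul_powDiag_apply, powDiag_mul_apply] at this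
    rw [sub_eq_add_neg, zpow_add, Units.val_mul]
    convert this using 1
    simp only [Pi.neg_apply]
    ring
  -- The determinant of `k₁⁻¹` is a unit, so by the ultrametric inequality some term of its Leibniz
  -- expansion has all its factors of valuation one. At these places `hk` gives `μ (σ i) ≤ ν i`, and
  -- the equality of the sums forces equality throughout.
  obtain ⟨σ, hσ⟩ : ∃ σ : Equiv.Perm (Fin n), ∀ i, 1 ≤ valuation F ((k₁⁻¹).1 (σ i) i) := by
    by_contra hno
    push Not at hno
    have h1 := valuation_det_of_mem_maxCompact (inv_mem hk₁)
    have hlt : valuation F (k₁⁻¹).1.det < 1 := by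
      rw [Matrix.det_apply]
      refine Valuation.map_sum_lt _ one_ne_zero fun σ _ => ?_
      have hs : valuation F (Equiv.Perm.sign σ • ∏ i, (k₁⁻¹).1 (σ i) i) =
          ∏ i, valuation F ((k₁⁻¹).1 (σ i) i) := by
        rcases Int.units_eq_one_or (Equiv.Perm.sign σ) with h | h <;>
        simp [h, map_prod, Valuation.map_neg]
      rw [hs]
      obtain ⟨i, hi⟩ := hno σ
      rw [← Finset.mul_prod_erase _ _ (Finset.mem_univ i)]
      refine lt_of_le_of_lt (mul_le_of_le_one_right' ?_) hi
      exact Finset.prod_le_one' fun j _ => inv_coe_mem_of_mem_maxCompact hk₁ _ _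
    exact hlt.ne h1
  have hle : ∀ i, μ (σ i) ≤ ν i := by
    intro i
    have := hk (σ i) i
    have h2 : ((ϖ ^ (ν i - μ (σ i)) : Fˣ) : F) ∈ 𝒪[F] := by
      rw [mem_integer_iff] at this ⊢
      rw [map_mul] at this
      exact (le_mul_of_one_le_right' (hσ i)).trans this
    have := hϖ.zpow_mem_iff.1 h2
    omega
  refine ⟨σ, ?_⟩
  have hs : ∑ i, μ (σ i) = ∑ i, ν i := (Equiv.sum_comp σ μ).trans hsum
  ext i
  exact ((Finset.sum_eq_sum_iff_of_le fun i _ => hle i).1 hs i (Finset.mem_univ i)).symm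

end Decomposition
-- Representatives of the cosets `gK` in the double coset of `T^{(j)}`.
section Representatives

variable {F : Type*} [Field F] [ValuativeRel F] {n : ℕ}

local notation "GL" => Matrix.GeneralLinearGroup (Fin n) F

/-- The indicator function of `I`, with values in `ℤ`. -/
def indZ (I : Finset (Fin n)) : Fin n → ℤ := fun i => (ind I i : ℤ)

theorem indZ_apply (I : Finset (Fin n)) (i : Fin n) : indZ I i = if i ∈ I then 1 else 0 := by
  unfold indZ ind
  split_ifs <;> rfl

theorem indZ_injective : Function.Injective (indZ (n := n)) := by
  intro I J h
  ext i
  have := congrFun h i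
  rw [indZ_apply, indZ_apply] at this
  split_ifs at this with h1 h2 h2 <;> simp_all

theorem sum_indZ (I : Finset (Fin n)) : ∑ i, indZ I i = I.card := by
  simp [indZ_apply]

/-- The pairs `(a, b)` with `a ∈ I`, `b ∉ I` and `a < b`. -/
def pairs (I : Finset (Fin n)) : Finset (Fin n × Fin n) :=
  Finset.univ.filter fun p => p.1 ∈ I ∧ p.2 ∉ I ∧ p.1 < p.2

theorem mem_pairs {I : Finset (Fin n)} {p : Fin n × Fin n} :
    p ∈ pairs I ↔ p.1 ∈ I ∧ p.2 ∉ I ∧ p.1 < p.2 := by simp [pairs]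

theorem indZ_univ : indZ (Finset.univ : Finset (Fin n)) = fun _ => 1 := by
  ext i
  simp [indZ_apply]

theorem pairs_univ : pairs (Finset.univ : Finset (Fin n)) = ∅ := by
  rw [Finset.eq_empty_iff_forall_notMem]
  exact fun p hp => (mem_pairs.1 hp).2.1 (Finset.mem_univ _)

/-- The matrix with the entries `y a b` for `(a, b) ∈ pairs I`, and `0` elsewhere. -/
def pairsMatrix (I : Finset (Fin n)) (y : Fin n → Fin n → F) : Matrix (Fin n) (Fin n) F :=
  Matrix.of fun a b => if (a, b) ∈ pairs I then y a b else 0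

theorem pairsMatrix_apply (I : Finset (Fin n)) (y : Fin n → Fin n → F) (a b : Fin n) :
    pairsMatrix I y a b = if (a, b) ∈ pairs I then y a b else 0 := rfl

/-- Nonzero rows are indexed by `I` and nonzero columns by its complement, so the products vanish;
the matrices `1 + pairsMatrix I y` therefore multiply by adding their entries. -/
theorem pairsMatrix_mul (I : Finset (Fin n)) (y z : Fin n → Fin n → F) :
    pairsMatrix I y * pairsMatrix I z = 0 := by
  ext a b
  rw [Matrix.mul_apply, Matrix.zero_apply]
  refine Finset.sum_eq_zero fun c _ => ?_
  rw [pairsMatrix_apply, pairsMatrix_apply]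
  by_cases hc : c ∈ I
  · rw [if_neg fun h : (a, c) ∈ pairs I => (mem_pairs.1 h).2.1 hc, zero_mul]
  · rw [if_neg fun h : (c, b) ∈ pairs I => hc (mem_pairs.1 h).1, mul_zero]

/-- The unipotent matrix with the entries `y a b` at the places `(a, b) ∈ pairs I`. -/
def pairsGL (I : Finset (Fin n)) (y : Fin n → Fin n → F) : GL where
  val := 1 + pairsMatrix I y
  inv := 1 - pairsMatrix I y
  val_inv := by
    rw [add_mul, one_mul, mul_sub, mul_one, pairsMatrix_mul]
    simp
  inv_val := by
    rw [sub_mul, one_mul, mul_add, mul_one, pairsMatrix_mul]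
    simp

theorem pairsGL_inv_mul (I : Finset (Fin n)) (y : Fin n → Fin n → F) (g : GL) (a c : Fin n) :
    ((pairsGL I y)⁻¹ * g).1 a c = g.1 a c - ∑ b, pairsMatrix I y a b * g.1 b c := by
  change ((1 - pairsMatrix I y) * g.1) a c = _
  rw [sub_mul, one_mul]
  rfl

theorem pairsGL_inv_mul_pairsGL (I : Finset (Fin n)) (y z : Fin n → Fin n → F) :
    ((pairsGL I y)⁻¹ * pairsGL I z).1 = 1 + (pairsMatrix I z - pairsMatrix I y) := by
  change (1 - pairsMatrix I y) * (1 + pairsMatrix I z) = _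
  rw [sub_mul, one_mul, mul_add, mul_one, pairsMatrix_mul]
  abel

theorem pairsGL_mem_unipotent (I : Finset (Fin n)) (y : Fin n → Fin n → F) :
    pairsGL I y ∈ unipotent F n := by
  constructor
  · intro i
    change (1 + pairsMatrix I y) i i = 1
    rw [Matrix.add_apply, Matrix.one_apply_eq, pairsMatrix_apply,
      if_neg fun h => lt_irrefl _ (mem_pairs.1 h).2.2, add_zero]
  · intro i j h
    change (1 + pairsMatrix I y) i j = 0
    rw [Matrix.add_apply, Matrix.one_apply_ne h.ne', pairsMatrix_apply,
      if_neg fun h' => lt_asymm h (mem_pairs.1 h').2.2, add_zero]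

theorem one_apply_mem_integer (i j : Fin n) : (1 : Matrix (Fin n) (Fin n) F) i j ∈ 𝒪[F] := by
  rw [Matrix.one_apply]
  split_ifs
  · exact one_mem _
  · exact zero_mem _

theorem pairsGL_mem_maxCompact (I : Finset (Fin n)) {y : Fin n → Fin n → F}
    (hy : ∀ a b, y a b ∈ 𝒪[F]) : pairsGL I y ∈ maxCompact F n := by
  refine unipotent_mem_maxCompact (pairsGL_mem_unipotent I y) fun i j => ?_
  refine add_mem (one_apply_mem_integer i j) ?_
  rw [pairsMatrix_apply]
  split_ifs
  · exact hy i j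
  · exact zero_mem _

theorem exists_perm_indZ {I J : Finset (Fin n)} (h : I.card = J.card) :
    ∃ σ : Equiv.Perm (Fin n), indZ I = indZ J ∘ σ := by
  let e : {x // x ∈ I} ≃ {x // x ∈ J} := Finset.equivOfCardEq h
  refine ⟨e.extendSubtype, ?_⟩
  ext i
  rw [Function.comp, indZ_apply, indZ_apply]
  by_cases hi : i ∈ I
  · rw [if_pos hi, if_pos (e.extendSubtype_mem i hi)]
  · rw [if_neg hi, if_neg (e.extendSubtype_not_mem i hi)]

theorem indicator_initial (j : ℕ) : (fun i : Fin n => if (i : ℕ) < j then (1 : ℤ) else 0) =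
    indZ (Finset.univ.filter fun i : Fin n => (i : ℕ) < j) := by
  ext i
  simp [indZ_apply]

theorem card_initial {j : ℕ} (hj : j ≤ n) :
    (Finset.univ.filter fun i : Fin n => (i : ℕ) < j).card = j := by
  rw [Fin.card_filter_val_lt, min_eq_right hj]

theorem pairsGL_mul_powDiag_mem (ϖ : Fˣ) {j : ℕ} (hj : j ≤ n) {I : Finset (Fin n)}
    (hI : I.card = j) {y : Fin n → Fin n → F} (hy : ∀ a b, y a b ∈ 𝒪[F]) :
    pairsGL I y * powDiag ϖ (indZ I) ∈ DoubleCoset.doubleCoset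
      (powDiag ϖ fun i : Fin n => if (i : ℕ) < j then 1 else 0)
      (maxCompact F n : Set GL) (maxCompact F n) := by
  rw [indicator_initial]
  obtain ⟨σ, hσ⟩ := exists_perm_indZ (hI.trans (card_initial hj).symm)
  refine DoubleCoset.mem_doubleCoset.2 ⟨pairsGL I y * permGL σ,
    mul_mem (pairsGL_mem_maxCompact I hy) (permGL_mem σ), permGL σ.symm, permGL_mem _, ?_⟩
  rw [hσ, ← permGL_conj_powDiag]
  simp only [mul_assoc]

/-- Conjugation by `ϖ^{1_I}` divides the entries at `pairs I` by `ϖ`, so a coset remembers exactly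
`I` and these entries modulo `ϖ`. -/
theorem eq_of_pairsGL_mul_powDiag {ϖ : Fˣ} (hϖ : IsUniformizer ϖ) {I J : Finset (Fin n)}
    {y z : Fin n → Fin n → F} {k : GL} (hk : k ∈ maxCompact F n)
    (h : pairsGL I y * powDiag ϖ (indZ I) * k = pairsGL J z * powDiag ϖ (indZ J)) :
    I = J ∧ ∀ a b, (a, b) ∈ pairs I → ((ϖ⁻¹ : Fˣ) : F) * (z a b - y a b) ∈ 𝒪[F] := by
  obtain ⟨h1, h2⟩ := eq_of_unipotent_mul_powDiag hϖ (pairsGL_mem_unipotent I y)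
    (pairsGL_mem_unipotent J z) hk h
  have hIJ := indZ_injective h1
  subst hIJ
  refine ⟨rfl, fun a b hab => ?_⟩
  have h3 := coe_mem_of_mem_maxCompact h2 a b
  obtain ⟨ha, hb, hlt⟩ := mem_pairs.1 hab
  rw [powDiag_conj_apply, pairsGL_inv_mul_pairsGL, Matrix.add_apply, Matrix.one_apply_ne hlt.ne,
    Matrix.sub_apply, pairsMatrix_apply, pairsMatrix_apply, if_pos hab, if_pos hab, indZ_apply,
    indZ_apply, if_pos ha, if_neg hb, zero_add] at h3
  simpa using h3

theorem mul_mem_integer_entries {g h : GL} (hg : ∀ i j, g.1 i j ∈ 𝒪[F])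
    (hh : ∀ i j, h.1 i j ∈ 𝒪[F]) (i j : Fin n) : (g * h).1 i j ∈ 𝒪[F] := by
  rw [Units.val_mul, Matrix.mul_apply]
  exact sum_mem fun k _ => mul_mem (hg i k) (hh k j)

theorem powDiag_entries {ϖ : Fˣ} (hϖ : IsUniformizer ϖ) {μ : Fin n → ℤ} (hμ : ∀ i, 0 ≤ μ i)
    (i j : Fin n) : (powDiag ϖ μ).1 i j ∈ 𝒪[F] := by
  rw [powDiag, diag_coe, Matrix.diagonal_apply]
  split_ifs
  · exact hϖ.zpow_mem_iff.2 (hμ i)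
  · exact zero_mem _

theorem powDiag_const_comm (ϖ : Fˣ) (m : ℤ) (g : GL) :
    powDiag ϖ (fun _ => m) * g = g * powDiag ϖ (fun _ => m) := by
  ext i j
  rw [powDiag_mul_apply, mul_powDiag_apply, mul_comm]

/-- Modulo `ϖ`, each row `a ∈ I` of an integral upper triangular matrix `m` with `ϖ m⁻¹` integral
is a combination of the rows `b ∉ I`, `b > a`, where `I` is the set of the `i` such that the
diagonal entry of `m⁻¹` at `i` is `ϖ⁻¹`. -/
theorem exists_row_combination {ϖ : Fˣ} (hϖ : IsUniformizer ϖ) {m s : GL} {I : Finset (Fin n)}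
    (hs : ∀ i j, s.1 i j ∈ 𝒪[F])
    (hup : ∀ i j, j < i → s.1 i j = 0) (hd : ∀ a ∈ I, s.1 a a = 1)
    (hsm : s * m = powDiag ϖ fun _ => 1) (a : Fin n) (ha : a ∈ I) :
    ∃ x : Fin n → F, (∀ b, x b ∈ 𝒪[F]) ∧ (∀ b, x b ≠ 0 → b ∉ I ∧ a < b) ∧
      ∀ c, valuation F (m.1 a c - ∑ b, x b * m.1 b c) < 1 := by
  -- The induction runs downwards from the last row. Row `a` of `s * m = ϖ` expresses row `a` of
  -- `m`, modulo `ϖ`, by later rows, since `s a a = 1`; the later rows in `I` are already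
  -- combinations of rows outside `I`.
  induction a using WellFoundedGT.induction with
  | ind a ih =>
  choose x hx1 hx2 hx3 using ih
  let J := (Finset.Ioi a).filter (· ∈ I)
  let x' : Fin n → Fin n → F := fun b d =>
    if h : a < b ∧ b ∈ I then x b h.1 h.2 d else 0
  have hx' : ∀ b d, x' b d ∈ 𝒪[F] := by
    intro b d
    simp only [x']
    split_ifs with h
    · exact hx1 _ _ _ _
    · exact zero_mem _
  have hx'0 : ∀ b d, x' b d ≠ 0 → d ∉ I ∧ a < d := by
    intro b d h
    simp only [x'] at h
    split_ifs at h with hb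
    · exact (hx2 _ _ _ _ h).imp_right hb.1.trans
    · exact absurd rfl h
  -- The first term comes from the rows outside `I`; the sum results from substituting the inductive
  -- combinations for the rows `b ∈ J`.
  refine ⟨fun d => -(if d ∉ I ∧ a < d then s.1 a d else 0) - ∑ b ∈ J, s.1 a b * x' b d,
    fun d => ?_, fun d => ?_, fun c => ?_⟩
  · refine sub_mem (neg_mem ?_) (sum_mem fun b _ => mul_mem (hs a b) (hx' b d))
    split_ifs
    · exact hs a d
    · exact zero_mem _
  · intro h
    by_contra hd'
    apply h
    simp only
    rw [if_neg hd', Finset.sum_eq_zero, neg_zero, sub_zero]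
    intro b _
    by_contra h0
    exact hd' (hx'0 b d (right_ne_zero_of_mul h0))
  · have e1 : m.1 a c + ∑ d, (if d ∉ I ∧ a < d then s.1 a d else 0) * m.1 d c +
        ∑ b ∈ J, s.1 a b * m.1 b c = (powDiag ϖ fun _ => (1 : ℤ)).1 a c := by
      rw [← hsm, Units.val_mul, Matrix.mul_apply]
      have h2 : ∑ b ∈ J, s.1 a b * m.1 b c =
          ∑ d, (if d ∈ I ∧ a < d then s.1 a d else 0) * m.1 d c := by
        simp only [ite_mul, zero_mul]
        rw [← Finset.sum_filter]
        refine Finset.sum_congr ?_ fun _ _ => rfl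
        ext b
        simp [J, and_comm]
      have h3 : m.1 a c = ∑ d, (if d = a then s.1 a d else 0) * m.1 d c := by
        simp [ite_mul, hd a ha]
      rw [h2, h3, ← Finset.sum_add_distrib, ← Finset.sum_add_distrib]
      refine Finset.sum_congr rfl fun d _ => ?_
      rw [← add_mul, ← add_mul]
      congr 1
      rcases lt_trichotomy a d with h | h | h
      · by_cases hI : d ∈ I <;> simp [h, hI, h.ne']
      · simp [h]
      · simp [hup a d h, h.not_gt, h.ne]
    have e2 : m.1 a c - ∑ d, (-(if d ∉ I ∧ a < d then s.1 a d else 0) -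
        ∑ b ∈ J, s.1 a b * x' b d) * m.1 d c =
        (powDiag ϖ fun _ => (1 : ℤ)).1 a c - ∑ b ∈ J, s.1 a b * (m.1 b c - ∑ d, x' b d * m.1 d c) := by
      rw [← e1]
      simp only [mul_sub, sub_mul, neg_mul, Finset.sum_sub_distrib, Finset.sum_neg_distrib,
        Finset.mul_sum, Finset.sum_mul]
      rw [Finset.sum_comm (s := Finset.univ) (t := J)]
      simp only [mul_assoc]
      ring
    rw [e2]
    refine (valuation F).map_sub_lt ?_ ((valuation F).map_sum_lt one_ne_zero fun b hb => ?_)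
    · rw [powDiag, diag_coe, Matrix.diagonal_apply]
      split_ifs
      · simpa using hϖ.valuation_lt_one
      · simp
    · rw [map_mul]
      have hb' : a < b ∧ b ∈ I := by simpa [J] using hb
      refine lt_of_le_of_lt (mul_le_of_le_one_left' (hs a b)) ?_
      have := hx3 b hb'.1 hb'.2 c
      simpa only [x', dif_pos hb'] using this

variable [TopologicalSpace F] [IsNonarchimedeanLocalField F]

variable (F) in
/-- A representative in `𝒪_F` of an element of the residue field. -/
noncomputable def residueLift (x : 𝓀[F]) : F :=
  ((Function.surjInv IsLocalRing.residue_surjective x : 𝒪[F]) : F)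

theorem residueLift_mem (x : 𝓀[F]) : residueLift F x ∈ 𝒪[F] := Subtype.prop _

theorem valuation_lt_one_iff_residue (x : 𝒪[F]) :
    valuation F (x : F) < 1 ↔ IsLocalRing.residue 𝒪[F] x = 0 := by
  rw [IsLocalRing.residue_eq_zero_iff, IsLocalRing.mem_maximalIdeal, mem_nonunits_iff,
    (Valuation.integer.integers (valuation F)).isUnit_iff_valuation_eq_one]
  exact ⟨fun h => h.ne, fun h => lt_of_le_of_ne x.2 h⟩

theorem residue_surjInv (x : 𝓀[F]) : IsLocalRing.residue 𝒪[F]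
    (Function.surjInv IsLocalRing.residue_surjective x) = x :=
  Function.surjInv_eq IsLocalRing.residue_surjective x

theorem valuation_sub_residueLift (x : 𝒪[F]) :
    valuation F ((x : F) - residueLift F (IsLocalRing.residue 𝒪[F] x)) < 1 := by
  have := (valuation_lt_one_iff_residue (x - Function.surjInv IsLocalRing.residue_surjective
    (IsLocalRing.residue 𝒪[F] x))).2
  apply this
  rw [map_sub, residue_surjInv, sub_self]

theorem residueLift_injective {ϖ : Fˣ} (hϖ : IsUniformizer ϖ) {x y : 𝓀[F]}
    (h : ((ϖ⁻¹ : Fˣ) : F) * (residueLift F y - residueLift F x) ∈ 𝒪[F]) : x = y := by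
  have h1 : valuation F (residueLift F y - residueLift F x) < 1 := by
    have : residueLift F y - residueLift F x =
        ϖ * (((ϖ⁻¹ : Fˣ) : F) * (residueLift F y - residueLift F x)) := by
      rw [← mul_assoc, ← Units.val_mul, mul_inv_cancel, Units.val_one, one_mul]
    rw [this, map_mul]
    exact lt_of_le_of_lt (mul_le_of_le_one_right' h) hϖ.valuation_lt_one
  have h2 := (valuation_lt_one_iff_residue
    (Function.surjInv IsLocalRing.residue_surjective y -
      Function.surjInv IsLocalRing.residue_surjective x : 𝒪[F])).1 h1
  rw [map_sub, residue_surjInv, residue_surjInv, sub_eq_zero] at h2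
  exact h2.symm

open Classical in
/-- The unipotent matrix whose entries at `pairs I` lift given elements of the residue field. -/
noncomputable def liftGL (I : Finset (Fin n)) (x : pairs I → 𝓀[F]) : GL :=
  pairsGL I fun a b => if h : (a, b) ∈ pairs I then residueLift F (x ⟨(a, b), h⟩) else 0

open Classical in
theorem liftGL_inv_mul (I : Finset (Fin n)) (x : pairs I → 𝓀[F]) (g : GL) (a c : Fin n) :
    ((liftGL I x)⁻¹ * g).1 a c = g.1 a c -
      ∑ b, (if h : (a, b) ∈ pairs I then residueLift F (x ⟨(a, b), h⟩) else 0) * g.1 b c := by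
  rw [liftGL, pairsGL_inv_mul]
  congr 1
  refine Finset.sum_congr rfl fun b _ => ?_
  rw [pairsMatrix_apply]
  split_ifs <;> rfl

/-- In the Iwasawa form `g = m k`, `m = u ϖ^μ`, both `m` and `s = ϖ m⁻¹` are integral, because `g`
lies in `K ϖ^{1_J} K` and `0 ≤ 1_J ≤ 1`. Hence `μ = 1_I`, and comparing determinants gives `|I| =
j`. The coefficients that express the rows of `m` in `I` by the other rows modulo `ϖ` supply the
entries of the representative. -/
theorem exists_liftGL {ϖ : Fˣ} (hϖ : IsUniformizer ϖ) {j : ℕ} (hj : j ≤ n) {g : GL}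
    (hg : g ∈ DoubleCoset.doubleCoset (powDiag ϖ fun i : Fin n => if (i : ℕ) < j then 1 else 0)
      (maxCompact F n : Set GL) (maxCompact F n)) :
    ∃ I : Finset (Fin n), I.card = j ∧ ∃ x : pairs I → 𝓀[F], ∃ k ∈ maxCompact F n,
      g = liftGL I x * powDiag ϖ (indZ I) * k := by
  classical
  obtain ⟨k₁, hk₁, k₂, hk₂, hgk⟩ := DoubleCoset.mem_doubleCoset.1 hg
  rw [indicator_initial] at hgk
  set J := Finset.univ.filter fun i : Fin n => (i : ℕ) < j with hJ
  have hJc : J.card = j := card_initial hj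
  obtain ⟨u, hu, μ, k, hk, hgu⟩ := exists_iwasawa hϖ g
  set m : GL := u * powDiag ϖ μ with hm
  set s : GL := powDiag ϖ (fun _ => 1) * m⁻¹ with hs
  have hmup : ∀ i j, j < i → m.1 i j = 0 := by
    intro i j h
    rw [hm, mul_powDiag_apply, hu.2 i j h, zero_mul]
  have hmint : ∀ i j, m.1 i j ∈ 𝒪[F] := by
    have : m = k₁ * powDiag ϖ (indZ J) * (k₂ * k⁻¹) := by
      rw [← mul_assoc, ← hgk, hgu]
      group
    rw [this]
    refine mul_mem_integer_entries (mul_mem_integer_entries (coe_mem_of_mem_maxCompact hk₁)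
      (powDiag_entries hϖ fun i => ?_)) (coe_mem_of_mem_maxCompact (mul_mem hk₂ (inv_mem hk)))
    exact Int.natCast_nonneg _
  have hsint : ∀ i j, s.1 i j ∈ 𝒪[F] := by
    have : s = (k * k₂⁻¹) * powDiag ϖ ((fun _ => 1) - indZ J) * k₁⁻¹ := by
      have : m⁻¹ = k * (k₂⁻¹ * powDiag ϖ (-indZ J) * k₁⁻¹) := by
        have : m = g * k⁻¹ := by rw [hgu]; group
        rw [this, hgk, powDiag_neg]
        group
      rw [hs, this, powDiag_const_comm, sub_eq_neg_add, powDiag_add]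
      simp only [mul_assoc]
      rw [← powDiag_const_comm]
    rw [this]
    refine mul_mem_integer_entries (mul_mem_integer_entries
      (coe_mem_of_mem_maxCompact (mul_mem hk (inv_mem hk₂)))
      (powDiag_entries hϖ fun i => ?_)) (coe_mem_of_mem_maxCompact (inv_mem hk₁))
    rw [Pi.sub_apply, indZ_apply]
    split_ifs <;> simp
  have hsup : ∀ i j, j < i → s.1 i j = 0 := by
    intro i j h
    rw [hs, powDiag_mul_apply, inv_upper hmup i j h, mul_zero]
  have hmd : ∀ i, m.1 i i = ((ϖ ^ μ i : Fˣ) : F) := by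
    intro i
    rw [hm, mul_powDiag_apply, hu.1, one_mul]
  have hsd : ∀ i, s.1 i i = ((ϖ ^ (1 - μ i) : Fˣ) : F) := by
    intro i
    have h1 := inv_apply_diag_of_upper hmup i
    rw [hmd] at h1
    rw [hs, powDiag_mul_apply, zpow_sub, Units.val_mul, Units.val_inv_eq_inv_val,
      eq_inv_of_mul_eq_one_right h1]
  have hμ0 : ∀ i, 0 ≤ μ i := fun i => hϖ.zpow_mem_iff.1 (hmd i ▸ hmint i i)
  have hμ1 : ∀ i, μ i ≤ 1 := fun i => by
    have := hϖ.zpow_mem_iff.1 (hsd i ▸ hsint i i)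
    omega
  set I := Finset.univ.filter fun i => μ i = 1 with hI
  have hμI : μ = indZ I := by
    ext i
    have h0 := hμ0 i
    have h1 := hμ1 i
    rw [indZ_apply]
    simp only [hI, Finset.mem_filter, Finset.mem_univ, true_and]
    split_ifs <;> omega
  have hcard : I.card = j := by
    have h1 : valuation F g.1.det = valuation F ((ϖ ^ (J.card : ℤ) : Fˣ) : F) := by
      rw [hgk]
      simp only [Units.val_mul, Matrix.det_mul, map_mul, valuation_det_of_mem_maxCompact hk₁,
        valuation_det_of_mem_maxCompact hk₂, det_powDiag, sum_indZ, one_mul, mul_one]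
    have h2 : valuation F g.1.det = valuation F ((ϖ ^ (I.card : ℤ) : Fˣ) : F) := by
      rw [hgu, hm, hμI]
      simp only [Units.val_mul, Matrix.det_mul, map_mul, valuation_det_of_mem_maxCompact hk,
        unipotent_det hu, det_powDiag, sum_indZ, one_mul, mul_one]
    have h3 : valuation F ((ϖ ^ ((I.card : ℤ) - J.card) : Fˣ) : F) = 1 := by
      rw [zpow_sub, Units.val_mul, Units.val_inv_eq_inv_val, map_mul, map_inv₀, ← h1, ← h2]
      refine mul_inv_cancel₀ ((valuation F).ne_zero_iff.2 ?_)
      exact ((Matrix.isUnit_iff_isUnit_det _).1 g.isUnit).ne_zero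
    have := hϖ.valuation_zpow_eq_one_iff.1 h3
    omega
  have hrow := exists_row_combination hϖ (I := I) hsint hsup
    (fun a ha => by
      have : μ a = 1 := by simpa [hI] using ha
      rw [hsd, this, sub_self, zpow_zero, Units.val_one]) (by rw [hs, inv_mul_cancel_right])
  choose X hX1 hX2 hX3 using hrow
  set x : pairs I → 𝓀[F] := fun p => IsLocalRing.residue 𝒪[F]
    ⟨X p.1.1 (mem_pairs.1 p.2).1 p.1.2, hX1 _ _ _⟩ with hx
  -- Multiplication by `(liftGL I x)⁻¹` makes the rows in `I` divisible by `ϖ`, so dividing them by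
  -- `ϖ` leaves an integral matrix; its determinant is a unit.
  refine ⟨I, hcard, x, (powDiag ϖ (-indZ I) * ((liftGL I x)⁻¹ * m)) * k,
    mul_mem (mem_maxCompact_of_det (fun a c => ?_) ?_) hk, ?_⟩
  · rw [powDiag_mul_apply, liftGL_inv_mul, Pi.neg_apply, indZ_apply]
    by_cases ha : a ∈ I
    · rw [if_pos ha, zpow_neg, zpow_one]
      refine hϖ.exists_eq_mul_of_lt_one ?_
      rw [← sub_add_sub_cancel _ (∑ b, X a ha b * m.1 b c), ← Finset.sum_sub_distrib]
      refine (valuation F).map_add_lt (hX3 a ha c)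
        ((valuation F).map_sum_lt one_ne_zero fun b _ => ?_)
      rw [← sub_mul, map_mul]
      refine lt_of_le_of_lt (mul_le_of_le_one_right' (hmint b c)) ?_
      split_ifs with hab
      · exact valuation_sub_residueLift ⟨X a ha b, hX1 _ _ _⟩
      · have : X a ha b = 0 := by
          by_contra h0
          exact hab (mem_pairs.2 ⟨ha, hX2 a ha b h0⟩)
        rw [this]
        simp
    · rw [Finset.sum_eq_zero, sub_zero, if_neg ha]
      · simpa using hmint a c
      · intro b _
        rw [dif_neg fun h : (a, b) ∈ pairs I => ha (mem_pairs.1 h).1, zero_mul]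
  · have h1 : ((liftGL I x)⁻¹).1.det = 1 :=
      unipotent_det (unipotent_inv (pairsGL_mem_unipotent I _))
    rw [Units.val_mul, Units.val_mul, Matrix.det_mul, Matrix.det_mul, h1, one_mul, hm,
      Units.val_mul, Matrix.det_mul, unipotent_det hu, one_mul, det_powDiag,
      det_powDiag, ← Units.val_mul, ← zpow_add, hμI]
    simp
  · rw [hgu, powDiag_neg]
    group

end Representatives
-- The Hecke action on functions is a module structure.
section Action

open HeckeAlgebra

variable {G : Type*} [Group G] {A : Type*} [CommRing A] {K : Subgroup G}
  {R : Type*} [CommRing R] [Algebra A R]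

namespace HeckeAlgebra

theorem act_term_inv (z : HeckeAlgebra A K) {W : G → R} (hW : ∀ k ∈ K, ∀ g, W (g * k) = W g)
    (x : G) : ∀ k ∈ K, ∀ y, z (y * k) • W (x * (y * k)) = z y • W (x * y) := by
  intro k hk y
  rw [z.right_inv hk, ← mul_assoc, hW k hk]

theorem act_add_left (z w : HeckeAlgebra A K) (W : G → R) : act (z + w) W = act z W + act w W := by
  ext x
  simp only [act, add_apply, add_smul, Pi.add_apply]
  exact finsum_add_distrib (finite_act z _) (finite_act w _)

theorem act_smul_left (a : A) (z : HeckeAlgebra A K) (W : G → R) :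
    act (a • z) W = a • act z W := by
  ext x
  simp only [act, smul_apply, mul_smul, Pi.smul_apply]
  exact (smul_finsum' a (finite_act z _)).symm

theorem act_one {W : G → R} (hW : ∀ k ∈ K, ∀ g, W (g * k) = W g) :
    act (1 : HeckeAlgebra A K) W = W := by
  classical
  ext x
  rw [act, finsum_eq_single _ ((1 : G) : G ⧸ K)]
  · rw [apply_out (φ := fun y => (1 : HeckeAlgebra A K) y • W (x * y)) (act_term_inv 1 hW x)]
    simp [one_apply]
  · intro c hc
    rw [one_apply, if_neg, zero_smul]
    intro h
    apply hc
    rw [← QuotientGroup.out_eq' c]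
    exact QuotientGroup.eq.2 (by simpa using h)

theorem act_right_inv (z : HeckeAlgebra A K) {W : G → R} (hW : ∀ k ∈ K, ∀ g, W (g * k) = W g) :
    ∀ k ∈ K, ∀ g, act z W (g * k) = act z W g := by
  intro k hk g
  unfold act
  rw [← finsum_translate (φ := fun y => z y • W (g * y)) (act_term_inv z hW g) k]
  refine finsum_congr fun c => ?_
  rw [z.left_inv hk, mul_assoc]

/-- The argument for associativity of convolution, with `W` in the role of the third factor: the
inner sum is translated by `d.out⁻¹` and the two finite sums are exchanged. -/
theorem act_mul (f g : HeckeAlgebra A K) {W : G → R} (hW : ∀ k ∈ K, ∀ g, W (g * k) = W g) :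
    act (f * g) W = act f (act g W) := by
  classical
  ext x
  set S₁ := (finite_conv f g).toFinset with hS₁
  set S₂ := f.finite_supp.toFinset with hS₂
  have e1 : act (f * g) W x = ∑ c ∈ S₁, ∑ d ∈ S₂,
      (f d.out * g (d.out⁻¹ * c.out)) • W (x * c.out) := by
    rw [act, finsum_eq_sum_of_support_subset (s := S₁)]
    · refine Finset.sum_congr rfl fun c _ => ?_
      rw [mul_apply, finsum_eq_sum_of_support_subset (s := S₂), Finset.sum_smul]
      intro d hd
      simpa [hS₂] using left_ne_zero_of_mul hd
    · intro c hc
      have h0 : (f * g) c.out ≠ 0 := left_ne_zero_of_smul hc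
      rw [mul_apply] at h0
      obtain ⟨d, hd⟩ : ∃ d : G ⧸ K, f d.out * g (d.out⁻¹ * c.out) ≠ 0 := by
        by_contra hno
        simp only [not_exists, not_not] at hno
        exact h0 (by simp only [hno]; exact finsum_zero)
      exact (Set.Finite.mem_toFinset _).2 ⟨d, hd⟩
  have e2 : act f (act g W) x = ∑ d ∈ S₂, ∑ c ∈ S₁,
      (f d.out * g (d.out⁻¹ * c.out)) • W (x * c.out) := by
    rw [act, finsum_eq_sum_of_support_subset (s := S₂)]
    · refine Finset.sum_congr rfl fun d _ => ?_
      rw [act, ← finsum_translate (φ := fun y => g y • W (x * d.out * y))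
        (act_term_inv g hW _) d.out⁻¹, smul_finsum' _ ?_, finsum_eq_sum_of_support_subset (s := S₁)]
      · refine Finset.sum_congr rfl fun c _ => ?_
        rw [mul_smul, show x * d.out * (d.out⁻¹ * c.out) = x * c.out by group]
      · intro c hc
        rw [Function.mem_support, ← mul_smul] at hc
        exact (Set.Finite.mem_toFinset _).2 ⟨d, left_ne_zero_of_smul hc⟩
      · exact (finite_translate g _).subset fun c hc => left_ne_zero_of_smul hc
    · intro d hd
      simpa [hS₂] using left_ne_zero_of_smul hd
  rw [e1, e2, Finset.sum_comm]

end HeckeAlgebra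
end Action

/-! ### Explicit action of `T^{(j)}`, and vanishing at non-dominant weights. -/

section HeckeOperators

open HeckeAlgebra

variable {F : Type*} [Field F] [ValuativeRel F] {n : ℕ}
  [TopologicalSpace F] [IsNonarchimedeanLocalField F]
  {A : Type*} [CommRing A] {R : Type*} [CommRing R] [Algebra A R]

local notation "GL" => Matrix.GeneralLinearGroup (Fin n) F

theorem doubleCoset_apply {G : Type*} [Group G] {K : Subgroup G} (g : G)
    (h : {c : G ⧸ K | c.out ∈ DoubleCoset.doubleCoset g K K}.Finite) (x : G) :
    doubleCoset A K g h x = Set.indicator (DoubleCoset.doubleCoset g (K : Set G) K) 1 x := rfl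

/-- The sum of `φ` over the cosets in the double coset of `diag(ϖ, …, ϖ, 1, …, 1)`. -/
theorem finsum_heckeT {ϖ : Fˣ} (hϖ : IsUniformizer ϖ) {j : ℕ} (hj : j ≤ n) {φ : GL → R}
    (hφ : ∀ k ∈ maxCompact F n, ∀ g, φ (g * k) = φ g) {w : Finset (Fin n) → R}
    (hw : ∀ I : Finset (Fin n), I.card = j → ∀ y : Fin n → Fin n → F, (∀ a b, y a b ∈ 𝒪[F]) →
      φ (pairsGL I y * powDiag ϖ (indZ I)) = w I) :
    ∑ᶠ c : GL ⧸ maxCompact F n, heckeT n A ϖ j c.out • φ c.out =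
      ∑ I ∈ Finset.powersetCard j Finset.univ,
        (Nat.card 𝓀[F] : R) ^ (pairs I).card * w I := by
  classical
  have : Fintype 𝓀[F] := Fintype.ofFinite _
  -- The cosets are parametrised by `I` and a residue at each place of `pairs I`. As `φ` depends
  -- only on `I`, each `I` counts `q ^ |pairs I|` times.
  let ι := Σ I : {I // I ∈ Finset.powersetCard j (Finset.univ : Finset (Fin n))},
    (pairs I.1 → 𝓀[F])
  let Φ : ι → GL ⧸ maxCompact F n := fun p =>
    ((liftGL p.1.1 p.2 * powDiag ϖ (indZ p.1.1) : GL) : GL ⧸ maxCompact F n)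
  have hcard : ∀ I : {I // I ∈ Finset.powersetCard j (Finset.univ : Finset (Fin n))},
      I.1.card = j := fun I => (Finset.mem_powersetCard.1 I.2).2
  have hint : ∀ (I : Finset (Fin n)) (x : pairs I → 𝓀[F]) (a b : Fin n),
      (if h : (a, b) ∈ pairs I then residueLift F (x ⟨(a, b), h⟩) else 0) ∈ 𝒪[F] := by
    intro I x a b
    split_ifs
    · exact residueLift_mem _
    · exact zero_mem _
  have hinj : Function.Injective Φ := by
    rintro ⟨⟨I, hI⟩, x⟩ ⟨⟨J, hJ⟩, y⟩ h
    have hk := QuotientGroup.eq.1 h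
    obtain ⟨h1, h2⟩ := eq_of_pairsGL_mul_powDiag hϖ hk (mul_inv_cancel_left _ _)
    subst h1
    have hxy : x = y := by
      ext1 p
      have h3 := h2 p.1.1 p.1.2 p.2
      rw [dif_pos p.2, dif_pos p.2] at h3
      exact residueLift_injective hϖ h3
    rw [hxy]
  set S : Set (GL ⧸ maxCompact F n) := {c | c.out ∈ DoubleCoset.doubleCoset
    (powDiag ϖ fun i : Fin n => if (i : ℕ) < j then 1 else 0)
    (maxCompact F n : Set GL) (maxCompact F n)} with hS
  have hrange : Set.range Φ = S := by
    ext c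
    constructor
    · rintro ⟨⟨I, x⟩, rfl⟩
      obtain ⟨k, hk⟩ := QuotientGroup.mk_out_eq_mul (maxCompact F n)
        (liftGL I.1 x * powDiag ϖ (indZ I.1))
      rw [hS, Set.mem_ofPred_eq, hk]
      obtain ⟨a, ha, b, hb, e⟩ := DoubleCoset.mem_doubleCoset.1
        (pairsGL_mul_powDiag_mem ϖ hj (hcard I) (hint I.1 x))
      refine DoubleCoset.mem_doubleCoset.2 ⟨a, ha, b * k, mul_mem hb k.2, ?_⟩
      rw [← mul_assoc, ← e]
      rfl
    · intro hc
      obtain ⟨I, hI, x, k, hk, e⟩ := exists_liftGL hϖ hj hc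
      refine ⟨⟨⟨I, Finset.mem_powersetCard.2 ⟨Finset.subset_univ _, hI⟩⟩, x⟩, ?_⟩
      rw [← QuotientGroup.out_eq' c, e]
      exact (QuotientGroup.mk_mul_of_mem _ hk).symm
  have e1 : ∀ c : GL ⧸ maxCompact F n, heckeT n A ϖ j c.out • φ c.out =
      ∑ᶠ (_ : c ∈ S), φ c.out := by
    intro c
    rw [heckeT, doubleCoset_apply, finsum_eq_if]
    by_cases hc : c ∈ S
    · rw [Set.indicator_of_mem (show c.out ∈ _ from hc), if_pos hc, Pi.one_apply, one_smul]
    · rw [Set.indicator_of_notMem (show c.out ∉ _ from hc), if_neg hc, zero_smul]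
  rw [finsum_congr e1, ← hrange, finsum_mem_range hinj, finsum_eq_sum_of_fintype,
    Fintype.sum_sigma,
    ← Finset.sum_coe_sort (Finset.powersetCard j Finset.univ)]
  refine Finset.sum_congr rfl fun I _ => ?_
  have e2 : ∀ x : pairs I.1 → 𝓀[F], φ (Φ ⟨I, x⟩).out = w I.1 := by
    intro x
    rw [apply_out hφ]
    exact hw I.1 (hcard I) _ (hint I.1 x)
  rw [Finset.sum_congr rfl fun x _ => e2 x, Finset.sum_const, nsmul_eq_mul, Finset.card_univ,
    Fintype.card_fun, Nat.card_eq_fintype_card]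
  simp

/-- For increasing `μ`, conjugation by `ϖ^{-μ}` keeps an integral upper unipotent matrix integral,
so the unipotent part of each representative is absorbed on the right into `K`. -/
theorem heckeT_mul_powDiag {ϖ : Fˣ} (hϖ : IsUniformizer ϖ) {j : ℕ} (hj : j ≤ n)
    (z : HeckeAlgebra A (maxCompact F n)) {μ : Fin n → ℤ} (hμ : Monotone μ) :
    (heckeT n A ϖ j * z) (powDiag ϖ μ) = ∑ I ∈ Finset.powersetCard j Finset.univ,
      (Nat.card 𝓀[F] : A) ^ (pairs I).card * z (powDiag ϖ (μ - indZ I)) := by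
  rw [HeckeAlgebra.mul_apply]
  refine finsum_heckeT (A := A) (R := A) (φ := fun g => z (g⁻¹ * powDiag ϖ μ)) hϖ hj (fun k hk g => ?_)
    (fun I _ y hy => ?_)
  · rw [mul_inv_rev, mul_assoc, z.left_inv (inv_mem hk)]
  · have hu := unipotent_conj ϖ μ (unipotent_inv (pairsGL_mem_unipotent I y))
    have hk : powDiag ϖ (-μ) * (pairsGL I y)⁻¹ * powDiag ϖ μ ∈ maxCompact F n := by
      refine unipotent_mem_maxCompact hu fun a b => ?_
      rcases lt_or_ge b a with h | h
      · rw [hu.2 a b h]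
        exact zero_mem _
      · rw [powDiag_conj_apply]
        refine mul_mem (hϖ.zpow_mem_iff.2 (sub_nonneg.2 (hμ h))) ?_
        exact inv_coe_mem_of_mem_maxCompact (pairsGL_mem_maxCompact I hy) a b
    rw [← z.right_inv hk (powDiag ϖ (μ - indZ I))]
    congr 1
    rw [sub_eq_neg_add, powDiag_add, powDiag_neg, powDiag_neg]
    group

variable {ψ : AddChar F A}

theorem HasConductorZero.eq_one (hψ : HasConductorZero ψ) {x : F} (hx : x ∈ 𝒪[F]) : ψ x = 1 := by
  have := (hψ 1).2 (one_mem _) x hx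
  rwa [one_mul] at this

theorem isLocallyConstant_of_right_inv {W : GL → R}
    (hW : ∀ k ∈ maxCompact F n, ∀ g, W (g * k) = W g) : IsLocallyConstant W := by
  rw [IsLocallyConstant.iff_exists_open]
  intro x
  refine ⟨(fun y => x⁻¹ * y) ⁻¹' (maxCompact F n : Set GL),
    isOpen_maxCompact.preimage (continuous_const_mul _), by simp, fun y hy => ?_⟩
  have := hW _ hy x
  rwa [mul_inv_cancel_left] at this

theorem act_mem_sphericalWhittaker {W : GL → R} (hW : W ∈ sphericalWhittaker n ψ R)
    (z : HeckeAlgebra A (maxCompact F n)) : act z W ∈ sphericalWhittaker n ψ R := by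
  have hinv := act_right_inv z hW.2
  refine ⟨⟨isLocallyConstant_of_right_inv hinv, fun u hu g => ?_⟩, hinv⟩
  unfold act
  rw [mul_finsum' _ _ (finite_act z _)]
  refine finsum_congr fun c => ?_
  rw [mul_assoc, hW.1.2 u hu, mul_smul_comm]

/-- For decreasing `μ` the unipotent part of a representative, moved to the left of `ϖ^μ`, has an
integral superdiagonal; the character is trivial on it. -/
theorem act_heckeT_powDiag {ϖ : Fˣ} (hϖ : IsUniformizer ϖ) (hψ : HasConductorZero ψ) {j : ℕ}
    (hj : j ≤ n) {W : GL → R} (hW : W ∈ sphericalWhittaker n ψ R) {μ : Fin n → ℤ}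
    (hμ : Antitone μ) :
    act (heckeT n A ϖ j) W (powDiag ϖ μ) = ∑ I ∈ Finset.powersetCard j Finset.univ,
      (Nat.card 𝓀[F] : R) ^ (pairs I).card * W (powDiag ϖ (μ + indZ I)) := by
  refine finsum_heckeT (φ := fun g => W (powDiag ϖ μ * g)) hϖ hj (fun k hk g => ?_)
    (fun I _ y hy => ?_)
  · rw [← mul_assoc, hW.2 k hk]
  · have hu := unipotent_conj ϖ (-μ) (pairsGL_mem_unipotent I y)
    have e : powDiag ϖ μ * (pairsGL I y * powDiag ϖ (indZ I)) =
        (powDiag ϖ (- -μ) * pairsGL I y * powDiag ϖ (-μ)) * powDiag ϖ (μ + indZ I) := by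
      rw [powDiag_add, powDiag_neg, powDiag_neg]
      group
    rw [e, hW.1.2 _ hu, hψ.eq_one, map_one, one_mul]
    refine superdiagSum_mem fun a b hab => ?_
    rw [powDiag_conj_apply]
    refine mul_mem (hϖ.zpow_mem_iff.2 ?_)
      (coe_mem_of_mem_maxCompact (pairsGL_mem_maxCompact I hy) a b)
    have : μ b ≤ μ a := hμ (Fin.le_def.2 (by omega))
    simp only [Pi.neg_apply]
    omega

theorem act_heckeT_last {ϖ : Fˣ} (hϖ : IsUniformizer ϖ) {W : GL → R}
    (hW : ∀ k ∈ maxCompact F n, ∀ g, W (g * k) = W g) (x : GL) :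
    act (heckeT n A ϖ n) W x = W (x * powDiag ϖ fun _ => 1) := by
  have h := finsum_heckeT (A := A) (φ := fun g => W (x * g))
    (w := fun _ => W (x * powDiag ϖ fun _ => 1)) hϖ le_rfl (fun k hk g => by
      rw [← mul_assoc, hW k hk]) (fun I hI y hy => by
      have hI' : I = Finset.univ := Finset.eq_univ_of_card I (by simpa using hI)
      rw [hI', indZ_univ, ← powDiag_const_comm, ← mul_assoc,
        hW _ (pairsGL_mem_maxCompact _ hy)])
  rw [act, h]
  rw [powersetCard_univ_self, Finset.sum_singleton, pairs_univ, Finset.card_empty, pow_zero,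
    one_mul]

/-- A spherical Whittaker function vanishes at the non-dominant `ϖ^μ`. -/
theorem sphericalWhittaker_eq_zero {ϖ : Fˣ} (hϖ : IsUniformizer ϖ) (hψ : HasConductorZero ψ)
    (hunit : ∀ t, ψ t ≠ 1 → IsUnit (ψ t - 1)) {W : GL → R} (hW : W ∈ sphericalWhittaker n ψ R)
    {μ : Fin n → ℤ} (hμ : ¬ Antitone μ) : W (powDiag ϖ μ) = 0 := by
  rw [antitone_iff_adjacent] at hμ
  push Not at hμ
  obtain ⟨i, j, hij, hlt⟩ := hμ
  -- Since the conductor is zero, `ψ` is nontrivial on `ϖ⁻¹ 𝒪[F]`; this yields `t = ϖ⁻¹ x` with `ψ t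
  -- ≠ 1` and a pole of order at most one.
  have hnot : ((ϖ⁻¹ : Fˣ) : F) ∉ 𝒪[F] := by
    rw [← zpow_neg_one, hϖ.zpow_mem_iff]
    decide
  rw [← hψ] at hnot
  push Not at hnot
  obtain ⟨x, hx, ht⟩ := hnot
  set t : F := ((ϖ⁻¹ : Fˣ) : F) * x with htdef
  let y : Fin n → Fin n → F := fun _ b => if b = j then t else 0
  have hpair : (i, j) ∈ pairs ({i} : Finset (Fin n)) := by
    rw [mem_pairs]
    refine ⟨Finset.mem_singleton_self _, fun h => ?_, Fin.lt_def.2 (by simp only; omega)⟩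
    rw [Finset.mem_singleton] at h
    simp only at h
    rw [h] at hij
    omega
  have hentry : ∀ a b, (pairsGL {i} y).1 a b =
      (1 : Matrix (Fin n) (Fin n) F) a b + if a = i ∧ b = j then t else 0 := by
    intro a b
    change (1 + pairsMatrix {i} y) a b = _
    rw [Matrix.add_apply, pairsMatrix_apply]
    congr 1
    by_cases hab : a = i ∧ b = j
    · rw [if_pos hab, hab.1, hab.2, if_pos hpair]
      exact if_pos rfl
    · rw [if_neg hab]
      split_ifs with h
      · have ha : a = i := Finset.mem_singleton.1 (mem_pairs.1 h).1
        exact if_neg fun hb => hab ⟨ha, hb⟩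
      · rfl
  have hu : pairsGL {i} y ∈ unipotent F n := pairsGL_mem_unipotent _ y
  have hsum : superdiagSum (pairsGL {i} y) = t := by
    unfold superdiagSum
    rw [Finset.sum_eq_single i, Finset.sum_eq_single j]
    · rw [if_pos hij, hentry, if_pos ⟨rfl, rfl⟩, Matrix.one_apply_ne, zero_add]
      rintro rfl
      omega
    · intro b _ hb
      refine if_neg fun h => hb (Fin.ext (h.trans hij.symm))
    · simp
    · intro a _ ha
      refine Finset.sum_eq_zero fun b _ => ?_
      split_ifs with h
      · rw [hentry, if_neg fun h => ha h.1, Matrix.one_apply_ne, zero_add]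
        rintro rfl
        omega
      · rfl
    · simp
  -- Conjugation multiplies the entry `t` by `ϖ ^ (μ j - μ i)`. As `μ i < μ j`, at least one factor
  -- `ϖ` is gained and the pole is cancelled.
  have hk : powDiag ϖ (-μ) * pairsGL {i} y * powDiag ϖ μ ∈ maxCompact F n := by
    refine unipotent_mem_maxCompact (unipotent_conj ϖ μ hu) fun a b => ?_
    rw [powDiag_conj_apply, hentry, mul_add]
    refine add_mem ?_ ?_
    · rw [Matrix.one_apply]
      split_ifs with h
      · simp [h]
      · simp
    · split_ifs with h
      · rw [h.1, h.2, htdef, ← mul_assoc, ← Units.val_mul, ← zpow_neg_one, ← zpow_add]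
        exact mul_mem (hϖ.zpow_mem_iff.2 (by omega)) hx
      · simp
  have h1 := hW.2 _ hk (powDiag ϖ μ)
  have e : powDiag ϖ μ * (powDiag ϖ (-μ) * pairsGL {i} y * powDiag ϖ μ) =
      pairsGL {i} y * powDiag ϖ μ := by
    rw [powDiag_neg]
    group
  rw [e, hW.1.2 _ hu, hsum] at h1
  have h2 : algebraMap A R (ψ t - 1) * W (powDiag ϖ μ) = 0 := by
    rw [map_sub, map_one, sub_mul, one_mul, h1, sub_self]
  exact ((hunit t ht).map (algebraMap A R)).mul_right_eq_zero.1 h2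

end HeckeOperators

/-! ### Units in the Witt vectors coming from `p ≠ ℓ`. -/

section WittVector

theorem witt_natCast_isUnit {ℓ : ℕ} [Fact ℓ.Prime] {k : Type*} [Field k] [CharP k ℓ] {m : ℕ}
    (hm : ¬ ℓ ∣ m) : IsUnit (m : WittVector ℓ k) := by
  refine WittVector.isUnit_of_coeff_zero_ne_zero _ ?_
  rw [← WittVector.constantCoeff_apply, map_natCast]
  exact fun h => hm ((CharP.cast_eq_zero_iff k ℓ m).1 h)

/-- For `ζ ≠ 1` the geometric sum of `ζ` is zero, as there are no zero divisors. Were `ζ` to reduce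
to `1`, this sum would reduce to `m`, which is nonzero in `k`. -/
theorem witt_root_sub_one_isUnit {ℓ : ℕ} [Fact ℓ.Prime] {k : Type*} [Field k] [CharP k ℓ] {m : ℕ}
    (hm : ¬ ℓ ∣ m) {ζ : WittVector ℓ k} (hζ : ζ ^ m = 1) (h1 : ζ ≠ 1) : IsUnit (ζ - 1) := by
  refine WittVector.isUnit_of_coeff_zero_ne_zero _ fun h => ?_
  rw [← WittVector.constantCoeff_apply, map_sub, map_one, sub_eq_zero] at h
  have hgeom : ∑ i ∈ Finset.range m, ζ ^ i = 0 := by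
    have := geom_sum_mul ζ m
    rw [hζ, sub_self] at this
    exact (mul_eq_zero.1 this).resolve_right (sub_ne_zero.2 h1)
  have h2 := congrArg (WittVector.constantCoeff (R := k) (p := ℓ)) hgeom
  simp only [map_sum, map_pow, h, one_pow, Finset.sum_const, Finset.card_range, nsmul_eq_mul,
    mul_one, map_zero] at h2
  exact hm ((CharP.cast_eq_zero_iff k ℓ m).1 h2)

variable {F : Type*} [Field F] [ValuativeRel F] [TopologicalSpace F] [IsNonarchimedeanLocalField F]

/-- The residue characteristic lies in the maximal ideal, so its powers clear denominators. The
argument includes equal characteristic, where `(p : F) = 0`. -/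
theorem exists_pow_mul_mem_integer {p : ℕ} [CharP 𝓀[F] p] {ϖ : Fˣ} (hϖ : IsUniformizer ϖ)
    (t : F) : ∃ m : ℕ, (p : F) ^ m * t ∈ 𝒪[F] := by
  rcases eq_or_ne t 0 with rfl | ht
  · exact ⟨0, by simp⟩
  obtain ⟨a, y, hy, e⟩ := hϖ.exists_zpow (Units.mk0 t ht)
  have hp : valuation F (p : F) < 1 := by
    have := (valuation_lt_one_iff_residue (p : 𝒪[F])).2 (by
      rw [map_natCast]
      exact CharP.cast_eq_zero _ p)
    simpa using this
  have h1 := hϖ.exists_eq_mul_of_lt_one hp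
  -- Since `ϖ⁻¹ p` is integral and `|a| + a ≥ 0`, this many factors `p` suffice.
  refine ⟨a.natAbs, ?_⟩
  have e2 : (p : F) ^ a.natAbs * t =
      (((ϖ⁻¹ : Fˣ) : F) * p) ^ a.natAbs * ((ϖ ^ ((a.natAbs : ℤ) + a) : Fˣ) : F) * y := by
    have e3 : t = ((ϖ ^ a : Fˣ) : F) * y := by
      rw [← Units.val_mul, ← e, Units.val_mk0]
    rw [e3, zpow_add, zpow_natCast, mul_pow]
    have : ((ϖ⁻¹ : Fˣ) : F) ^ a.natAbs * ((ϖ ^ a.natAbs : Fˣ) : F) = 1 := by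
      rw [← Units.val_pow_eq_pow_val, ← Units.val_mul, inv_pow, inv_mul_cancel, Units.val_one]
    rw [Units.val_mul]
    linear_combination (-(p : F) ^ a.natAbs * ((ϖ ^ a : Fˣ) : F) * y) * this
  rw [e2]
  refine mul_mem (mul_mem (pow_mem h1 _) (hϖ.zpow_mem_iff.2 (by omega))) ?_
  exact hy.le

/-- Some `p ^ m * t` is integral, so `ψ t` is a root of unity of order dividing `p ^ m`, which is
prime to `ℓ`. -/
theorem addChar_sub_one_isUnit {p ℓ : ℕ} [Fact p.Prime] [Fact ℓ.Prime] (hℓp : ℓ ≠ p)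
    [CharP 𝓀[F] p] {k : Type*} [Field k] [CharP k ℓ] {ϖ : Fˣ} (hϖ : IsUniformizer ϖ)
    {ψ : AddChar F (WittVector ℓ k)} (hψ : HasConductorZero ψ) (t : F) (ht : ψ t ≠ 1) :
    IsUnit (ψ t - 1) := by
  obtain ⟨m, hm⟩ := exists_pow_mul_mem_integer (p := p) hϖ t
  refine witt_root_sub_one_isUnit (m := p ^ m) (fun h => hℓp ?_) ?_ ht
  · exact (Nat.prime_dvd_prime_iff_eq Fact.out Fact.out).1 (Nat.Prime.dvd_of_dvd_pow Fact.out h)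
  · rw [← AddChar.map_nsmul_eq_pow, nsmul_eq_mul, Nat.cast_pow]
    exact hψ.eq_one hm

theorem residueCard_isUnit {p ℓ : ℕ} [Fact p.Prime] [Fact ℓ.Prime] (hℓp : ℓ ≠ p)
    [CharP 𝓀[F] p] {k : Type*} [Field k] [CharP k ℓ] :
    IsUnit (Nat.card 𝓀[F] : WittVector ℓ k) := by
  have : Fintype 𝓀[F] := Fintype.ofFinite _
  obtain ⟨m, _, hm⟩ := FiniteField.card 𝓀[F] p
  rw [Nat.card_eq_fintype_card, hm]
  refine witt_natCast_isUnit fun h => hℓp ?_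
  exact (Nat.prime_dvd_prime_iff_eq Fact.out Fact.out).1 (Nat.Prime.dvd_of_dvd_pow Fact.out h)

end WittVector
-- Generators of the spherical Hecke algebra.
section Generation

open HeckeAlgebra

variable {F : Type*} [Field F] [ValuativeRel F] {n : ℕ}
  [TopologicalSpace F] [IsNonarchimedeanLocalField F]
  {A : Type*} [CommRing A]

local notation "GL" => Matrix.GeneralLinearGroup (Fin n) F

variable (A) in
/-- The indicator function of `K ϖ^μ K`. -/
noncomputable def delta (ϖ : Fˣ) (μ : Fin n → ℤ) : HeckeAlgebra A (maxCompact F n) :=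
  doubleCoset A (maxCompact F n) (powDiag ϖ μ)
    (finite_of_isOpen_isCompact isOpen_maxCompact isCompact_maxCompact _)

theorem delta_zero (ϖ : Fˣ) : delta A ϖ (0 : Fin n → ℤ) = 1 := by
  ext x
  change Set.indicator _ 1 x = Set.indicator _ 1 x
  rw [powDiag_zero]

theorem powDiag_mem_doubleCoset_iff {ϖ : Fˣ} (hϖ : IsUniformizer ϖ) {μ ν : Fin n → ℤ} :
    powDiag ϖ ν ∈ DoubleCoset.doubleCoset (powDiag ϖ μ)
      (maxCompact F n : Set GL) (maxCompact F n) ↔ ∃ σ : Equiv.Perm (Fin n), ν = μ ∘ σ := by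
  constructor
  · intro h
    obtain ⟨a, ha, b, hb, e⟩ := DoubleCoset.mem_doubleCoset.1 h
    exact exists_perm_of_powDiag_eq hϖ ha hb e
  · rintro ⟨σ, rfl⟩
    exact DoubleCoset.mem_doubleCoset.2 ⟨_, permGL_mem σ, _, permGL_mem σ.symm,
      (permGL_conj_powDiag ϖ μ σ).symm⟩

theorem delta_apply_powDiag {ϖ : Fˣ} (hϖ : IsUniformizer ϖ) (μ ν : Fin n → ℤ)
    [Decidable (∃ σ : Equiv.Perm (Fin n), ν = μ ∘ σ)] :
    delta A ϖ μ (powDiag ϖ ν) = if ∃ σ : Equiv.Perm (Fin n), ν = μ ∘ σ then 1 else 0 := by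
  rw [delta, doubleCoset_apply]
  split_ifs with h
  · exact Set.indicator_of_mem ((powDiag_mem_doubleCoset_iff hϖ).2 h) _
  · exact Set.indicator_of_notMem (fun h' => h ((powDiag_mem_doubleCoset_iff hϖ).1 h')) _

theorem eq_of_monotone_perm {μ ν : Fin n → ℤ} (hμ : Monotone μ) (hν : Monotone ν)
    (h : ∃ σ : Equiv.Perm (Fin n), ν = μ ∘ σ) : ν = μ := by
  obtain ⟨σ, rfl⟩ := h
  exact Tuple.unique_monotone (f := μ) (σ := σ) (τ := 1) hν hμ

theorem delta_apply_monotone {ϖ : Fˣ} (hϖ : IsUniformizer ϖ) {μ ν : Fin n → ℤ}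
    (hμ : Monotone μ) (hν : Monotone ν) :
    delta A ϖ μ (powDiag ϖ ν) = if ν = μ then 1 else 0 := by
  classical
  rw [delta_apply_powDiag hϖ]
  congr 1
  exact propext ⟨eq_of_monotone_perm hμ hν, fun h => ⟨1, h⟩⟩

/-- An element of the Hecke algebra is determined by its values at the `ϖ^ν`, `ν` increasing. -/
theorem hecke_ext_monotone {ϖ : Fˣ} (hϖ : IsUniformizer ϖ)
    {z w : HeckeAlgebra A (maxCompact F n)}
    (h : ∀ ν : Fin n → ℤ, Monotone ν → z (powDiag ϖ ν) = w (powDiag ϖ ν)) : z = w := by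
  ext g
  obtain ⟨k₁, hk₁, ν, k₂, hk₂, hν, rfl⟩ := exists_cartan hϖ g
  rw [z.right_inv hk₂, z.left_inv hk₁, w.right_inv hk₂, w.left_inv hk₁, h ν hν]

theorem finite_support_powDiag {ϖ : Fˣ} (hϖ : IsUniformizer ϖ)
    (z : HeckeAlgebra A (maxCompact F n)) : {ν : Fin n → ℤ | z (powDiag ϖ ν) ≠ 0}.Finite := by
  have hinj : Function.Injective
      fun ν : Fin n → ℤ => ((powDiag ϖ ν : GL) : GL ⧸ maxCompact F n) := by
    intro μ ν h
    have hk := QuotientGroup.eq.1 h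
    refine (eq_of_unipotent_mul_powDiag hϖ unipotent_one unipotent_one hk ?_).1
    rw [one_mul, one_mul, mul_inv_cancel_left]
  refine (z.finite_supp.preimage hinj.injOn).subset fun ν hν => ?_
  rw [Set.mem_preimage, Set.mem_ofPred_eq,
    apply_out (φ := z) (fun k hk y => z.right_inv hk y)]
  exact hν

/-- Evaluation at `x`. -/
noncomputable def evalAt (x : GL) : HeckeAlgebra A (maxCompact F n) →ₗ[A] A where
  toFun z := z x
  map_add' _ _ := rfl
  map_smul' _ _ := rfl

/-- By the Cartan decomposition `z` is a finite combination of the indicators of the double cosets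
in its own support, so only those need to lie in `B`. -/
theorem mem_of_delta_mem {ϖ : Fˣ} (hϖ : IsUniformizer ϖ)
    (B : Submodule A (HeckeAlgebra A (maxCompact F n))) (z : HeckeAlgebra A (maxCompact F n))
    (h : ∀ ν : Fin n → ℤ, Monotone ν → z (powDiag ϖ ν) ≠ 0 → delta A ϖ ν ∈ B) : z ∈ B := by
  classical
  set S := (finite_support_powDiag hϖ z).toFinset.filter Monotone with hS
  have hz : z = ∑ ν ∈ S, z (powDiag ϖ ν) • delta A ϖ ν := by
    refine hecke_ext_monotone hϖ fun μ hμ => ?_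
    have e : (∑ ν ∈ S, z (powDiag ϖ ν) • delta A ϖ ν) (powDiag ϖ μ) =
        ∑ ν ∈ S, z (powDiag ϖ ν) * delta A ϖ ν (powDiag ϖ μ) :=
      map_sum (evalAt (A := A) (powDiag ϖ μ : GL)) _ _
    rw [e, Finset.sum_congr rfl (g := fun ν => if μ = ν then z (powDiag ϖ ν) else 0)]
    · rw [Finset.sum_ite_eq]
      split_ifs with hm
      · rfl
      · by_contra hne
        exact hm (Finset.mem_filter.2 ⟨(Set.Finite.mem_toFinset _).2 hne, hμ⟩)
    · intro ν hν
      rw [delta_apply_monotone hϖ (Finset.mem_filter.1 hν).2 hμ, mul_ite, mul_one, mul_zero]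
  rw [hz]
  refine B.sum_mem fun ν hν => B.smul_mem _ ?_
  exact h ν (Finset.mem_filter.1 hν).2 ((Set.Finite.mem_toFinset _).1 (Finset.mem_filter.1 hν).1)

/-- The quantity `∑ (μ i + μ i ^ 2)` measures the size of a weight in the triangularity argument and
stands in for the dominance order. It is invariant under permutations, and raising `μ i` by one
increases it by `2 (μ i + 1)`. -/
theorem sum_add_indZ_sq (μ : Fin n → ℤ) (I : Finset (Fin n)) :
    ∑ i, ((μ + indZ I) i + (μ + indZ I) i ^ 2) =
      ∑ i, (μ i + μ i ^ 2) + 2 * ∑ i ∈ I, (μ i + 1) := by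
  have h : ∑ i ∈ I, 2 * (μ i + 1) = ∑ i, if i ∈ I then 2 * (μ i + 1) else 0 := by simp
  rw [Finset.mul_sum, h, ← Finset.sum_add_distrib]
  refine Finset.sum_congr rfl fun i _ => ?_
  rw [Pi.add_apply, indZ_apply]
  split_ifs <;> ring

/-- Raising a fixed number of entries by one increases the size most when all of them have the
maximal value `M`. In that case `I` is a final segment of the same cardinality as `J`, hence equal
to it. -/
theorem eq_or_sum_sq_lt {μ' ν : Fin n → ℤ} {M : ℤ} {I J : Finset (Fin n)} (hIJ : I.card = J.card)
    (hμ' : Monotone μ') (hle : ∀ i, μ' i ≤ M) (hJ : ∀ i ∈ J, μ' i = M)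
    (hJup : IsUpperSet (J : Set (Fin n))) (hν : Monotone ν) {σ : Equiv.Perm (Fin n)}
    (h : ν - indZ I = μ' ∘ σ) :
    (I = J ∧ ν = μ' + indZ J) ∨ ∑ i, (ν i + ν i ^ 2) <
      ∑ i, ((μ' + indZ J) i + (μ' + indZ J) i ^ 2) := by
  have hν' : ν = μ' ∘ σ + indZ I := by rw [← h, sub_add_cancel]
  by_cases hall : ∀ i ∈ I, μ' (σ i) = M
  · left
    have hval : ∀ i, ν i = μ' (σ i) + indZ I i := fun i => congrFun hν' i
    have hI1 : ∀ i ∈ I, ν i = M + 1 := fun i hi => by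
      rw [hval, hall i hi, indZ_apply, if_pos hi]
    have hI2 : ∀ i ∉ I, ν i ≤ M := fun i hi => by
      rw [hval, indZ_apply, if_neg hi, add_zero]
      exact hle _
    have hIup : IsUpperSet (I : Set (Fin n)) := by
      intro a b hab ha
      by_contra hb
      have h1 := hI1 a ha
      have h2 := hI2 b hb
      have h3 := hν hab
      omega
    have hIJ' : I = J := by
      rcases hIup.total hJup with h1 | h1
      · exact Finset.eq_of_subset_of_card_le (Finset.coe_subset.1 h1) hIJ.ge
      · exact (Finset.eq_of_subset_of_card_le (Finset.coe_subset.1 h1) hIJ.le).symm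
    refine ⟨hIJ', ?_⟩
    subst hIJ'
    have hmono : Monotone (μ' ∘ σ) := by
      rw [← h]
      intro a b hab
      rw [Pi.sub_apply, Pi.sub_apply, indZ_apply, indZ_apply]
      have h3 := hν hab
      by_cases ha : a ∈ I
      · rw [if_pos ha, if_pos (Finset.mem_coe.1 (hIup hab ha))]
        omega
      · by_cases hb : b ∈ I
        · rw [if_neg ha, if_pos hb, hI1 b hb]
          have := hI2 a ha
          omega
        · rw [if_neg ha, if_neg hb]
          omega
    rw [hν', eq_of_monotone_perm hμ' hmono ⟨σ, rfl⟩]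
  · right
    push Not at hall
    obtain ⟨i, hi, hne⟩ := hall
    rw [hν', sum_add_indZ_sq, sum_add_indZ_sq]
    have h1 : ∑ i, ((μ' ∘ σ) i + (μ' ∘ σ) i ^ 2) = ∑ i, (μ' i + μ' i ^ 2) :=
      Equiv.sum_comp σ fun i => μ' i + μ' i ^ 2
    have h2 : ∑ i ∈ J, (μ' i + 1) = ∑ i ∈ I, (M + 1) := by
      rw [Finset.sum_congr rfl fun i hi => by rw [hJ i hi], Finset.sum_const, Finset.sum_const, hIJ]
    have h3 : ∑ i ∈ I, ((μ' ∘ σ) i + 1) < ∑ i ∈ I, (M + 1) :=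
      Finset.sum_lt_sum (fun i _ => add_le_add_left (hle _) 1)
        ⟨i, hi, add_lt_add_left (lt_of_le_of_ne (hle _) hne) 1⟩
    rw [h1, h2]
    omega

/-- With `J` the set where `μ` is maximal and `μ' = μ - 1_J`, the product `T^{(|J|)} * δ_{μ'}`
equals `δ_μ` plus a combination of indicators of non-negative weights of smaller size. The bound `N`
on the size serves for the induction. -/
theorem delta_mem_of_nonneg {ϖ : Fˣ} (hϖ : IsUniformizer ϖ)
    (B : Subalgebra A (HeckeAlgebra A (maxCompact F n)))
    (hT : ∀ j, 1 ≤ j → j ≤ n → heckeT n A ϖ j ∈ B) (N : ℕ) (μ : Fin n → ℤ) (hμ : Monotone μ)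
    (h0 : ∀ i, 0 ≤ μ i) (hN : ∑ i, (μ i + μ i ^ 2) < N) : delta A ϖ μ ∈ B := by
  classical
  induction N generalizing μ with
  | zero =>
    refine absurd hN (not_lt.2 (Finset.sum_nonneg fun i _ => ?_))
    have := h0 i
    positivity
  | succ N ih =>
    rcases eq_or_ne μ 0 with rfl | hne
    · rw [delta_zero]
      exact one_mem B
    obtain ⟨i₁, hi₁⟩ := Function.ne_iff.1 hne
    obtain ⟨i₀, -, hmax⟩ := Finset.exists_max_image Finset.univ μ ⟨i₁, Finset.mem_univ _⟩
    have hM : 1 ≤ μ i₀ := by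
      have h1 := hmax i₁ (Finset.mem_univ _)
      have h2 := h0 i₁
      rw [Pi.zero_apply] at hi₁
      omega
    have hmax' : ∀ i, μ i ≤ μ i₀ := fun i => hmax i (Finset.mem_univ i)
    set J := Finset.univ.filter fun i => μ i = μ i₀ with hJ
    have hmemJ : ∀ i, i ∈ J ↔ μ i = μ i₀ := fun i => by simp [hJ]
    have hJup : IsUpperSet (J : Set (Fin n)) := by
      intro a b hab ha
      have h1 := (hmemJ a).1 ha
      exact (hmemJ b).2 (le_antisymm (hmax' b) (h1 ▸ hμ hab))
    set μ' : Fin n → ℤ := μ - indZ J with hμ'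
    have hμμ' : μ' + indZ J = μ := sub_add_cancel _ _
    have hval : ∀ i, μ' i = if μ i = μ i₀ then μ i - 1 else μ i := by
      intro i
      rw [hμ', Pi.sub_apply, indZ_apply]
      simp only [hmemJ]
      split_ifs <;> simp
    have hmono : Monotone μ' := by
      intro a b hab
      have h1 := hμ hab
      have h2 := hmax' a
      have h3 := hmax' b
      rw [hval, hval]
      split_ifs <;> omega
    have hnn : ∀ i, 0 ≤ μ' i := by
      intro i
      have h2 := h0 i
      rw [hval]
      split_ifs <;> omega
    have hle : ∀ i, μ' i ≤ μ i₀ - 1 := by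
      intro i
      have h2 := hmax' i
      rw [hval]
      split_ifs <;> omega
    have hJval : ∀ i ∈ J, μ' i = μ i₀ - 1 := by
      intro i hi
      rw [hval, if_pos ((hmemJ i).1 hi), (hmemJ i).1 hi]
    have hi₀J : i₀ ∈ J := (hmemJ i₀).2 rfl
    have hJ1 : 1 ≤ J.card := Finset.card_pos.2 ⟨i₀, hi₀J⟩
    have hJn : J.card ≤ n := by simpa using J.card_le_univ
    have hlt : ∑ i, (μ' i + μ' i ^ 2) < ∑ i, (μ i + μ i ^ 2) := by
      conv_rhs => rw [← hμμ', sum_add_indZ_sq]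
      have : 0 < ∑ i ∈ J, (μ' i + 1) :=
        Finset.sum_pos (fun i _ => by have := hnn i; omega) ⟨i₀, hi₀J⟩
      omega
    have hδ' : delta A ϖ μ' ∈ B := ih μ' hmono hnn (by push_cast at hN; omega)
    have hprod := B.mul_mem (hT J.card hJ1 hJn) hδ'
    have hz : heckeT n A ϖ J.card * delta A ϖ μ' - delta A ϖ μ ∈ B := by
      refine mem_of_delta_mem hϖ (Subalgebra.toSubmodule B) _ fun ν hν hne => ?_
      have hsub : (heckeT n A ϖ J.card * delta A ϖ μ' - delta A ϖ μ) (powDiag ϖ ν) =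
          (heckeT n A ϖ J.card * delta A ϖ μ') (powDiag ϖ ν) - delta A ϖ μ (powDiag ϖ ν) :=
        map_sub (evalAt (A := A) (powDiag ϖ ν : GL)) _ _
      rw [hsub, heckeT_mul_powDiag hϖ hJn _ hν, delta_apply_monotone hϖ hμ hν] at hne
      have hterm : ∀ I ∈ Finset.powersetCard J.card (Finset.univ : Finset (Fin n)),
          delta A ϖ μ' (powDiag ϖ (ν - indZ I)) ≠ 0 → (∀ i, 0 ≤ ν i) ∧
          ((I = J ∧ ν = μ) ∨ ∑ i, (ν i + ν i ^ 2) < ∑ i, (μ i + μ i ^ 2)) := by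
        intro I hI h
        rw [delta_apply_powDiag hϖ] at h
        obtain ⟨σ, hσ⟩ : ∃ σ : Equiv.Perm (Fin n), ν - indZ I = μ' ∘ σ := by
          by_contra hno
          exact h (if_neg hno)
        refine ⟨fun i => ?_, ?_⟩
        · have h1 := congrFun hσ i
          have h2 := hnn (σ i)
          rw [Pi.sub_apply, Function.comp, indZ_apply] at h1
          split_ifs at h1 <;> omega
        · have := eq_or_sum_sq_lt (Finset.mem_powersetCard.1 hI).2 hmono hle hJval hJup hν hσ
          rwa [hμμ'] at this
      by_cases hνμ : ν = μ
      · subst hνμ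
        refine absurd ?_ hne
        rw [Finset.sum_eq_single J, if_pos rfl, delta_apply_monotone hϖ hmono hmono, if_pos rfl,
          mul_one, sub_eq_zero]
        -- As `J` is a final segment, no index outside `J` lies to the right of one in `J`, so the
        -- leading coefficient is `q ^ 0 = 1` and no division is needed.
        · have hp : pairs J = ∅ := by
            rw [Finset.eq_empty_iff_forall_notMem]
            intro p hp
            obtain ⟨h1, h2, h3⟩ := mem_pairs.1 hp
            exact h2 (hJup h3.le h1)
          rw [hp, Finset.card_empty, pow_zero]
        · intro I hI hIJ
          by_contra h
          rcases (hterm I hI (right_ne_zero_of_mul h)).2 with h1 | h1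
          · exact hIJ h1.1
          · exact lt_irrefl _ h1
        · exact fun h => absurd (Finset.mem_powersetCard.2 ⟨Finset.subset_univ _, rfl⟩) h
      · rw [if_neg hνμ, sub_zero] at hne
        obtain ⟨I, hI, hIne⟩ := Finset.exists_ne_zero_of_sum_ne_zero hne
        obtain ⟨h1, h2⟩ := hterm I hI (right_ne_zero_of_mul hIne)
        have h3 := h2.resolve_left fun h => hνμ h.2
        exact ih ν hν h1 (by push_cast at hN; omega)
    have := B.sub_mem hprod hz
    rwa [sub_sub_cancel] at this

theorem heckeT_last_mul_delta {ϖ : Fˣ} (hϖ : IsUniformizer ϖ) (μ : Fin n → ℤ) :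
    heckeT n A ϖ n * delta A ϖ μ = delta A ϖ (μ + fun _ => 1) := by
  classical
  refine hecke_ext_monotone hϖ fun ν hν => ?_
  rw [heckeT_mul_powDiag hϖ le_rfl _ hν, powersetCard_univ_self, Finset.sum_singleton, pairs_univ,
    Finset.card_empty, pow_zero, one_mul, indZ_univ, delta_apply_powDiag hϖ, delta_apply_powDiag hϖ]
  congr 1
  refine propext (exists_congr fun σ => ?_)
  rw [sub_eq_iff_eq_add]
  rfl

theorem heckeT_last_mul_inv {ϖ : Fˣ} (hϖ : IsUniformizer ϖ) :
    heckeT n A ϖ n * delta A ϖ (fun _ => -1) = 1 := by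
  rw [heckeT_last_mul_delta hϖ, ← delta_zero ϖ]
  congr 1

/-- The Hecke algebra is generated by the `T^{(j)}` and the inverse of `T^{(n)}`. -/
theorem subalgebra_eq_top {ϖ : Fˣ} (hϖ : IsUniformizer ϖ)
    (B : Subalgebra A (HeckeAlgebra A (maxCompact F n)))
    (hT : ∀ j, 1 ≤ j → j ≤ n → heckeT n A ϖ j ∈ B)
    (hdiv : ∀ z, heckeT n A ϖ n * z ∈ B → z ∈ B) (z : HeckeAlgebra A (maxCompact F n)) :
    z ∈ B := by
  -- Since `T^{(n)} * δ_μ = δ_{μ + 1}`, the cancellation property `hdiv` permits lowering all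
  -- entries together, which reduces the claim to non-negative weights.
  have hshift : ∀ (m : ℕ) (μ : Fin n → ℤ), delta A ϖ (μ + fun _ => (m : ℤ)) ∈ B →
      delta A ϖ μ ∈ B := by
    intro m
    induction m with
    | zero =>
      intro μ h
      convert h using 2
      ext i
      simp
    | succ m ih =>
      intro μ h
      refine ih μ (hdiv _ ?_)
      rw [heckeT_last_mul_delta hϖ]
      convert h using 2
      ext i
      simp [add_assoc]
  refine mem_of_delta_mem hϖ (Subalgebra.toSubmodule B) z fun ν hν _ => ?_
  set N := ∑ i, (ν i).natAbs with hN
  set μ : Fin n → ℤ := ν + fun _ => (N : ℤ) with hμ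
  refine hshift N ν (delta_mem_of_nonneg hϖ B hT ((∑ i, (μ i + μ i ^ 2)).toNat + 1) μ
    (fun a b hab => by simpa [hμ] using hν hab) (fun i => ?_) ?_)
  · have := Finset.single_le_sum (f := fun i => (ν i).natAbs) (fun i _ => Nat.zero_le _)
      (Finset.mem_univ i)
    simp only [hμ, Pi.add_apply]
    omega
  · push_cast
    exact Int.lt_add_one_of_le (Int.self_le_toNat _)

end Generation
-- The powers of `q`.
section Exponents

variable {n : ℕ}

/-- Both sides count the pairs `a < b` with `a ∈ I`: those with `b ∉ I` are `pairs I`, and those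
with `b ∈ I` number half of `I.offDiag`. -/
theorem card_pairs_add (I : Finset (Fin n)) :
    (pairs I).card + I.card * (I.card - 1) / 2 = ∑ a ∈ I, (n - 1 - (a : ℕ)) := by
  set T := (I ×ˢ I).filter fun p => p.1 < p.2 with hT
  set T' := (I ×ˢ I).filter fun p => p.2 < p.1 with hT'
  have hTT' : T.card = T'.card := by
    refine Finset.card_bij (fun p _ => p.swap) ?_ (fun p _ q _ h => Prod.swap_injective h) ?_
    · intro p hp
      simp only [hT, hT', Finset.mem_filter, Finset.mem_product, Prod.fst_swap,
        Prod.snd_swap] at hp ⊢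
      exact ⟨hp.1.symm, hp.2⟩
    · intro p hp
      refine ⟨p.swap, ?_, Prod.swap_swap p⟩
      simp only [hT, hT', Finset.mem_filter, Finset.mem_product, Prod.fst_swap,
        Prod.snd_swap] at hp ⊢
      exact ⟨hp.1.symm, hp.2⟩
  have hoff : I.offDiag = T ∪ T' := by
    ext p
    simp only [hT, hT', Finset.mem_offDiag, Finset.mem_union, Finset.mem_filter,
      Finset.mem_product, ← and_or_left, and_assoc, lt_or_lt_iff_ne]
  have hdisj : Disjoint T T' := by
    refine Finset.disjoint_filter.2 fun p _ h => lt_asymm h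
  have hcard : 2 * T.card = I.card * (I.card - 1) := by
    have h := Finset.offDiag_card (s := I)
    rw [hoff, Finset.card_union_of_disjoint hdisj, ← hTT'] at h
    rw [two_mul, h, Nat.mul_sub, mul_one]
  have hsum : (pairs I).card + T.card = ∑ a ∈ I, (Finset.Ioi a).card := by
    rw [← Finset.card_sigma, ← Finset.card_union_of_disjoint]
    · refine Finset.card_bij (fun p _ => ⟨p.1, p.2⟩) ?_ ?_ ?_
      · intro p hp
        simp only [hT, Finset.mem_union, mem_pairs, Finset.mem_filter, Finset.mem_product] at hp
        simp only [Finset.mem_sigma, Finset.mem_Ioi]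
        tauto
      · rintro ⟨a, b⟩ _ ⟨c, d⟩ _ h
        simpa using h
      · rintro ⟨a, b⟩ h
        refine ⟨(a, b), ?_, rfl⟩
        simp only [Finset.mem_sigma, Finset.mem_Ioi] at h
        simp only [hT, Finset.mem_union, mem_pairs, Finset.mem_filter, Finset.mem_product]
        tauto
    · refine Finset.disjoint_left.2 fun p hp hp' => (mem_pairs.1 hp).2.1 ?_
      simp only [hT, Finset.mem_filter, Finset.mem_product] at hp'
      exact hp'.1.2
  rw [← hcard, Nat.mul_div_cancel_left _ (by norm_num), hsum]
  simp [Fin.card_Ioi]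

/-- The exponent `∑ (n - i) μ_i`. -/
def heightZ (μ : Fin n → ℤ) : ℤ := ∑ i : Fin n, ((n : ℤ) - ((i : ℤ) + 1)) * μ i

theorem heightZ_add (μ ν : Fin n → ℤ) : heightZ (μ + ν) = heightZ μ + heightZ ν := by
  simp [heightZ, mul_add, Finset.sum_add_distrib]

/-- The reason for the normalisation: the weight `q ^ heightZ` absorbs the multiplicity `q ^ |pairs
I|` of `I` in `T^{(j)}` up to `q ^ (j (j - 1) / 2)`, which does not depend on `I`. -/
theorem heightZ_indZ (I : Finset (Fin n)) :
    heightZ (indZ I) = (pairs I).card + (I.card * (I.card - 1) / 2 : ℕ) := by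
  rw [← Nat.cast_add, card_pairs_add, heightZ, Nat.cast_sum]
  simp only [indZ_apply, mul_ite, mul_one, mul_zero, Finset.sum_ite_mem, Finset.univ_inter]
  refine Finset.sum_congr rfl fun i _ => ?_
  have := i.2
  omega

end Exponents

/-! ### Specialised Schur polynomials for all dominant weights. -/

section Specialisation
open MvPolynomial

variable {n : ℕ} {R : Type*} [CommRing R]

/-- `(μ + N)` as a function to `ℕ`. -/
def shiftNat (μ : Fin n → ℤ) (N : ℕ) : Fin n → ℕ := fun i => (μ i + N).toNat

theorem shiftNat_antitone {μ : Fin n → ℤ} (hμ : Antitone μ) (N : ℕ) : Antitone (shiftNat μ N) :=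
  fun a b hab => by
    have := hμ hab
    simp only [shiftNat]
    omega

/-- A shift that makes `μ` non-negative. -/
def shiftOf (μ : Fin n → ℤ) : ℕ := ∑ i, (μ i).natAbs

theorem shiftOf_nonneg (μ : Fin n → ℤ) (i : Fin n) : 0 ≤ μ i + shiftOf μ := by
  have := Finset.single_le_sum (f := fun i => (μ i).natAbs) (fun i _ => Nat.zero_le _)
    (Finset.mem_univ i)
  unfold shiftOf
  omega

/-- The Schur polynomials, specialised at `c` and extended to all dominant weights, where `e` is
the value of the last elementary symmetric polynomial. -/
noncomputable def schurValue (c : Fin n → R) (e : Rˣ) (μ : Fin n → ℤ) : R :=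
  open Classical in
  if Antitone μ then ((e⁻¹ ^ shiftOf μ : Rˣ) : R) * aeval c (schurPoly (shiftNat μ (shiftOf μ)))
  else 0

/-- Pieri's rule for the last elementary symmetric polynomial, whose only subset is the full one.
For `n = 0` there is no such variable, hence the extra condition `e = 1`. -/
theorem aeval_schurPoly_add_one {c : Fin n → R} {e : Rˣ}
    (he : ∀ i : Fin n, (i : ℕ) + 1 = n → c i = e) (he0 : n = 0 → e = 1) (ν : Fin n → ℕ) :
    aeval c (schurPoly (fun i => ν i + 1)) = e * aeval c (schurPoly ν) := by
  rcases Nat.eq_zero_or_pos n with hn | hn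
  · rw [he0 hn, Units.val_one, one_mul]
    have : (fun i => ν i + 1) = ν := by
      ext i
      exact absurd i.2 (by omega)
    rw [this]
  · have hi : ((⟨n - 1, by omega⟩ : Fin n) : ℕ) + 1 = n := by simp only; omega
    have h := congrArg (aeval c) (X_mul_schurPoly ν ⟨n - 1, by omega⟩)
    rw [map_mul, aeval_X, he _ hi, hi] at h
    rw [powersetCard_univ_self, Finset.sum_singleton] at h
    rw [h]
    congr 2
    ext i
    simp [ind]

/-- Makes the extension to negative entries independent of the shift, as long as the shift makes `μ`
non-negative. -/
theorem aeval_schurPoly_shift {c : Fin n → R} {e : Rˣ}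
    (he : ∀ i : Fin n, (i : ℕ) + 1 = n → c i = e) (he0 : n = 0 → e = 1) {μ : Fin n → ℤ}
    {N : ℕ} (hN : ∀ i, 0 ≤ μ i + N) (k : ℕ) :
    ((e⁻¹ ^ (N + k) : Rˣ) : R) * aeval c (schurPoly (shiftNat μ (N + k))) =
      ((e⁻¹ ^ N : Rˣ) : R) * aeval c (schurPoly (shiftNat μ N)) := by
  induction k with
  | zero => rfl
  | succ k ih =>
    rw [← ih]
    have h1 : shiftNat μ (N + (k + 1)) = fun i => shiftNat μ (N + k) i + 1 := by
      ext i
      have := hN i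
      simp only [shiftNat]
      omega
    rw [h1, aeval_schurPoly_add_one he he0, ← mul_assoc,
      ← Units.val_mul, ← add_assoc, pow_succ, inv_mul_cancel_right]

theorem schurValue_eq {c : Fin n → R} {e : Rˣ}
    (he : ∀ i : Fin n, (i : ℕ) + 1 = n → c i = e) (he0 : n = 0 → e = 1) {μ : Fin n → ℤ}
    (hμ : Antitone μ) {N : ℕ} (hN : ∀ i, 0 ≤ μ i + N) :
    schurValue c e μ = ((e⁻¹ ^ N : Rˣ) : R) * aeval c (schurPoly (shiftNat μ N)) := by
  rw [schurValue, if_pos hμ]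
  rw [← aeval_schurPoly_shift he he0 (shiftOf_nonneg μ) N,
    ← aeval_schurPoly_shift he he0 hN (shiftOf μ), add_comm]

theorem schurValue_eq_zero (c : Fin n → R) (e : Rˣ) {μ : Fin n → ℤ} (hμ : ¬ Antitone μ) :
    schurValue c e μ = 0 := if_neg hμ

theorem schurValue_zero (c : Fin n → R) (e : Rˣ) : schurValue c e 0 = 1 := by
  have h : shiftNat (0 : Fin n → ℤ) (shiftOf (0 : Fin n → ℤ)) = 0 := by
    ext i
    simp [shiftNat, shiftOf]
  rw [schurValue, if_pos (show Antitone (0 : Fin n → ℤ) from antitone_const), h, schurPoly_zero, map_one, mul_one]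
  simp [shiftOf]

/-- One shift makes `μ` and every `μ + indZ I` non-negative, so the rule for partitions applies; the
terms that are not decreasing are zero by definition of `schurValue`. -/
theorem pieri_schurValue {c : Fin n → R} {e : Rˣ}
    (he : ∀ i : Fin n, (i : ℕ) + 1 = n → c i = e) (he0 : n = 0 → e = 1) {μ : Fin n → ℤ}
    (hμ : Antitone μ) (i : Fin n) :
    c i * schurValue c e μ = ∑ I ∈ Finset.powersetCard (i + 1) Finset.univ,
      schurValue c e (μ + indZ I) := by
  set N := shiftOf μ
  have hN := shiftOf_nonneg μ
  have h := congrArg (aeval c) (pieri_antitone (shiftNat_antitone hμ N) i)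
  rw [map_mul, aeval_X, map_sum, Finset.sum_filter] at h
  rw [schurValue_eq he he0 hμ hN, mul_left_comm, h, Finset.mul_sum]
  refine Finset.sum_congr rfl fun I _ => ?_
  have hadd : shiftNat (μ + indZ I) N = shiftNat μ N + ind I := by
    ext a
    have := hN a
    simp only [shiftNat, Pi.add_apply, indZ]
    omega
  have hiff : Antitone (shiftNat μ N + ind I) ↔ Antitone (μ + indZ I) := by
    have hval : ∀ a, ((shiftNat μ N + ind I) a : ℤ) = (μ + indZ I) a + N := by
      intro a
      have := hN a
      simp only [shiftNat, Pi.add_apply, indZ]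
      omega
    constructor <;> intro h a b hab
    · have h1 := h hab
      have h2 := hval a
      have h3 := hval b
      omega
    · have h1 := h hab
      have h2 := hval a
      have h3 := hval b
      omega
  by_cases ha : Antitone (μ + indZ I)
  · rw [if_pos (hiff.2 ha), schurValue_eq he he0 ha (N := N), hadd]
    intro a
    have h1 := hN a
    rw [Pi.add_apply, indZ]
    omega
  · rw [if_neg (fun h => ha (hiff.1 h)), mul_zero, schurValue_eq_zero c e ha]

end Specialisation

/-! ### Spherical Whittaker functions and their values on the torus. -/

section Whittaker

open HeckeAlgebra

variable {F : Type*} [Field F] [ValuativeRel F] {n : ℕ}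
  [TopologicalSpace F] [IsNonarchimedeanLocalField F]
  {A : Type*} [CommRing A] {R : Type*} [CommRing R] [Algebra A R] {ψ : AddChar F A}

local notation "GL" => Matrix.GeneralLinearGroup (Fin n) F

theorem sphericalWhittaker_ext {ϖ : Fˣ} (hϖ : IsUniformizer ϖ) {V W : GL → R}
    (hV : V ∈ sphericalWhittaker n ψ R) (hW : W ∈ sphericalWhittaker n ψ R)
    (h : ∀ μ : Fin n → ℤ, V (powDiag ϖ μ) = W (powDiag ϖ μ)) : V = W := by
  ext g
  obtain ⟨u, hu, μ, k, hk, rfl⟩ := exists_iwasawa hϖ g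
  rw [hV.2 k hk, hW.2 k hk, hV.1.2 u hu, hW.1.2 u hu, h]

/-- The function with the value `ψ(u) w(μ)` at `u ϖ^μ k`. -/
noncomputable def whittakerExtend {ϖ : Fˣ} (hϖ : IsUniformizer ϖ) (ψ : AddChar F A)
    (w : (Fin n → ℤ) → R) (g : GL) : R :=
  algebraMap A R (ψ (superdiagSum (exists_iwasawa hϖ g).choose)) *
    w (exists_iwasawa hϖ g).choose_spec.2.choose

/-- Independence of the chosen Iwasawa decomposition. The exponent is unique, and two choices of `u`
differ by `v` with `ϖ^{-μ} v ϖ^μ ∈ K`. For decreasing `μ` the superdiagonal of `v` is then integral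
and `ψ` does not see it; for the other `μ` the value is zero. -/
theorem whittakerExtend_apply {ϖ : Fˣ} (hϖ : IsUniformizer ϖ) (hψ : HasConductorZero ψ)
    {w : (Fin n → ℤ) → R} (hw : ∀ μ, ¬ Antitone μ → w μ = 0) {u : GL} (hu : u ∈ unipotent F n)
    (μ : Fin n → ℤ) {k : GL} (hk : k ∈ maxCompact F n) :
    whittakerExtend hϖ ψ w (u * powDiag ϖ μ * k) =
      algebraMap A R (ψ (superdiagSum u)) * w μ := by
  set g : GL := u * powDiag ϖ μ * k with hg
  set u' := (exists_iwasawa hϖ g).choose with hu'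
  have hspec := (exists_iwasawa hϖ g).choose_spec
  set μ' := hspec.2.choose with hμ'
  obtain ⟨k', hk', e⟩ := hspec.2.choose_spec
  change algebraMap A R (ψ (superdiagSum u')) * w μ' = _
  have hku : u * powDiag ϖ μ * (k * k'⁻¹) = u' * powDiag ϖ μ' := by
    rw [← mul_assoc, ← hg, e, mul_inv_cancel_right]
  obtain ⟨h1, h2⟩ := eq_of_unipotent_mul_powDiag hϖ hu hspec.1 (mul_mem hk (inv_mem hk')) hku
  rw [← h1]
  by_cases hμ : Antitone μ
  · have h3 : superdiagSum u' = superdiagSum u + superdiagSum (u⁻¹ * u') := by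
      rw [← superdiagSum_mul hu (unipotent_mul (unipotent_inv hu) hspec.1), mul_inv_cancel_left]
    rw [h3, AddChar.map_add_eq_mul, hψ.eq_one (x := superdiagSum (u⁻¹ * u')) (superdiagSum_mem _), mul_one]
    intro i j hij
    have h4 := coe_mem_of_mem_maxCompact h2 i j
    rw [powDiag_conj_apply] at h4
    have h5 : (u⁻¹ * u').1 i j = ((ϖ ^ (μ i - μ j) : Fˣ) : F) *
        (((ϖ ^ (μ j - μ i) : Fˣ) : F) * (u⁻¹ * u').1 i j) := by
      rw [← mul_assoc, ← Units.val_mul, ← zpow_add]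
      simp
    rw [h5]
    have : μ j ≤ μ i := hμ (Fin.le_def.2 (by omega))
    exact mul_mem (hϖ.zpow_mem_iff.2 (by omega)) h4
  · rw [hw μ hμ, mul_zero, mul_zero]

theorem whittakerExtend_mem {ϖ : Fˣ} (hϖ : IsUniformizer ϖ) (hψ : HasConductorZero ψ)
    {w : (Fin n → ℤ) → R} (hw : ∀ μ, ¬ Antitone μ → w μ = 0) :
    whittakerExtend hϖ ψ w ∈ sphericalWhittaker n ψ R := by
  have hinv : ∀ k ∈ maxCompact F n, ∀ g,
      whittakerExtend hϖ ψ w (g * k) = whittakerExtend hϖ ψ w g := by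
    intro k hk g
    obtain ⟨u, hu, μ, k', hk', rfl⟩ := exists_iwasawa hϖ g
    rw [mul_assoc, whittakerExtend_apply hϖ hψ hw hu μ (mul_mem hk' hk),
      whittakerExtend_apply hϖ hψ hw hu μ hk']
  refine ⟨⟨isLocallyConstant_of_right_inv hinv, fun v hv g => ?_⟩, hinv⟩
  obtain ⟨u, hu, μ, k, hk, rfl⟩ := exists_iwasawa hϖ g
  rw [← mul_assoc, ← mul_assoc, whittakerExtend_apply hϖ hψ hw (unipotent_mul hv hu) μ hk,
    whittakerExtend_apply hϖ hψ hw hu μ hk, superdiagSum_mul hv hu, AddChar.map_add_eq_mul,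
    map_mul, mul_assoc]

theorem whittakerExtend_powDiag {ϖ : Fˣ} (hϖ : IsUniformizer ϖ) (hψ : HasConductorZero ψ)
    {w : (Fin n → ℤ) → R} (hw : ∀ μ, ¬ Antitone μ → w μ = 0) (μ : Fin n → ℤ) :
    whittakerExtend hϖ ψ w (powDiag ϖ μ) = w μ := by
  have h := whittakerExtend_apply hϖ hψ hw unipotent_one μ (one_mem (maxCompact F n))
  rw [one_mul, mul_one] at h
  have h0 : superdiagSum (1 : GL) ∈ 𝒪[F] :=
    superdiagSum_mem fun i j _ => one_apply_mem_integer i j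
  rw [h, hψ.eq_one h0, map_one, one_mul]

variable (χ : HeckeAlgebra A (maxCompact F n) →ₐ[A] R)

/-- A spherical Whittaker function that is an eigenfunction of the `T^{(j)}` is an eigenfunction
of the whole Hecke algebra. -/
theorem mem_eigenWhittaker {ϖ : Fˣ} (hϖ : IsUniformizer ϖ) {W : GL → R}
    (hW : W ∈ sphericalWhittaker n ψ R)
    (hT : ∀ j, 1 ≤ j → j ≤ n → act (heckeT n A ϖ j) W = χ (heckeT n A ϖ j) • W)
    (hTn : act (heckeT n A ϖ n) W = χ (heckeT n A ϖ n) • W) : W ∈ eigenWhittaker ψ χ := by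
  -- The `z` that act on `W` through `χ` form a subalgebra; closure under products only needs the
  -- eigenvalues to commute.
  let B : Subalgebra A (HeckeAlgebra A (maxCompact F n)) :=
    { carrier := {z | act z W = χ z • W}
      mul_mem' := fun {f g} hf hg => by
        rw [Set.mem_ofPred_eq] at hf hg ⊢
        rw [act_mul f g hW.2, hg, act_smul, hf, map_mul, smul_smul, mul_comm]
      add_mem' := fun {f g} hf hg => by
        rw [Set.mem_ofPred_eq] at hf hg ⊢
        rw [act_add_left, hf, hg, map_add, add_smul]
      algebraMap_mem' := fun a => by
        rw [Set.mem_ofPred_eq, Algebra.algebraMap_eq_smul_one, act_smul_left, act_one hW.2,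
          map_smul, map_one, smul_assoc, one_smul] }
  refine ⟨hW, fun z => subalgebra_eq_top hϖ B hT (fun z hz => ?_) z⟩
  have hz' : act (heckeT n A ϖ n * z) W = χ (heckeT n A ϖ n * z) • W := hz
  rw [act_mul _ _ hW.2, map_mul] at hz'
  change act z W = χ z • W
  ext x
  -- `T^{(n)}` acts as translation by `ϖ`, so it is undone by evaluating at `x ϖ⁻¹`.
  have h1 := congrFun hz' (x * powDiag ϖ fun _ => -1)
  have h2 := congrFun hTn (x * powDiag ϖ fun _ => -1)
  have e : (x * powDiag ϖ fun _ => (-1 : ℤ)) * (powDiag ϖ fun _ => (1 : ℤ)) = x := by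
    have : ((fun _ => (-1 : ℤ)) + fun _ => (1 : ℤ) : Fin n → ℤ) = 0 := by
      ext i
      simp
    rw [mul_assoc, ← powDiag_add, this, powDiag_zero, mul_one]
  rw [act_heckeT_last hϖ (act_right_inv z hW.2), e, Pi.smul_apply, smul_eq_mul] at h1
  rw [act_heckeT_last hϖ hW.2, e, Pi.smul_apply, smul_eq_mul] at h2
  rw [h1, Pi.smul_apply, smul_eq_mul, h2]
  ring

/-- The Hecke eigenvalues give Pieri's rule for the values of a Whittaker function. -/
theorem pieri_whittaker {ϖ : Fˣ} (hϖ : IsUniformizer ϖ) (hψ : HasConductorZero ψ)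
    {W : GL → R} (hW : W ∈ sphericalWhittaker n ψ R) {q : Rˣ} (hq : (q : R) = Nat.card 𝓀[F])
    {j : ℕ} (hj : j ≤ n) {μ : Fin n → ℤ} (hμ : Antitone μ) :
    (q : R) ^ (j * (j - 1) / 2) * (((q ^ heightZ μ : Rˣ) : R) *
      act (heckeT n A ϖ j) W (powDiag ϖ μ)) = ∑ I ∈ Finset.powersetCard j Finset.univ,
        ((q ^ heightZ (μ + indZ I) : Rˣ) : R) * W (powDiag ϖ (μ + indZ I)) := by
  rw [act_heckeT_powDiag hϖ hψ hj hW hμ, Finset.mul_sum, Finset.mul_sum]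
  refine Finset.sum_congr rfl fun I hI => ?_
  -- The exponent of the weight at `μ + 1_I` splits into that at `μ`, the multiplicity of `I`, and
  -- the constant on the left.
  rw [heightZ_add, heightZ_indZ, (Finset.mem_powersetCard.1 hI).2, zpow_add, zpow_add,
    zpow_natCast, zpow_natCast, ← hq]
  push_cast
  ring

end Whittaker
-- The Schur formula and the existence of an eigenfunction.
section EigenWhittaker

open HeckeAlgebra

variable {F : Type*} [Field F] [ValuativeRel F] {n : ℕ}
  [TopologicalSpace F] [IsNonarchimedeanLocalField F]
  {A : Type*} [CommRing A] {R : Type*} [CommRing R] [Algebra A R] {ψ : AddChar F A}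
  (χ : HeckeAlgebra A (maxCompact F n) →ₐ[A] R)

local notation "GL" => Matrix.GeneralLinearGroup (Fin n) F

/-- For `n = 0` the range `1 ≤ j ≤ n` is empty, so the eigenvalue of `T^{(n)}` has to be obtained
from this identity. -/
theorem heckeT_zero_of_eq_zero (hn : n = 0) (ϖ : Fˣ) (j : ℕ) : heckeT n A ϖ j = 1 := by
  rw [← delta_zero ϖ]
  have h : (fun i : Fin n => if (i : ℕ) < j then (1 : ℤ) else 0) = 0 := by
    ext i
    exact absurd i.2 (by omega)
  change delta A ϖ _ = _
  rw [h]

theorem whittaker_shift {ϖ : Fˣ} (hϖ : IsUniformizer ϖ) {W : GL → R}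
    (hW : W ∈ sphericalWhittaker n ψ R)
    (hT : 1 ≤ n → act (heckeT n A ϖ n) W = χ (heckeT n A ϖ n) • W) {u : Rˣ}
    (hu : (u : R) = χ (heckeT n A ϖ n)) (μ : Fin n → ℤ) (m : ℤ) :
    W (powDiag ϖ fun i => μ i + m) = ((u ^ m : Rˣ) : R) * W (powDiag ϖ μ) := by
  have hone : ∀ μ : Fin n → ℤ, W (powDiag ϖ fun i => μ i + 1) = u * W (powDiag ϖ μ) := by
    intro μ
    have hTn : act (heckeT n A ϖ n) W = χ (heckeT n A ϖ n) • W := by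
      rcases Nat.eq_zero_or_pos n with hn | hn
      · rw [heckeT_zero_of_eq_zero hn, act_one hW.2, map_one, one_smul]
      · exact hT hn
    have h := congrFun hTn (powDiag ϖ μ)
    rw [act_heckeT_last hϖ hW.2, ← powDiag_add, Pi.smul_apply, smul_eq_mul, ← hu] at h
    exact h
  induction m with
  | zero => simp
  | succ m ih =>
    have h := hone fun i => μ i + m
    simp only [add_assoc] at h
    rw [h, ih, ← mul_assoc, ← Units.val_mul, ← zpow_one_add, add_comm]
  | pred m ih =>
    have h := hone fun i => μ i + (-m - 1)
    simp only [add_assoc, sub_add_cancel] at h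
    rw [ih] at h
    rw [zpow_sub_one, mul_comm (u ^ (-(m : ℤ))), Units.val_mul, mul_assoc, h,
      ← mul_assoc, ← Units.val_mul, inv_mul_cancel, Units.val_one, one_mul]

/-- The weighted values `q ^ heightZ ν * W(ϖ^ν)` satisfy Pieri's rule, with `c i` the eigenvalue of
`T^{(i+1)}` times `q ^ (i (i + 1) / 2)`: the terms of non-decreasing type drop out by
`sphericalWhittaker_eq_zero`. -/
theorem whittaker_eq_schurPoly {ϖ : Fˣ} (hϖ : IsUniformizer ϖ) (hψ : HasConductorZero ψ)
    (hunit : ∀ t, ψ t ≠ 1 → IsUnit (ψ t - 1)) {W : GL → R}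
    (hW : W ∈ sphericalWhittaker n ψ R) {q : Rˣ} (hq : (q : R) = Nat.card 𝓀[F])
    (hT : ∀ j : ℕ, 1 ≤ j → j ≤ n → act (heckeT n A ϖ j) W = χ (heckeT n A ϖ j) • W)
    {μ : Fin n → ℕ} (hμ : Antitone μ) :
    W (powDiag ϖ fun i => (μ i : ℤ)) =
      ((q ^ (∑ i : Fin n, (((i : ℤ) + 1) - (n : ℤ)) * (μ i : ℤ)) : Rˣ) : R) *
        MvPolynomial.aeval (fun i : Fin n => (q : R) ^ (((i : ℕ) + 1) * (i : ℕ) / 2) *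
          χ (heckeT n A ϖ ((i : ℕ) + 1))) (schurPoly μ) * W 1 := by
  have hanti : ∀ ν : Fin n → ℕ, Antitone (fun i => (ν i : ℤ)) ↔ Antitone ν := fun ν =>
    ⟨fun h a b hab => Int.ofNat_le.1 (h hab), fun h a b hab => Int.ofNat_le.2 (h hab)⟩
  have h := eq_aeval_schurPoly (fun ν : Fin n → ℕ =>
    ((q ^ heightZ (fun i => (ν i : ℤ)) : Rˣ) : R) * W (powDiag ϖ fun i => (ν i : ℤ)))
    (fun i : Fin n => (q : R) ^ (((i : ℕ) + 1) * (i : ℕ) / 2) *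
      χ (heckeT n A ϖ ((i : ℕ) + 1))) (fun ν hν i => ?_) hμ
  · have h0 : (fun i : Fin n => ((0 : Fin n → ℕ) i : ℤ)) = 0 := by
      ext i
      simp
    have hz : heightZ (0 : Fin n → ℤ) = 0 := by simp [heightZ]
    rw [h0, powDiag_zero, hz, zpow_zero, Units.val_one, one_mul] at h
    have hneg : ∑ i : Fin n, (((i : ℤ) + 1) - (n : ℤ)) * (μ i : ℤ) =
        -heightZ fun i => (μ i : ℤ) := by
      rw [heightZ, ← Finset.sum_neg_distrib]
      exact Finset.sum_congr rfl fun i _ => by ring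
    rw [hneg, zpow_neg, mul_assoc, ← h, ← mul_assoc, ← Units.val_mul, inv_mul_cancel,
      Units.val_one, one_mul]
  · have h1 := pieri_whittaker hϖ hψ hW hq (j := i + 1) i.2 ((hanti ν).2 hν)
    rw [hT _ (by omega) i.2, Pi.smul_apply, smul_eq_mul, Nat.add_sub_cancel] at h1
    rw [mul_assoc, mul_left_comm (χ _), h1, Finset.sum_filter]
    refine Finset.sum_congr rfl fun I _ => ?_
    have hadd : (fun i => ((ν + ind I) i : ℤ)) = (fun i => (ν i : ℤ)) + indZ I := by
      ext i
      simp [indZ]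
    rw [hadd]
    split_ifs with ha
    · rfl
    · rw [sphericalWhittaker_eq_zero hϖ hψ hunit hW, mul_zero]
      rwa [← hadd, hanti]

/-- The formula is read backwards: the values it prescribes define `W`. At dominant weights the
eigenvalue equation is Pieri's rule for Schur polynomials, and at the others both sides vanish
because both are spherical Whittaker functions. -/
theorem exists_eigenWhittaker {ϖ : Fˣ} (hϖ : IsUniformizer ϖ) (hψ : HasConductorZero ψ)
    (hunit : ∀ t, ψ t ≠ 1 → IsUnit (ψ t - 1)) {q u : Rˣ} (hq : (q : R) = Nat.card 𝓀[F])
    (hu : (u : R) = χ (heckeT n A ϖ n)) : ∃ W ∈ eigenWhittaker ψ χ, W 1 = 1 := by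
  set c : Fin n → R := fun i => (q : R) ^ (((i : ℕ) + 1) * (i : ℕ) / 2) *
    χ (heckeT n A ϖ ((i : ℕ) + 1)) with hc
  -- This is the value substituted for `T_n`; that it is a unit allows negative weights.
  set e : Rˣ := q ^ (n * (n - 1) / 2) * u with he'
  have he : ∀ i : Fin n, (i : ℕ) + 1 = n → c i = e := by
    intro i hi
    have hi' : (i : ℕ) = n - 1 := by omega
    simp only [hc]
    rw [hi, ← hu, hi', he', Units.val_mul, Units.val_pow_eq_pow_val]
  have he0 : n = 0 → e = 1 := by
    intro hn
    have hu1 : u = 1 := by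
      ext
      rw [hu, heckeT_zero_of_eq_zero hn, map_one, Units.val_one]
    rw [he', hu1, hn]
    simp
  set w : (Fin n → ℤ) → R := fun μ => ((q ^ (-heightZ μ) : Rˣ) : R) * schurValue c e μ with hw'
  have hw : ∀ μ, ¬ Antitone μ → w μ = 0 := fun μ hμ => by
    simp only [hw']
    rw [schurValue_eq_zero c e hμ, mul_zero]
  have hqw : ∀ μ, ((q ^ heightZ μ : Rˣ) : R) * w μ = schurValue c e μ := by
    intro μ
    simp only [hw']
    rw [← mul_assoc, ← Units.val_mul, ← zpow_add, add_neg_cancel, zpow_zero, Units.val_one,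
      one_mul]
  set W := whittakerExtend hϖ ψ w with hWdef
  have hW : W ∈ sphericalWhittaker n ψ R := whittakerExtend_mem hϖ hψ hw
  have hWval : ∀ μ, W (powDiag ϖ μ) = w μ := whittakerExtend_powDiag hϖ hψ hw
  have hT : ∀ j, 1 ≤ j → j ≤ n → act (heckeT n A ϖ j) W = χ (heckeT n A ϖ j) • W := by
    intro j hj1 hjn
    have hact := act_mem_sphericalWhittaker hW (heckeT n A ϖ j)
    refine sphericalWhittaker_ext hϖ hact (Submodule.smul_mem _ _ hW) fun μ => ?_
    by_cases hμ : Antitone μ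
    · have h1 := pieri_whittaker hϖ hψ hW hq hjn hμ
      have h2 := pieri_schurValue he he0 hμ ⟨j - 1, by omega⟩
      have hj : j - 1 + 1 = j := by omega
      simp only [hWval, hqw] at h1
      simp only [hc, hj] at h2
      rw [← h2, ← hqw] at h1
      have hcancel : IsUnit ((q : R) ^ (j * (j - 1) / 2) * ((q ^ heightZ μ : Rˣ) : R)) :=
        (q.isUnit.pow _).mul (Units.isUnit _)
      rw [← mul_assoc] at h1
      refine hcancel.mul_left_cancel (h1.trans ?_)
      rw [Pi.smul_apply, smul_eq_mul, hWval]
      ring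
    · rw [sphericalWhittaker_eq_zero hϖ hψ hunit hact hμ, Pi.smul_apply,
        sphericalWhittaker_eq_zero hϖ hψ hunit hW hμ, smul_zero]
  refine ⟨W, mem_eigenWhittaker χ hϖ hW hT ?_, ?_⟩
  · rcases Nat.eq_zero_or_pos n with hn | hn
    · rw [heckeT_zero_of_eq_zero hn, act_one hW.2, map_one, one_smul]
    · exact hT n hn le_rfl
  · have h := hWval 0
    rw [powDiag_zero] at h
    rw [h]
    simp only [hw']
    rw [schurValue_zero]
    simp [heightZ]

end EigenWhittaker
end Shintani

theorem mainTheorem10 {p ℓ : ℕ} [Fact p.Prime] [Fact ℓ.Prime] (hℓp : ℓ ≠ p)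
    {F : Type*} [Field F] [ValuativeRel F] [TopologicalSpace F] [IsNonarchimedeanLocalField F]
    [CharP 𝓀[F] p]
    {k : Type*} [Field k] [IsAlgClosed k] [CharP k ℓ]
    (n : ℕ) (ϖ : Fˣ) (hϖ : Shintani.IsUniformizer ϖ)
    (ψ : AddChar F (WittVector ℓ k)) (hψ : Shintani.HasConductorZero ψ)
    {R : Type*} [CommRing R] [Algebra (WittVector ℓ k) R]
    (χ : Shintani.HeckeAlgebra (WittVector ℓ k) (Shintani.maxCompact F n) →ₐ[WittVector ℓ k] R) :
    ∃ q u : Rˣ, (q : R) = (Nat.card 𝓀[F] : R) ∧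
      (u : R) = χ (Shintani.heckeT n (WittVector ℓ k) ϖ n) ∧
      (∀ W ∈ Shintani.sphericalWhittaker n ψ R,
        (∀ j : ℕ, 1 ≤ j → j ≤ n →
          Shintani.HeckeAlgebra.act (Shintani.heckeT n (WittVector ℓ k) ϖ j) W =
            χ (Shintani.heckeT n (WittVector ℓ k) ϖ j) • W) →
        (∀ μ : Fin n → ℕ, Antitone μ →
          W (Shintani.powDiag ϖ fun i => (μ i : ℤ)) =
            ((q ^ (∑ i : Fin n, (((i : ℤ) + 1) - (n : ℤ)) * (μ i : ℤ)) : Rˣ) : R) *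
              MvPolynomial.aeval
                (fun i : Fin n => (q : R) ^ (((i : ℕ) + 1) * (i : ℕ) / 2) *
                  χ (Shintani.heckeT n (WittVector ℓ k) ϖ ((i : ℕ) + 1)))
                (Shintani.schurPoly μ) * W 1) ∧
        (∀ (μ : Fin n → ℤ) (m : ℤ),
          W (Shintani.powDiag ϖ fun i => μ i + m) =
            ((u ^ m : Rˣ) : R) * W (Shintani.powDiag ϖ μ)) ∧
        (∀ μ : Fin n → ℤ, ¬ Antitone μ → W (Shintani.powDiag ϖ μ) = 0)) ∧
      Function.Bijective (Shintani.evalOne ψ χ) := by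
  classical
  have hunit := Shintani.addChar_sub_one_isUnit (p := p) hℓp hϖ hψ
  obtain ⟨q, hq'⟩ := (Shintani.residueCard_isUnit (F := F) (k := k) hℓp).map
    (algebraMap (WittVector ℓ k) R)
  have hq : (q : R) = (Nat.card 𝓀[F] : R) := by rw [hq', map_natCast]
  -- The inverse of `T^{(n)}` in the Hecke algebra is the indicator of `ϖ⁻¹ K`.
  obtain ⟨u, hu⟩ : IsUnit (χ (Shintani.heckeT n (WittVector ℓ k) ϖ n)) :=
    IsUnit.of_mul_eq_one _ (by
      rw [← map_mul, Shintani.heckeT_last_mul_inv hϖ, map_one])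
  set c : Fin n → R := fun i => (q : R) ^ (((i : ℕ) + 1) * (i : ℕ) / 2) *
    χ (Shintani.heckeT n (WittVector ℓ k) ϖ ((i : ℕ) + 1)) with hc
  have hshift : ∀ W ∈ Shintani.sphericalWhittaker n ψ R,
      (∀ j : ℕ, 1 ≤ j → j ≤ n →
        Shintani.HeckeAlgebra.act (Shintani.heckeT n (WittVector ℓ k) ϖ j) W =
          χ (Shintani.heckeT n (WittVector ℓ k) ϖ j) • W) →
      ∀ (μ : Fin n → ℤ) (m : ℤ), W (Shintani.powDiag ϖ fun i => μ i + m) =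
        ((u ^ m : Rˣ) : R) * W (Shintani.powDiag ϖ μ) := by
    intro W hW hT
    exact Shintani.whittaker_shift χ hϖ hW (fun hn => hT n hn le_rfl) hu
  have hval : ∀ W ∈ Shintani.sphericalWhittaker n ψ R,
      (∀ j : ℕ, 1 ≤ j → j ≤ n →
        Shintani.HeckeAlgebra.act (Shintani.heckeT n (WittVector ℓ k) ϖ j) W =
          χ (Shintani.heckeT n (WittVector ℓ k) ϖ j) • W) →
      ∀ μ : Fin n → ℕ, Antitone μ → W (Shintani.powDiag ϖ fun i => (μ i : ℤ)) =
        ((q ^ (∑ i : Fin n, (((i : ℤ) + 1) - (n : ℤ)) * (μ i : ℤ)) : Rˣ) : R) *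
          MvPolynomial.aeval c (Shintani.schurPoly μ) * W 1 := fun W hW hT μ hμ =>
    Shintani.whittaker_eq_schurPoly χ hϖ hψ hunit hW hq hT hμ
  refine ⟨q, u, hq, hu, fun W hW hT => ⟨hval W hW hT, hshift W hW hT, fun μ hμ =>
    Shintani.sphericalWhittaker_eq_zero hϖ hψ hunit hW hμ⟩, ?_, ?_⟩
  · rw [injective_iff_map_eq_zero]
    rintro ⟨W, hW, hT⟩ h1
    replace h1 : W 1 = 0 := h1
    refine Subtype.ext (Shintani.sphericalWhittaker_ext hϖ hW (zero_mem _) fun μ => ?_)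
    change W (Shintani.powDiag ϖ μ) = 0
    by_cases hμ : Antitone μ
    -- The formula covers only non-negative weights, so `μ` is first shifted; the unit `u ^ m`
    -- carries the vanishing back to `μ`.
    · have h2 := hval W hW (fun j _ _ => hT _) _
        (Shintani.shiftNat_antitone hμ (Shintani.shiftOf μ))
      rw [h1, mul_zero] at h2
      have h3 := hshift W hW (fun j _ _ => hT _) μ (Shintani.shiftOf μ)
      have h4 : (fun i => μ i + (Shintani.shiftOf μ : ℤ)) =
          fun i => (Shintani.shiftNat μ (Shintani.shiftOf μ) i : ℤ) := by
        ext i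
        have := Shintani.shiftOf_nonneg μ i
        simp only [Shintani.shiftNat]
        omega
      rw [h4, h2] at h3
      exact (Units.isUnit _).mul_right_eq_zero.1 h3.symm
    · exact Shintani.sphericalWhittaker_eq_zero hϖ hψ hunit hW hμ
  · obtain ⟨W, hW, h1⟩ := Shintani.exists_eigenWhittaker χ hϖ hψ hunit hq hu
    refine fun r => ⟨r • ⟨W, hW⟩, ?_⟩
    change r * W 1 = r
    rw [h1, mul_one]
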